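/- Let $m,\lambda,\beta>0$, $n\in\mathbb N$, $M=\mathbb R\times\mathbb R^3\ni x=(t,\mathbf x)$, $\omega(\mathbf p)=\sqrt{|\mathbf p|^2+m^2}$, and $$\Delta_{+,\lambda}(t,\mathbf x)=\frac{e^{-\lambda^2m^2}}{(2\pi)^3}\int_{\mathbb R^3}\frac{e^{-2\lambda^2|\mathbf p|^2}e^{i\mathbf p\cdot\mathbf x}}{2\omega(\mathbf p)}e^{-it\omega(\mathbf p)}\,d\mathbf p,$$ $$\Delta_{\beta,\lambda}(t,\mathbf x)=\frac{e^{-\lambda^2m^2}}{(2\pi)^3}\int_{\mathbb R^3}\frac{e^{-2\lambda^2|\mathbf p|^2}e^{i\mathbf p\cdot\mathbf x}}{2\omega(\mathbf p)}\Big(\frac{e^{-it\omega(\mathbf p)}}{1-e^{-\beta\omega(\mathbf p)}}-\frac{e^{it\omega(\mathbf p)}}{1-e^{\beta\omega(\mathbf p)}}\Big)d\mathbf p,$$ $\Delta_{F,\lambda}(x)=\theta(t)\Delta_{+,\lambda}(x)+\theta(-t)\Delta_{+,\lambda}(-x)$. Let $\mathcal A$ be the space of finite sums of functionals $A(\phi)=\int_{M^\ell}f(x_1,\dots,x_\ell)\phi(x_1)^{n_1}\cdots\phi(x_\ell)^{n_\ell}\,dx_1\cdots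 dx_\ell$ of fields $\phi\in C^\infty(M;\mathbb R)\cap\mathcal S'(M)$, with $f$ continuous of compact support. For a function $D$ on $M$ put $\Gamma_D=\int D(x-y)\frac{\delta}{\delta\phi(x)}\otimes\frac{\delta}{\delta\phi(y)}\,dx\,dy$, let $\mathsf m(A\otimes B)(\phi)=A(\phi)B(\phi)$, and define on $\mathcal A$ the products $A\star_\lambda B=\mathsf m\,e^{\Gamma_{\Delta_{+,\lambda}}}(A\otimes B)$ and $A\cdot_{T_\lambda}B=\mathsf m\,e^{\Gamma_{\Delta_{F,\lambda}}}(A\otimes B)$, the free time evolution $\alpha_t(A)(\phi)=A(\phi(\cdot+te_0))$, where $e_0=(1,0)$, and the free KMS state $$\omega_{\lambda,\beta}(A)=\Big(e^{\frac12\int[\Delta_{\beta,\lambda}-\Delta_{+,\lambda}](x-y)\frac{\delta^2}{\delta\phi(x)\delta\phi(y)}\,dx\,dy}A\Big)(0).$$ All of this is extended to formal power series in the coupling constant with coefficients in $\mathcal A$, denoted $\mathcal A[[g]]$; an interaction $V\in\mathcal A$ counts as first order. Put $$S(V)=\sum_k\frac{(-i)^k}{k!}V^{\cdot_{T_\lambda}k},\qquad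 R_V(A)=S(V)^{-1}\star_\lambda\big(S(V)\cdot_{T_\lambda}A\big),$$ the inverse being taken with respect to $\star_\lambda$. The map $R_V$ is invertible on $\mathcal A[[g]]$ with $R_V^{-1}(B)=S(-V)\cdot_{T_\lambda}(S(V)\star_\lambda B)$, and the interacting time evolution $\alpha^V_t$ is given by $\alpha_t^V(R_V(A))=R_V(\alpha_t(A))$, that is, $\alpha_t^V=R_V\circ\alpha_t\circ R_V^{-1}$. Let $V=V_{\chi,h}=\int_M\chi(t)h(\mathbf x)\phi(x)^n\,dx$ with $h\in C_0^\infty(\mathbb R^3;\mathbb R)$ and with $\chi\in C^\infty(\mathbb R;\mathbb R)$ such that, for some $\varepsilon>0$, $\chi=1$ on $[-\varepsilon,\infty)$ and $\chi=0$ on $(-\infty,-2\varepsilon]$. Since $\chi$ is not compactly supported, $\alpha^V_t(B)$ is understood as follows: for all $t\in\mathbb R$, $B\in\mathcal A[[g]]$ and each order $k$ there is $T$ such that the $k$-th order coefficient of $\alpha_t^{V_{\chi',h}}(B)$ is one and the same functional for all $\chi'\in C_0^\infty(\mathbb R;\mathbb R)$ with $\chi'=\chi$ on $(-\infty,T]$;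 this functional, an element of $\mathcal A$, is the $k$-th order coefficient of $\alpha^V_t(B)$. Then $\alpha_t^V(B)$ is well defined in this sense, and for all $A,B\in\mathcal A[[g]]$ the clustering condition $$\lim_{t\to+\infty}\Big(\omega_{\lambda,\beta}\big(A\star_\lambda\alpha^V_t(B)\big)-\omega_{\lambda,\beta}(A)\,\omega_{\lambda,\beta}\big(\alpha^V_t(B)\big)\Big)=0$$ holds at each order of perturbation theory; more precisely, for every $k$ the coefficient of order $k$ of the difference is $O(t^{-3/2})$ as $t\to+\infty$. -/

import Mathlib

open MeasureTheory Filter Topology Asymptotics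
open scoped ContDiff SchwartzMap CompactlySupported RealInnerProductSpace

noncomputable section

namespace QST

/-! ### Spacetime, parameters, field configurations -/

/-- The time-zero plane `ℝ³`. -/
abbrev Space := EuclideanSpace ℝ (Fin 3)

/-- Points `x = (t, 𝐱)` of four-dimensional Minkowski spacetime. -/
abbrev Spacetime := ℝ × Space

/-- The two parameters of the free theory: the mass `m > 0` of the field and the
(Planck) length `λ > 0` of quantum spacetime. -/
structure Params where
  mass : ℝ
  planck : ℝ
  mass_pos : 0 < mass
  planck_pos : 0 < planck

/-- Field configurations: real smooth functions on spacetime which are tempered distributions. -/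
structure Config where
  toFun : Spacetime → ℝ
  smooth : ContDiff ℝ ∞ toFun
  tempered : ∃ u : 𝓢'(Spacetime, ℂ), ∀ f : 𝓢(Spacetime, ℂ), HasCompactSupport f →
    u f = ∫ x, f x * (toFun x : ℂ)

/-! ### The modified propagators -/

/-- The relativistic energy `ω(𝐩) = √(|𝐩|² + m²)`. -/
def energy (P : Params) (p : Space) : ℝ := √(‖p‖ ^ 2 + P.mass ^ 2)

/-- The weight `e^{-2 λ² |𝐩|²} / (2 ω(𝐩))` of the momentum `𝐩`. -/
def weight (P : Params) (p : Space) : ℝ :=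
  Real.exp (-2 * P.planck ^ 2 * ‖p‖ ^ 2) / (2 * energy P p)

/-- The constant `e^{-λ² m²} / (2π)³`. -/
def prefactor (P : Params) : ℝ :=
  Real.exp (-P.planck ^ 2 * P.mass ^ 2) / (2 * Real.pi) ^ 3

/-- The vacuum two-point function `Δ_{+,λ}(t, 𝐱)`. -/
def vacuumFun (P : Params) (x : Spacetime) : ℂ :=
  (prefactor P : ℂ) * ∫ p : Space, (weight P p : ℂ) *
    Complex.exp (Complex.I * (⟪p, x.2⟫ : ℝ)) * Complex.exp (-Complex.I * x.1 * energy P p)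

/-- The thermal two-point function `Δ_{β,λ}(t, 𝐱)` at inverse temperature `β`. -/
def thermalFun (P : Params) (β : ℝ) (x : Spacetime) : ℂ :=
  (prefactor P : ℂ) * ∫ p : Space, (weight P p : ℂ) *
    Complex.exp (Complex.I * (⟪p, x.2⟫ : ℝ)) *
      (Complex.exp (-Complex.I * x.1 * energy P p) / (1 - Real.exp (-β * energy P p) : ℝ)
        - Complex.exp (Complex.I * x.1 * energy P p) / (1 - Real.exp (β * energy P p) : ℝ))

/-- The Feynman propagator
`Δ_{F,λ}(x) = θ(x⁰) Δ_{+,λ}(x) + θ(-x⁰) Δ_{+,λ}(-x)`. The two expressions agree at `x⁰ = 0`. -/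
def feynmanFun (P : Params) (x : Spacetime) : ℂ :=
  if 0 ≤ x.1 then vacuumFun P x else vacuumFun P (-x)

/-! Continuity of the propagators. -/

theorem mass_le_energy (P : Params) (p : Space) : P.mass ≤ energy P p :=
  Real.le_sqrt_of_sq_le (by nlinarith [sq_nonneg ‖p‖])

theorem energy_pos (P : Params) (p : Space) : 0 < energy P p :=
  P.mass_pos.trans_le (mass_le_energy P p)

theorem continuous_energy (P : Params) : Continuous (energy P) := by
  unfold energy; fun_prop

theorem continuous_weight (P : Params) : Continuous (weight P) := by
  unfold weight
  refine Continuous.div (by fun_prop) (continuous_const.mul (continuous_energy P)) fun p => ?_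
  have := energy_pos P p
  positivity

theorem weight_nonneg (P : Params) (p : Space) : 0 ≤ weight P p := by
  have := energy_pos P p
  unfold weight; positivity

theorem integrable_gauss (P : Params) :
    Integrable fun p : Space => Real.exp (-2 * P.planck ^ 2 * ‖p‖ ^ 2) := by
  have h := GaussianFourier.integrable_cexp_neg_mul_sq_norm_add (V := Space)
    (b := ((2 * P.planck ^ 2 : ℝ) : ℂ))
    (by have := P.planck_pos; rw [Complex.ofReal_re]; positivity) 0 0
  refine h.norm.congr (ae_of_all _ fun p => ?_)
  simp only [Complex.norm_exp]
  congr 1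
  simp [← Complex.ofReal_pow, ← Complex.ofReal_mul]

theorem integrable_weight (P : Params) : Integrable (weight P) := by
  refine ((integrable_gauss P).div_const (2 * P.mass)).mono'
    (continuous_weight P).aestronglyMeasurable (ae_of_all _ fun p => ?_)
  rw [Real.norm_of_nonneg (weight_nonneg P p), weight]
  have h1 := mass_le_energy P p
  have h2 := P.mass_pos
  gcongr

theorem continuous_integral_weight (P : Params) (F : Spacetime → Space → ℂ) (C : ℝ)
    (h1 : ∀ x, Continuous (F x)) (h2 : ∀ p, Continuous fun x => F x p)
    (hC : ∀ x p, ‖F x p‖ ≤ C) : Continuous fun x => ∫ p, (weight P p : ℂ) * F x p := by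
  refine continuous_of_dominated (bound := fun p => weight P p * C) (fun x => ?_)
    (fun x => ae_of_all _ fun p => ?_) ((integrable_weight P).mul_const C)
    (ae_of_all _ fun p => continuous_const.mul (h2 p))
  · exact ((Complex.continuous_ofReal.comp (continuous_weight P)).mul
      (h1 x)).aestronglyMeasurable
  · rw [norm_mul, Complex.norm_real, Real.norm_of_nonneg (weight_nonneg P p)]
    exact mul_le_mul_of_nonneg_left (hC x p) (weight_nonneg P p)

theorem continuous_vacuumFun (P : Params) : Continuous (vacuumFun P) := by
  have hE := continuous_energy P
  have := continuous_integral_weight P (fun x p => Complex.exp (Complex.I * (⟪p, x.2⟫ : ℝ)) *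
    Complex.exp (-Complex.I * x.1 * energy P p)) 1 (fun x => by fun_prop) (fun p => by fun_prop)
    (fun x p => by simp [Complex.norm_exp])
  unfold vacuumFun
  simp only [mul_assoc] at this ⊢
  exact continuous_const.mul this

theorem continuous_thermalFun (P : Params) {β : ℝ} (hβ : 0 < β) :
    Continuous (thermalFun P β) := by
  have hE := continuous_energy P
  have hm := P.mass_pos
  have hbm : 0 < β * P.mass := mul_pos hβ hm
  have e1 : Real.exp (-(β * P.mass)) < 1 := by rw [Real.exp_lt_one_iff]; linarith
  have e2 : 1 < Real.exp (β * P.mass) := by rw [Real.one_lt_exp_iff]; exact hbm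
  have b1 : ∀ p, 1 - Real.exp (-(β * P.mass)) ≤ 1 - Real.exp (-β * energy P p) := fun p => by
    have : Real.exp (-β * energy P p) ≤ Real.exp (-(β * P.mass)) := by
      rw [Real.exp_le_exp]; nlinarith [mass_le_energy P p]
    linarith
  have b2 : ∀ p, Real.exp (β * P.mass) - 1 ≤ Real.exp (β * energy P p) - 1 := fun p => by
    have : Real.exp (β * P.mass) ≤ Real.exp (β * energy P p) := by
      rw [Real.exp_le_exp]; nlinarith [mass_le_energy P p]
    linarith
  have n1 : ∀ p, ((1 - Real.exp (-β * energy P p) : ℝ) : ℂ) ≠ 0 := fun p => by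
    rw [Complex.ofReal_ne_zero]; have := b1 p; linarith
  have n2 : ∀ p, ((1 - Real.exp (β * energy P p) : ℝ) : ℂ) ≠ 0 := fun p => by
    rw [Complex.ofReal_ne_zero]; have := b2 p; linarith
  have := continuous_integral_weight P (fun x p => Complex.exp (Complex.I * (⟪p, x.2⟫ : ℝ)) *
      (Complex.exp (-Complex.I * x.1 * energy P p) / (1 - Real.exp (-β * energy P p) : ℝ)
        - Complex.exp (Complex.I * x.1 * energy P p) / (1 - Real.exp (β * energy P p) : ℝ)))
    (1 / (1 - Real.exp (-(β * P.mass))) + 1 / (Real.exp (β * P.mass) - 1))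
    (fun x => by
      refine Continuous.mul (by fun_prop) (Continuous.sub ?_ ?_)
      · exact Continuous.div (by fun_prop) (by fun_prop) n1
      · exact Continuous.div (by fun_prop) (by fun_prop) n2)
    (fun p => by fun_prop)
    (fun x p => by
      rw [norm_mul]
      have h0 : ‖Complex.exp (Complex.I * (⟪p, x.2⟫ : ℝ))‖ = 1 := by simp [Complex.norm_exp]
      rw [h0, one_mul]
      refine (norm_sub_le _ _).trans (add_le_add ?_ ?_)
      · rw [norm_div, Complex.norm_real, Real.norm_of_nonneg (by have := b1 p; linarith)]
        have : ‖Complex.exp (-Complex.I * x.1 * energy P p)‖ = 1 := by simp [Complex.norm_exp]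
        rw [this]
        exact one_div_le_one_div_of_le (by linarith) (b1 p)
      · rw [norm_div, Complex.norm_real, Real.norm_of_nonpos (by have := b2 p; linarith), neg_sub]
        have : ‖Complex.exp (Complex.I * x.1 * energy P p)‖ = 1 := by simp [Complex.norm_exp]
        rw [this]
        exact one_div_le_one_div_of_le (by linarith) (b2 p))
  unfold thermalFun
  simp only [mul_assoc] at this ⊢
  exact continuous_const.mul this

theorem continuous_feynmanFun (P : Params) : Continuous (feynmanFun P) := by
  have hv := continuous_vacuumFun P
  refine Continuous.if_le hv (hv.comp continuous_neg) continuous_const continuous_fst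
    fun x hx => ?_
  unfold vacuumFun
  congr 1
  rw [← integral_neg_eq_self]
  refine integral_congr_ae (ae_of_all _ fun p => ?_)
  simp [← hx, weight, energy]

/-- `Δ_{+,λ}` as a continuous function. -/
def vacuum (P : Params) : C(Spacetime, ℂ) := ⟨vacuumFun P, continuous_vacuumFun P⟩

/-- `Δ_{β,λ}` as a continuous function. -/
def thermal (P : Params) {β : ℝ} (hβ : 0 < β) : C(Spacetime, ℂ) :=
  ⟨thermalFun P β, continuous_thermalFun P hβ⟩

/-- `Δ_{F,λ}` as a continuous function. -/
def feynman (P : Params) : C(Spacetime, ℂ) := ⟨feynmanFun P, continuous_feynmanFun P⟩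

/-! ### Observables -/

/-- Kernels: continuous compactly supported functions of `l` spacetime points. -/
abbrev Kernel (l : ℕ) := C_c(Fin l → Spacetime, ℂ)

/-- The observables: finite sums of multilocal functionals
`φ ↦ ∫ f(x₁,…,x_l) φ(x₁)^{n₁} ⋯ φ(x_l)^{n_l} dx₁ ⋯ dx_l`, where `f` is continuous with compact
support and where `l` and the exponents are arbitrary. An observable is given by its kernels `f`,
one for each `(l, n)` with finitely many of them nonzero; the functional which it stands for is
`Obs.eval`. -/
abbrev Obs := Π₀ i : (l : ℕ) × (Fin l → ℕ), Kernel i.1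

/-- The multilocal functional with kernel `f` and exponents `n`. -/
def monomial {l : ℕ} (n : Fin l → ℕ) (f : Kernel l) : Obs := DFinsupp.single ⟨l, n⟩ f

open Classical in
/-- The value of an observable at the field `φ`. -/
def Obs.eval (A : Obs) (φ : Spacetime → ℝ) : ℂ :=
  A.sum fun i f => ∫ X : Fin i.1 → Spacetime, f X * ∏ k, (φ (X k) : ℂ) ^ i.2 k

/-- The constant functional `1`: the multilocal functional of no points with kernel `1`. -/
def Obs.unit : Obs :=
  monomial (l := 0) ![] ⟨ContinuousMap.const _ 1, HasCompactSupport.of_compactSpace _⟩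

/-- `d_i = ∑_j (c_{ij} + c_{ji})`, the number of derivatives `∂/∂φ(x_i)` contained in
`∏_{i,j} (∂²/∂φ(x_i)∂φ(x_j))^{c_{ij}}`. -/
def legs {l : ℕ} (c : Fin l → Fin l → ℕ) (i : Fin l) : ℕ := ∑ j, (c i j + c j i)

/-- The exponential of the second order operator `∑_{i,j} Q_{ij}(X) ∂²/∂φ(x_i)∂φ(x_j)`, applied
under the integral sign to the multilocal functional with kernel `f` and exponents `n`. As the
partial derivatives commute, the exponential is
`∑_c ∏_{i,j} Q_{ij}^{c_{ij}} / c_{ij}! · ∏_i (∂/∂φ(x_i))^{d_i}`,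
and `∂^d φ^n = n (n-1) ⋯ (n-d+1) φ^{n-d}`, which vanishes for `d > n`; so it is enough to let
`c_{ij}` run through `0, …, n_i`. -/
def expQuad {l : ℕ} (Q : Fin l → Fin l → C(Fin l → Spacetime, ℂ)) (n : Fin l → ℕ)
    (f : Kernel l) : Obs :=
  ∑ c ∈ Fintype.piFinset fun i => Fintype.piFinset fun _ : Fin l => Finset.range (n i + 1),
    monomial (fun i => n i - legs c i)
      (((∏ i, ((n i).descFactorial (legs c i) : ℂ)) / ∏ i, ∏ j, ((c i j).factorial : ℂ)) •
        ((∏ i, ∏ j, Q i j ^ c i j : C(Fin l → Spacetime, ℂ)) • f))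

/-- The function `X ↦ D(x_i - x_j)`. -/
def edge (D : C(Spacetime, ℂ)) {l : ℕ} (i j : Fin l) : C(Fin l → Spacetime, ℂ) :=
  ⟨fun X => D (X i - X j), by fun_prop⟩

/-- The kernel `f(x₁,…,x_l) g(y₁,…,y_{l'})` of a pointwise product. -/
def tensor {l l' : ℕ} (f : Kernel l) (g : Kernel l') : Kernel (l + l') where
  toFun Z := f (fun i => Z (Fin.castAdd l' i)) * g (fun j => Z (Fin.natAdd l j))
  continuous_toFun := by
    have hf := f.continuous
    have hg := g.continuous
    fun_prop
  hasCompactSupport' := by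
    have hK : IsCompact ((fun q : (Fin l → Spacetime) × (Fin l' → Spacetime) =>
        (Fin.append q.1 q.2 : Fin (l + l') → Spacetime)) ''
          (tsupport f ×ˢ tsupport g)) := by
      refine (f.hasCompactSupport.isCompact.prod g.hasCompactSupport.isCompact).image ?_
      refine continuous_pi fun k => ?_
      refine Fin.addCases (fun i => ?_) (fun j => ?_) k
      · simp only [Fin.append_left]; fun_prop
      · simp only [Fin.append_right]; fun_prop
    refine HasCompactSupport.intro hK fun Z hZ => ?_
    by_contra hne
    refine hZ ⟨(fun i => Z (Fin.castAdd l' i), fun j => Z (Fin.natAdd l j)),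
      ⟨subset_tsupport _ (left_ne_zero_of_mul hne), subset_tsupport _ (right_ne_zero_of_mul hne)⟩,
      ?_⟩
    exact Fin.append_castAdd_natAdd

open Classical in
/-- The product `m ∘ e^{Γ_D} (A ⊗ B)` with
`Γ_D = ∫ D(x - y) δ/δφ(x) ⊗ δ/δφ(y) dx dy`. On multilocal functionals with points `x_i` and `y_j`
one has `Γ_D = ∑_{i,j} D(x_i - y_j) ∂/∂φ(x_i) ⊗ ∂/∂φ(y_j)`. -/
def Obs.mul (D : C(Spacetime, ℂ)) (A B : Obs) : Obs :=
  A.sum fun i f => B.sum fun j g =>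
    expQuad (fun r s : Fin (i.1 + j.1) => if r.val < i.1 ∧ i.1 ≤ s.val then edge D r s else 0)
      (Fin.append i.2 j.2) (tensor f g)

open Classical in
/-- The map `A ↦ exp(½ ∫ W(x - y) δ²/δφ(x)δφ(y) dx dy) A`. On multilocal functionals the exponent
is `½ ∑_{i,j} W(x_i - x_j) ∂²/∂φ(x_i)∂φ(x_j)`. -/
def Obs.deform (W : C(Spacetime, ℂ)) (A : Obs) : Obs :=
  A.sum fun i f => expQuad (fun r s => (1 / 2 : ℂ) • edge W r s) i.2 f

/-- The free vacuum state `ω_λ(A) = A(0)`. -/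
def vacuumState (A : Obs) : ℂ := A.eval 0

/-- The free KMS state `ω_{λ,β}` at inverse temperature `β`. -/
def kmsState (P : Params) {β : ℝ} (hβ : 0 < β) (A : Obs) : ℂ :=
  vacuumState (A.deform (thermal P hβ - vacuum P))

/-- The kernel `f(x₁ - t e₀, …, x_l - t e₀)`. -/
def Kernel.shift (t : ℝ) {l : ℕ} (f : Kernel l) : Kernel l where
  toFun X := f (fun i => X i - (t, 0))
  continuous_toFun := by
    have hf := f.continuous
    fun_prop
  hasCompactSupport' := by
    have hK : IsCompact ((fun (X : Fin l → Spacetime) (i : Fin l) => X i + ((t, 0) : Spacetime)) ''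
        tsupport f) := f.hasCompactSupport.isCompact.image (by fun_prop)
    refine HasCompactSupport.intro hK fun X hX => ?_
    by_contra hne
    exact hX ⟨_, subset_tsupport _ hne, funext fun i => sub_add_cancel (X i) _⟩

open Classical in
/-- The free time evolution `α_t(A)[φ] = A[φ(· + t e₀)]`. -/
def Obs.evolve (t : ℝ) (A : Obs) : Obs :=
  A.sum fun i f => monomial i.2 (Kernel.shift t f)

/-- The interaction `V_{χ,h} = ∫ χ(x⁰) h(𝐱) φ(x)^n dx`. -/
def interaction (n : ℕ) (χ : C_c(ℝ, ℝ)) (h : C_c(Space, ℝ)) : Obs :=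
  monomial (l := 1) ![n]
    { toFun := fun X => ((χ (X 0).1 * h (X 0).2 : ℝ) : ℂ)
      continuous_toFun := by
        have h1 := χ.continuous
        have h2 := h.continuous
        fun_prop
      hasCompactSupport' := by
        have hK : IsCompact ((fun (x : Spacetime) (_ : Fin 1) => x) ''
            (tsupport χ ×ˢ tsupport h)) :=
          (χ.hasCompactSupport.isCompact.prod h.hasCompactSupport.isCompact).image (by fun_prop)
        refine HasCompactSupport.intro hK fun X hX => ?_
        by_contra hne
        have hne' := Complex.ofReal_ne_zero.1 hne
        refine hX ⟨X 0, ⟨subset_tsupport _ (left_ne_zero_of_mul hne'),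
          subset_tsupport _ (right_ne_zero_of_mul hne')⟩, ?_⟩
        funext i
        rw [Subsingleton.elim i 0] }

/-! ### Formal power series in the coupling and the interacting dynamics -/

/-- Formal power series in the coupling constant with coefficients in the observables. -/
abbrev Series := ℕ → Obs

/-- The extension of the product `Obs.mul D` to formal power series. -/
def Series.mul (D : C(Spacetime, ℂ)) (A B : Series) : Series := fun k =>
  ∑ j ∈ Finset.range (k + 1), (A j).mul D (B (k - j))

/-- The product `⋆_λ`, given by the vacuum two-point function `Δ_{+,λ}`. -/
def Series.star (P : Params) (A B : Series) : Series := Series.mul (vacuum P) A B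

/-- The time ordered product `·_{T_λ}`, given by the Feynman propagator `Δ_{F,λ}`. -/
def Series.timeOrd (P : Params) (A B : Series) : Series := Series.mul (feynman P) A B

/-- The powers of `V` with respect to the time ordered product. -/
def timeOrdPow (P : Params) (V : Obs) : ℕ → Obs
  | 0 => Obs.unit
  | k + 1 => V.mul (feynman P) (timeOrdPow P V k)

/-- The `S` matrix `S(V) = ∑_k (-i)^k / k! · V ·_{T_λ} ⋯ ·_{T_λ} V`, where `V` is of first order
in the coupling. -/
def sMatrix (P : Params) (V : Obs) : Series := fun k =>
  ((-Complex.I) ^ k / (k.factorial : ℂ)) • timeOrdPow P V k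

/-- The inverse, with respect to `⋆_λ`, of a formal power series with constant term `1`. -/
def Series.starInv (P : Params) (S : Series) : ℕ → Obs
  | 0 => Obs.unit
  | k + 1 => -∑ j : Fin (k + 1), (S (j.val + 1)).mul (vacuum P) (Series.starInv P S (k - j.val))
  decreasing_by omega

/-- The Bogoliubov map `R_V(A) = S(V)^{-1} ⋆_λ (S(V) ·_{T_λ} A)`. -/
def bogoliubov (P : Params) (V : Obs) (A : Series) : Series :=
  Series.star P (Series.starInv P (sMatrix P V)) (Series.timeOrd P (sMatrix P V) A)

/-- The inverse `R_V^{-1}(B) = S(-V) ·_{T_λ} (S(V) ⋆_λ B)` of the Bogoliubov map. -/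
def bogoliubovInv (P : Params) (V : Obs) (B : Series) : Series :=
  Series.timeOrd P (sMatrix P (-V)) (Series.star P (sMatrix P V) B)

/-- The interacting time evolution `R_V(A) ↦ R_V(A_t)`, applied to `B = R_V(A)`, for an
interaction `V` with compact support. -/
def evolveWith (P : Params) (V : Obs) (t : ℝ) (B : Series) : Series :=
  bogoliubov P V fun k => (bogoliubovInv P V B k).evolve t

/-- `B'` is the interacting time evolution `α_t^V(B)` for `V = V_{χ,h}`, where the time cutoff `χ`
does not vanish in the future. It is computed, at each order of perturbation theory, with any
smooth time cutoff `χ'` of compact support which agrees with `χ` up to a sufficiently late time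
(the result being the same functional for all of them). -/
def IsInteractingEvolution (P : Params) (n : ℕ) (χ : ℝ → ℝ) (h : C_c(Space, ℝ)) (t : ℝ)
    (B B' : Series) : Prop :=
  ∀ k : ℕ, ∃ T : ℝ, ∀ χ' : C_c(ℝ, ℝ), ContDiff ℝ ∞ χ' → (∀ s ≤ T, χ' s = χ s) →
    ∀ φ : Config,
      (evolveWith P (interaction n χ' h) t B k).eval φ.toFun = (B' k).eval φ.toFun

/-- The free KMS state on formal power series, with values in formal power series of numbers. -/
def kmsSeries (P : Params) {β : ℝ} (hβ : 0 < β) (A : Series) : PowerSeries ℂ :=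
  PowerSeries.mk fun k => kmsState P hβ (A k)

end QST

end

/-! Observables are tested by linear functionals, called observers, which are known through their
moments, the values on the monomials ∏ φ(x_i)^{n_i}. On the exponential generating function of the
moments the operator exp(∑ Q_ij ∂_i ∂_j) is multiplication by the power series exp(∑ Q_ij s_i s_j).
So every product of the theory becomes a multiplication of commuting symbols (`wick`, `contr`), and
a product can be evaluated by modifying the observer (`pair_mul`).

At order p in V, the map R_V is an integral over p vertices, each of which comes either from
S(V)^{-1} or from S(V), with a sign (`twoLeft_val`). Once the vertices are ordered by time, the
contraction of two of them depends only on the origin of the earlier one. Hence the alternating sum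
over the origins factors into one difference per vertex (`groupSymbol_bogoliubov`), with two
consequences.

Causality: the factor of the latest vertex vanishes if that vertex is not earlier than any point of
the observable. The same vanishing holds for R_V^{-1}. So the interaction at late times is
irrelevant, which makes α^V_t(B) well defined (`pair_evolveWith_congr`). Moreover R_V^{-1}(B) can be
computed with a cutoff independent of t, so that only R_V ∘ α_t remains to be estimated
(`pair_evolveWith_eq`).

Connectedness: each factor is a difference of exponentials, hence at least linear in the
propagators. So each vertex is linked to a later vertex or to the observable, which sits near time
t. The truncated functional X ↦ ω(A ⋆ X) - ω(A) ω(X) of the quasifree state contains at least one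
further link, to A near time 0 (`clusters_connected_gaussian`).

By stationary phase in the massive dispersion relation, each link decays like |s|^{-3/2} in the time
difference s, uniformly for bounded positions (`norm_integral_oscillatory_le`). The function (1 +
|s|)^{-3/2} is integrable, and its convolution with itself is bounded by a multiple of itself. Space
is cut off by h, so the vertices can be integrated out one at a time, the earliest first. This gives
O(t^{-3/2}), uniformly in the late time cutoff, although the interaction region grows with t
(`lintegral_treeWeight_le`, `exists_norm_bogoliubovObserver_le`). -/

noncomputable section

namespace QST

/-! ### Exponential generating functions and contractions -/

section PairExp

variable {ι : Type}

/-- The symbol `exp(q s_i s_j)` of the exponential of the contraction of the points `i` and `j`. -/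
def pairExp (q : ℂ) (i j : ι) : MvPowerSeries ι ℂ :=
  PowerSeries.subst (MvPowerSeries.X i * MvPowerSeries.X j : MvPowerSeries ι ℂ)
    (PowerSeries.rescale q (PowerSeries.exp ℂ))

theorem hasSubst_X_mul_X (i j : ι) :
    PowerSeries.HasSubst (MvPowerSeries.X i * MvPowerSeries.X j : MvPowerSeries ι ℂ) :=
  PowerSeries.HasSubst.of_constantCoeff_zero (by simp)

theorem pairExp_add (q r : ℂ) (i j : ι) :
    pairExp (q + r) i j = pairExp q i j * pairExp r i j := by
  rw [pairExp, ← PowerSeries.exp_mul_exp_eq_exp_add, PowerSeries.subst_mul (hasSubst_X_mul_X i j)]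
  rfl

theorem pairExp_zero (i j : ι) : pairExp 0 i j = (1 : MvPowerSeries ι ℂ) := by
  rw [pairExp, PowerSeries.rescale_zero]
  have := map_one (PowerSeries.substAlgHom (R := ℂ) (hasSubst_X_mul_X i j))
  rw [PowerSeries.coe_substAlgHom] at this
  simpa using this

theorem pairExp_comm (q : ℂ) (i j : ι) : pairExp q i j = pairExp q j i := by
  rw [pairExp, pairExp, mul_comm]

/-- The truncation of `exp(q s_i s_j)`. -/
def pairTrunc (N : ℕ) (q : ℂ) (i j : ι) : MvPowerSeries ι ℂ :=
  ∑ c ∈ Finset.range N, (q ^ c / (c.factorial : ℂ)) •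
    MvPowerSeries.monomial (Finsupp.single i c + Finsupp.single j c) (1 : ℂ)

theorem X_mul_X_pow (i j : ι) (c : ℕ) :
    (MvPowerSeries.X i * MvPowerSeries.X j : MvPowerSeries ι ℂ) ^ c =
      MvPowerSeries.monomial (Finsupp.single i c + Finsupp.single j c) (1 : ℂ) := by
  rw [mul_pow, MvPowerSeries.X_pow_eq, MvPowerSeries.X_pow_eq, MvPowerSeries.monomial_mul_monomial,
    one_mul]

/-- The remainder is a multiple of s_i^N s_j^N, so it annihilates all monomials whose exponent at i
is below N. This makes the infinite exponential agree with the finite sums in `expQuad`. -/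
theorem exists_pairExp_eq (N : ℕ) (q : ℂ) (i j : ι) : ∃ r : MvPowerSeries ι ℂ,
    pairExp q i j = pairTrunc N q i j +
      MvPowerSeries.monomial (Finsupp.single i N + Finsupp.single j N) (1 : ℂ) * r := by
  have hs := hasSubst_X_mul_X i j
  refine ⟨PowerSeries.subst (MvPowerSeries.X i * MvPowerSeries.X j : MvPowerSeries ι ℂ)
    (PowerSeries.mk fun c => PowerSeries.coeff (c + N)
      (PowerSeries.rescale q (PowerSeries.exp ℂ))), ?_⟩
  rw [pairExp]
  conv_lhs =>
    rw [PowerSeries.eq_X_pow_mul_shift_add_trunc N (PowerSeries.rescale q (PowerSeries.exp ℂ))]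
  rw [PowerSeries.subst_add hs, PowerSeries.subst_mul hs, PowerSeries.subst_pow hs,
    PowerSeries.subst_X hs, X_mul_X_pow, add_comm]
  congr 1
  rw [PowerSeries.subst_coe hs, PowerSeries.trunc_apply, map_sum, pairTrunc, ← Finset.range_eq_Ico]
  refine Finset.sum_congr rfl fun c _ => ?_
  rw [Polynomial.aeval_monomial, X_mul_X_pow, PowerSeries.coeff_rescale, PowerSeries.coeff_exp,
    ← Algebra.smul_def]
  congr 1
  simp [div_eq_mul_inv]

end PairExp

section Wick

variable {ι κ : Type} [Fintype ι] [Fintype κ]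

/-- A multi-index as a finitely supported function. -/
def multi (n : ι → ℕ) : ι →₀ ℕ := Finsupp.equivFunOnFinite.symm n

@[simp] theorem multi_apply (n : ι → ℕ) (i : ι) : multi n i = n i := rfl

@[simp] theorem coe_multi (n : ι → ℕ) : ⇑(multi n) = n := rfl

@[simp] theorem multi_coe (d : ι →₀ ℕ) : multi d = d := by ext; rfl

/-- The multi-index factorial. -/
def fac (n : ι → ℕ) : ℂ := ∏ i, ((n i).factorial : ℂ)

theorem fac_ne_zero (n : ι → ℕ) : fac n ≠ 0 :=
  Finset.prod_ne_zero_iff.2 fun _ _ => Nat.cast_ne_zero.2 (Nat.factorial_ne_zero _)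

/-- The exponential generating function of a family of moments. -/
def egf (μ : (ι → ℕ) → ℂ) : MvPowerSeries ι ℂ := fun d => μ d / fac (d : ι → ℕ)

theorem coeff_egf (μ : (ι → ℕ) → ℂ) (d : ι →₀ ℕ) :
    MvPowerSeries.coeff d (egf μ) = μ d / fac (d : ι → ℕ) := rfl

/-- The moments of the functional obtained by acting with the differential operator of symbol `H`,
in the derivatives with respect to the fields at the points, before taking moments. -/
def wick (H : MvPowerSeries ι ℂ) (μ : (ι → ℕ) → ℂ) (n : ι → ℕ) : ℂ :=
  fac n * MvPowerSeries.coeff (multi n) (H * egf μ)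

theorem egf_wick (H : MvPowerSeries ι ℂ) (μ : (ι → ℕ) → ℂ) : egf (wick H μ) = H * egf μ := by
  ext d
  rw [coeff_egf, wick, multi_coe, mul_div_cancel_left₀ _ (fac_ne_zero _)]

/-- The point of the generating functions: composition of differential operators is multiplication
in a commutative ring, so contractions can be reordered and merged freely. -/
theorem wick_mul (H K : MvPowerSeries ι ℂ) (μ : (ι → ℕ) → ℂ) :
    wick (H * K) μ = wick H (wick K μ) := by
  funext n
  rw [wick, wick, egf_wick, mul_assoc]

theorem wick_one (μ : (ι → ℕ) → ℂ) : wick 1 μ = μ := by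
  funext n
  rw [wick, one_mul, coeff_egf, coe_multi, mul_div_cancel₀ _ (fac_ne_zero _)]

theorem wick_add (H K : MvPowerSeries ι ℂ) (μ : (ι → ℕ) → ℂ) (n : ι → ℕ) :
    wick (H + K) μ n = wick H μ n + wick K μ n := by
  simp [wick, add_mul, mul_add]

theorem wick_sub (H K : MvPowerSeries ι ℂ) (μ : (ι → ℕ) → ℂ) (n : ι → ℕ) :
    wick (H - K) μ n = wick H μ n - wick K μ n := by
  simp [wick, sub_mul, mul_sub]

theorem wick_zero (μ : (ι → ℕ) → ℂ) (n : ι → ℕ) : wick 0 μ n = 0 := by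
  simp [wick]

theorem wick_smul (a : ℂ) (H : MvPowerSeries ι ℂ) (μ : (ι → ℕ) → ℂ) (n : ι → ℕ) :
    wick (a • H) μ n = a * wick H μ n := by
  simp [wick]; ring

theorem wick_sum {τ : Type*} (s : Finset τ) (H : τ → MvPowerSeries ι ℂ) (μ : (ι → ℕ) → ℂ)
    (n : ι → ℕ) : wick (∑ t ∈ s, H t) μ n = ∑ t ∈ s, wick (H t) μ n := by
  simp [wick, Finset.sum_mul, Finset.mul_sum]

/-- The variable s_i stands for ∂/∂φ(x_i). If some d_i exceeds n_i, the falling factorial vanishes,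
so the truncated subtraction in the exponent is harmless. -/
theorem wick_monomial (d : ι →₀ ℕ) (μ : (ι → ℕ) → ℂ) (n : ι → ℕ) :
    wick (MvPowerSeries.monomial d 1) μ n =
      (∏ i, ((n i).descFactorial (d i) : ℂ)) * μ (n - ⇑d) := by
  classical
  rw [wick, MvPowerSeries.coeff_monomial_mul]
  split_ifs with h
  · have e : multi n - d = multi (n - ⇑d) := by ext; rfl
    rw [e, coeff_egf, coe_multi, one_mul, mul_div_assoc', mul_comm (fac n), mul_div_assoc, mul_comm]
    congr 1
    rw [fac, fac, ← Finset.prod_div_distrib]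
    refine Finset.prod_congr rfl fun i _ => ?_
    have hi : d i ≤ n i := h i
    rw [← Nat.factorial_mul_descFactorial hi]
    have : (((n i - d i).factorial : ℕ) : ℂ) ≠ 0 := Nat.cast_ne_zero.2 (Nat.factorial_ne_zero _)
    simp only [Pi.sub_apply]
    push_cast
    field_simp
  · rw [mul_zero]
    obtain ⟨i, hi⟩ : ∃ i, n i < d i := by
      by_contra! hc
      exact h hc
    rw [Finset.prod_eq_zero (Finset.mem_univ i), zero_mul]
    rw [Nat.descFactorial_of_lt hi, Nat.cast_zero]

/-- The symbol of the exponential of `∑ Q_{ij} ∂_i ∂_j`. -/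
def contr (Q : ι → ι → ℂ) : MvPowerSeries ι ℂ := ∏ i, ∏ j, pairExp (Q i j) i j

theorem contr_add (Q R : ι → ι → ℂ) : contr (Q + R) = contr Q * contr R := by
  simp only [contr, Pi.add_apply, pairExp_add, Finset.prod_mul_distrib]

theorem contr_zero : contr (0 : ι → ι → ℂ) = 1 := by
  simp [contr, pairExp_zero]

theorem contr_sum {τ : Type*} (s : Finset τ) (Q : τ → ι → ι → ℂ) :
    contr (∑ t ∈ s, Q t) = ∏ t ∈ s, contr (Q t) := by
  classical
  induction s using Finset.induction_on with
  | empty => simp [contr_zero]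
  | insert a s ha ih => rw [Finset.sum_insert ha, Finset.prod_insert ha, contr_add, ih]

theorem contr_transpose (Q : ι → ι → ℂ) : contr (fun i j => Q j i) = contr Q := by
  rw [contr, Finset.prod_comm, contr]
  simp only [pairExp_comm]

theorem contr_eq_half (Q : ι → ι → ℂ) :
    contr Q = contr fun i j => (1 / 2 : ℂ) * (Q i j + Q j i) := by
  have h1 : Q = (fun i j => (1 / 2 : ℂ) * Q i j) + fun i j => (1 / 2 : ℂ) * Q i j := by
    funext i j; simp only [Pi.add_apply]; ring
  have h2 : (fun i j => (1 / 2 : ℂ) * (Q i j + Q j i)) =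
      (fun i j => (1 / 2 : ℂ) * Q i j) + fun i j => (1 / 2 : ℂ) * Q j i := by
    funext i j; simp only [Pi.add_apply]; ring
  rw [h2, contr_add, contr_transpose (fun i j => (1 / 2 : ℂ) * Q i j), ← contr_add, ← h1]

/-- Partial derivatives commute, so only the symmetrization of the contraction matrix matters. Each
pair may therefore be booked in whichever row is convenient. -/
theorem contr_congr {Q R : ι → ι → ℂ} (h : ∀ i j, Q i j + Q j i = R i j + R j i) :
    contr Q = contr R := by
  rw [contr_eq_half Q, contr_eq_half R]
  simp only [h]

/-! The explicit form of the contractions. -/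

/-- Equality of symbols as far as the moment of order `n` is concerned. -/
def EqUpTo (n : ι → ℕ) (H K : MvPowerSeries ι ℂ) : Prop :=
  ∀ μ, wick H μ n = wick K μ n

/-- The family of moments is arbitrary in `EqUpTo`, so the other factor can be absorbed into it;
commutativity then exchanges the roles of the two factors. -/
theorem EqUpTo.mul {n : ι → ℕ} {H K H' K' : MvPowerSeries ι ℂ} (h : EqUpTo n H K)
    (h' : EqUpTo n H' K') : EqUpTo n (H * H') (K * K') := fun μ => by
  rw [wick_mul, h, ← wick_mul, mul_comm, wick_mul, h', ← wick_mul, mul_comm]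

theorem EqUpTo.prod {n : ι → ℕ} {τ : Type*} {s : Finset τ} {H K : τ → MvPowerSeries ι ℂ}
    (h : ∀ t ∈ s, EqUpTo n (H t) (K t)) : EqUpTo n (∏ t ∈ s, H t) (∏ t ∈ s, K t) := by
  classical
  induction s using Finset.induction_on with
  | empty => intro μ; rfl
  | insert a s ha ih =>
    rw [Finset.prod_insert ha, Finset.prod_insert ha]
    exact (h a (Finset.mem_insert_self a s)).mul (ih fun t ht => h t (Finset.mem_insert_of_mem ht))

theorem pairExp_eqUpTo (n : ι → ℕ) (q : ℂ) (i j : ι) {N : ℕ} (hN : n i < N) :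
    EqUpTo n (pairExp q i j) (pairTrunc N q i j) := fun μ => by
  obtain ⟨r, hr⟩ := exists_pairExp_eq N q i j
  rw [hr, wick_add, wick_mul, wick_monomial, Finset.prod_eq_zero (Finset.mem_univ i)]
  · simp
  · rw [Nat.descFactorial_of_lt, Nat.cast_zero]
    simp only [Finsupp.add_apply, Finsupp.single_eq_same]
    omega

theorem wick_pairExp (q : ℂ) (i j : ι) (μ : (ι → ℕ) → ℂ) (n : ι → ℕ) {N : ℕ} (hN : n i < N) :
    wick (pairExp q i j) μ n = ∑ c ∈ Finset.range N, (q ^ c / (c.factorial : ℂ)) *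
      wick (MvPowerSeries.monomial (Finsupp.single i c + Finsupp.single j c) 1) μ n := by
  rw [pairExp_eqUpTo n q i j hN, pairTrunc, wick_sum]
  simp only [wick_smul]

-- The bridge to the definition of `expQuad`: each exponential is truncated beyond the exponent n_i
-- and the product of the truncations is expanded.
open Classical in
theorem wick_contr (Q : ι → ι → ℂ) (μ : (ι → ℕ) → ℂ) (n : ι → ℕ) :
    wick (contr Q) μ n =
      ∑ c ∈ Fintype.piFinset fun i => Fintype.piFinset fun _ : ι => Finset.range (n i + 1),
        ((∏ i, ((n i).descFactorial (∑ j, (c i j + c j i)) : ℂ)) /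
          ∏ i, ∏ j, ((c i j).factorial : ℂ)) * (∏ i, ∏ j, Q i j ^ c i j) *
          μ (fun i => n i - ∑ j, (c i j + c j i)) := by
  have h1 : EqUpTo n (contr Q) (∏ i, ∏ j, pairTrunc (n i + 1) (Q i j) i j) :=
    EqUpTo.prod fun i _ => EqUpTo.prod fun j _ => pairExp_eqUpTo n _ i j (Nat.lt_succ_self _)
  have h2 : (∏ i, ∏ j, pairTrunc (n i + 1) (Q i j) i j) =
      ∑ c ∈ Fintype.piFinset fun i => Fintype.piFinset fun _ : ι => Finset.range (n i + 1),
        (∏ i, ∏ j, (Q i j ^ c i j / ((c i j).factorial : ℂ))) •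
          MvPowerSeries.monomial (multi fun i => ∑ j, (c i j + c j i)) (1 : ℂ) := by
    simp only [pairTrunc]
    simp_rw [Finset.prod_univ_sum]
    refine Finset.sum_congr rfl fun c _ => ?_
    simp_rw [Finset.prod_smul]
    congr 1
    simp_rw [← X_mul_X_pow, mul_pow, Finset.prod_mul_distrib]
    rw [Finset.prod_comm (s := Finset.univ) (t := Finset.univ)
      (f := fun i j => (MvPowerSeries.X j : MvPowerSeries ι ℂ) ^ c i j)]
    rw [← Finset.prod_mul_distrib]
    simp_rw [← Finset.prod_mul_distrib, ← pow_add, Finset.prod_pow_eq_pow_sum]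
    rw [MvPowerSeries.monomial_eq']
    simp [Finsupp.prod_fintype]
  rw [h1, h2, wick_sum]
  refine Finset.sum_congr rfl fun c _ => ?_
  rw [wick_smul, wick_monomial]
  simp_rw [Finset.prod_div_distrib]
  have : (n - ⇑(multi fun i => ∑ j, (c i j + c j i))) = fun i => n i - ∑ j, (c i j + c j i) := rfl
  rw [this]
  simp only [multi_apply]
  ring

end Wick

/-! ### Symbols on two groups of points and on a part of the points -/

section Block

variable {ι κ : Type}

/-- The block matrix of the contractions within two groups of points and between them. -/
def block (K : ι → ι → ℂ) (C : ι → κ → ℂ) (H : κ → κ → ℂ) : ι ⊕ κ → ι ⊕ κ → ℂ :=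
  Sum.elim (fun i => Sum.elim (K i) (C i)) fun j => Sum.elim (fun _ => 0) (H j)

theorem block_add (K K' : ι → ι → ℂ) (C C' : ι → κ → ℂ) (H H' : κ → κ → ℂ) :
    block (K + K') (C + C') (H + H') = block K C H + block K' C' H' := by
  funext x y
  rcases x with i | i <;> rcases y with j | j <;> simp [block]

end Block

section Embedding

variable {ι κ : Type} [Fintype ι] [Fintype κ]

/-- The symbol `H` in the derivatives at the points `κ` acts as the symbol `H'` in those at the
points `ι`, of which the points `κ` are a part. -/
def ActsAs (f : κ → ι) (H : MvPowerSeries κ ℂ) (H' : MvPowerSeries ι ℂ) : Prop :=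
  ∀ (μ : (ι → ℕ) → ℂ) (n : ι → ℕ) (m : κ → ℕ),
    wick H (fun m' => μ (Function.extend f m' n)) m = wick H' μ (Function.extend f m n)

theorem ActsAs.mul {f : κ → ι} {H K : MvPowerSeries κ ℂ} {H' K' : MvPowerSeries ι ℂ}
    (h : ActsAs f H H') (k : ActsAs f K K') : ActsAs f (H * K) (H' * K') := fun μ n m => by
  rw [wick_mul, wick_mul, ← h]
  congr 1
  funext m'
  exact k μ n m'

theorem ActsAs.prod {f : κ → ι} {τ : Type*} {s : Finset τ} {H : τ → MvPowerSeries κ ℂ}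
    {H' : τ → MvPowerSeries ι ℂ} (h : ∀ t, ActsAs f (H t) (H' t)) :
    ActsAs f (∏ t ∈ s, H t) (∏ t ∈ s, H' t) := by
  classical
  induction s using Finset.induction_on with
  | empty => intro μ n m; simp only [Finset.prod_empty, wick_one]
  | insert a s ha ih =>
    rw [Finset.prod_insert ha, Finset.prod_insert ha]
    exact (h a).mul ih

theorem actsAs_monomial {f : κ → ι} (hf : Function.Injective f) (d : κ →₀ ℕ) :
    ActsAs f (MvPowerSeries.monomial d 1) (MvPowerSeries.monomial (d.mapDomain f) 1) := by
  intro μ n m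
  rw [wick_monomial, wick_monomial]
  congr 1
  · refine Fintype.prod_of_injective f hf _ _ (fun i hi => ?_) fun a => ?_
    · rw [Finsupp.mapDomain_of_notMem_range _ _ hi, Nat.descFactorial_zero, Nat.cast_one]
    · rw [hf.extend_apply, Finsupp.mapDomain_apply hf]
  · congr 1
    funext i
    by_cases hi : i ∈ Set.range f
    · obtain ⟨a, rfl⟩ := hi
      simp only [hf.extend_apply, Pi.sub_apply, Finsupp.mapDomain_apply hf]
    · rw [Pi.sub_apply, Finsupp.mapDomain_of_notMem_range _ _ hi,
        Function.extend_apply' _ _ _ hi, Function.extend_apply' _ _ _ hi, Nat.sub_zero]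

theorem actsAs_pairExp {f : κ → ι} (hf : Function.Injective f) (q : ℂ) (a b : κ) :
    ActsAs f (pairExp q a b) (pairExp q (f a) (f b)) := by
  intro μ n m
  rw [wick_pairExp _ _ _ _ _ (Nat.lt_succ_self (m a)), wick_pairExp (N := m a + 1)]
  · refine Finset.sum_congr rfl fun c _ => ?_
    rw [actsAs_monomial hf, Finsupp.mapDomain_add, Finsupp.mapDomain_single,
      Finsupp.mapDomain_single]
  · rw [hf.extend_apply]; exact Nat.lt_succ_self _

theorem actsAs_contr {f : κ → ι} (hf : Function.Injective f) (Q : κ → κ → ℂ) :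
    ActsAs f (contr Q) (∏ a, ∏ b, pairExp (Q a b) (f a) (f b)) :=
  ActsAs.prod fun _ => ActsAs.prod fun _ => actsAs_pairExp hf _ _ _

/-- A relabelling is an embedding that leaves no point outside its range. It is used throughout to
identify differently bracketed sums of index types. -/
theorem wick_contr_equiv (e : ι ≃ κ) (Q : κ → κ → ℂ) (μ : (κ → ℕ) → ℂ) (n : κ → ℕ) :
    wick (contr fun i j => Q (e i) (e j)) (fun m => μ (m ∘ e.symm)) (n ∘ e) =
      wick (contr Q) μ n := by
  have hext : ∀ m : ι → ℕ, Function.extend e m n = m ∘ e.symm := fun m => by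
    funext k
    obtain ⟨i, rfl⟩ := e.surjective k
    rw [e.injective.extend_apply]; simp
  have h := actsAs_contr e.injective (fun i j => Q (e i) (e j)) μ n (n ∘ e)
  simp only [hext] at h
  rw [h]
  congr 1
  · rw [contr, ← e.prod_comp]
    exact Finset.prod_congr rfl fun i _ => e.prod_comp fun j => pairExp (Q (e i) j) (e i) j
  · funext k; simp

theorem wick_contr_inr (H : κ → κ → ℂ) (μ : (ι ⊕ κ → ℕ) → ℂ) (n : ι → ℕ) (m : κ → ℕ) :
    wick (contr H) (fun m' => μ (Sum.elim n m')) m =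
      wick (contr (block 0 0 H)) μ (Sum.elim n m) := by
  have hext : ∀ m' : κ → ℕ, Function.extend Sum.inr m' (Sum.elim n m) = Sum.elim n m' := by
    intro m'
    funext x
    rcases x with i | j
    · rw [Function.extend_apply' _ _ _ (by simp)]; rfl
    · rw [Sum.inr_injective.extend_apply]; rfl
  have h := actsAs_contr (Sum.inr_injective (α := ι)) H μ (Sum.elim n m) m
  simp only [hext] at h
  rw [h]
  congr 1
  simp [contr, Fintype.prod_sum_type, block, pairExp_zero]

theorem wick_contr_inl (K : ι → ι → ℂ) (μ : (ι ⊕ κ → ℕ) → ℂ) (n : ι → ℕ) (m : κ → ℕ) :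
    wick (contr K) (fun n' => μ (Sum.elim n' m)) n =
      wick (contr (block K 0 0)) μ (Sum.elim n m) := by
  have hext : ∀ n' : ι → ℕ, Function.extend Sum.inl n' (Sum.elim n m) = Sum.elim n' m := by
    intro m'
    funext x
    rcases x with i | j
    · rw [Sum.inl_injective.extend_apply]; rfl
    · rw [Function.extend_apply' _ _ _ (by simp)]; rfl
  have h := actsAs_contr (Sum.inl_injective (β := κ)) K μ (Sum.elim n m) n
  simp only [hext] at h
  rw [h]
  congr 1
  simp [contr, Fintype.prod_sum_type, block, pairExp_zero]

/-- Contractions within two groups of points after those between the groups. -/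
theorem wick_block (K : ι → ι → ℂ) (C : ι → κ → ℂ) (H : κ → κ → ℂ) (μ : (ι ⊕ κ → ℕ) → ℂ)
    (n : ι → ℕ) (m : κ → ℕ) :
    wick (contr H) (fun m' => wick (contr K) (fun n' =>
      wick (contr (block 0 C 0)) μ (Sum.elim n' m')) n) m =
      wick (contr (block K C H)) μ (Sum.elim n m) := by
  simp only [wick_contr_inl]
  rw [wick_contr_inr, ← wick_mul, ← wick_mul, ← contr_add, ← contr_add, ← block_add, ← block_add]
  simp

end Embedding

/-! ### Observers: families of moments of multilocal fields -/

section SumElim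

variable {ι κ : Type}

theorem continuous_sumElim : Continuous fun p : (ι → Spacetime) × (κ → Spacetime) =>
    (Sum.elim p.1 p.2 : ι ⊕ κ → Spacetime) := by
  refine continuous_pi fun x => ?_
  rcases x with i | j
  · exact (continuous_apply i).comp continuous_fst
  · exact (continuous_apply j).comp continuous_snd

theorem hasCompactSupport_sum {f : (ι → Spacetime) → ℂ} {g : (κ → Spacetime) → ℂ}
    (hf : HasCompactSupport f) (hg : HasCompactSupport g) :
    HasCompactSupport fun Z : ι ⊕ κ → Spacetime => f (Z ∘ Sum.inl) * g (Z ∘ Sum.inr) := by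
  have hK : IsCompact ((fun p : (ι → Spacetime) × (κ → Spacetime) =>
      (Sum.elim p.1 p.2 : ι ⊕ κ → Spacetime)) '' (tsupport f ×ˢ tsupport g)) := by
    refine (hf.isCompact.prod hg.isCompact).image (continuous_pi fun x => ?_)
    rcases x with i | j
    · exact (continuous_apply i).comp continuous_fst
    · exact (continuous_apply j).comp continuous_snd
  refine HasCompactSupport.intro hK fun Z hZ => ?_
  by_contra hne
  exact hZ ⟨(Z ∘ Sum.inl, Z ∘ Sum.inr), ⟨subset_tsupport _ (left_ne_zero_of_mul hne),
    subset_tsupport _ (right_ne_zero_of_mul hne)⟩, Sum.elim_comp_inl_inr Z⟩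

end SumElim

section Integrals

variable {ι κ : Type} [Fintype ι] [Fintype κ]

theorem integral_reindex (e : ι ≃ κ) (g : (κ → Spacetime) → ℂ) :
    ∫ X : κ → Spacetime, g X = ∫ X : ι → Spacetime, g (X ∘ e.symm) := by
  have h := (volume_measurePreserving_piCongrLeft (fun _ : κ => Spacetime) e).integral_comp' g
  rw [← h]
  congr 1
  funext X
  congr 1
  funext k
  obtain ⟨i, rfl⟩ := e.surjective k
  simp [MeasurableEquiv.coe_piCongrLeft, Equiv.piCongrLeft_apply_apply]

theorem integral_sumElim {g : (ι ⊕ κ → Spacetime) → ℂ} (hg : Continuous g)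
    (hs : HasCompactSupport g) :
    ∫ Z : ι ⊕ κ → Spacetime, g Z = ∫ Y : κ → Spacetime, ∫ X : ι → Spacetime, g (Sum.elim X Y) := by
  have hm := (volume_measurePreserving_sumPiEquivProdPi (fun _ : ι ⊕ κ => Spacetime)).symm
  rw [← hm.integral_comp' g]
  rw [Measure.volume_eq_prod, integral_prod_symm]
  · rfl
  · exact (hm.integrable_comp_emb (MeasurableEquiv.measurableEmbedding _)).2
      (hg.integrable_of_hasCompactSupport hs)

theorem continuous_integral_of_tsupport {τ : Type*} [TopologicalSpace τ]
    [FirstCountableTopology τ] [LocallyCompactSpace τ] {f : (ι → Spacetime) → ℂ}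
    (hf : Continuous f) (hs : HasCompactSupport f) {g : τ → (ι → Spacetime) → ℂ}
    (hg : Continuous fun p : τ × (ι → Spacetime) => g p.1 p.2) :
    Continuous fun t => ∫ X, f X * g t X := by
  have h := continuous_parametric_integral_of_continuous (μ := volume)
    (f := fun t X => f X * g t X) ((hf.comp continuous_snd).mul hg) hs.isCompact
  convert! h using 2 with t
  refine (setIntegral_eq_integral_of_forall_compl_eq_zero fun X hX => ?_).symm
  rw [image_eq_zero_of_notMem_tsupport hX, zero_mul]

theorem continuous_wick {τ : Type*} [TopologicalSpace τ] {Q : τ → ι → ι → ℂ}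
    {μ : τ → (ι → ℕ) → ℂ} (hQ : ∀ i j, Continuous fun t => Q t i j)
    (hμ : ∀ n, Continuous fun t => μ t n) (n : ι → ℕ) :
    Continuous fun t => wick (contr (Q t)) (μ t) n := by
  simp only [wick_contr]
  fun_prop

/-- A contraction of given order is a finite linear combination of moments, hence passes under the
integral. -/
theorem wick_integral {f : (κ → Spacetime) → ℂ} {ν : (κ → Spacetime) → (ι → ℕ) → ℂ}
    (h : ∀ n, Integrable fun X => f X * ν X n) (Q : ι → ι → ℂ) (n : ι → ℕ) :
    wick (contr Q) (fun n => ∫ X, f X * ν X n) n = ∫ X, f X * wick (contr Q) (ν X) n := by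
  simp only [wick_contr, Finset.mul_sum]
  rw [integral_finsetSum]
  · refine Finset.sum_congr rfl fun c _ => ?_
    rw [← integral_const_mul]
    congr 1
    funext X
    ring
  · intro c _
    refine ((h fun i => n i - ∑ j, (c i j + c j i)).const_mul (((∏ i, ((n i).descFactorial
      (∑ j, (c i j + c j i)) : ℂ)) / ∏ i, ∏ j, ((c i j).factorial : ℂ)) *
        (∏ i, ∏ j, Q i j ^ c i j))).congr (ae_of_all _ fun X => ?_)
    simp only
    ring

end Integrals

/-- A family of numbers `L(∏ φ(x_i)^{n_i})`, symmetric and continuous in the points. -/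
structure Observer where
  /-- The moments. -/
  val : (ι : Type) → [Fintype ι] → (ι → ℕ) → (ι → Spacetime) → ℂ
  natural : ∀ {ι κ : Type} [Fintype ι] [Fintype κ] (e : ι ≃ κ) (n : κ → ℕ) (X : κ → Spacetime),
    val ι (n ∘ e) (X ∘ e) = val κ n X
  continuous_val : ∀ {ι : Type} [Fintype ι] (n : ι → ℕ), Continuous (val ι n)

/-- The value of an observer on a multilocal functional. -/
def pairKernel (L : Observer) {l : ℕ} (n : Fin l → ℕ) : Kernel l →ₗ[ℂ] ℂ where
  toFun f := ∫ X, f X * L.val (Fin l) n X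
  map_add' f g := by
    have hi : ∀ f : Kernel l, Integrable fun X => f X * L.val (Fin l) n X := fun f =>
      (f.continuous.mul (L.continuous_val n)).integrable_of_hasCompactSupport
        f.hasCompactSupport.mul_right
    rw [← integral_add (hi f) (hi g)]
    simp [add_mul]
  map_smul' c f := by
    rw [RingHom.id_apply, smul_eq_mul, ← integral_const_mul]
    simp [mul_assoc]

/-- The value of an observer on an observable. -/
def pair (L : Observer) : Obs →ₗ[ℂ] ℂ := DFinsupp.lsum ℂ fun i => pairKernel L i.2

theorem pair_monomial (L : Observer) {l : ℕ} (n : Fin l → ℕ) (f : Kernel l) :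
    pair L (monomial n f) = ∫ X, f X * L.val (Fin l) n X := by
  rw [pair, monomial, DFinsupp.lsum_single]
  rfl

open Classical in
theorem pair_eq_sum (L : Observer) (A : Obs) : pair L A =
    A.sum fun (i : (l : ℕ) × (Fin l → ℕ)) (f : Kernel i.1) => ∫ X, f X * L.val (Fin i.1) i.2 X := by
  rw [pair, DFinsupp.lsum_apply_apply, DFinsupp.sumAddHom_apply]
  rfl

theorem pair_congr {L L' : Observer} (h : ∀ (ι : Type) [Fintype ι] n X, L.val ι n X = L'.val ι n X)
    (A : Obs) : pair L A = pair L' A := by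
  classical
  simp only [pair_eq_sum, h]

-- Only points in the support of the kernels are seen; this is how information about supports in
-- time enters.
open Classical in
theorem pair_congr_support {L L' : Observer} {A : Obs}
    (h : ∀ i ∈ A.support, ∀ X, A i X ≠ 0 → L.val (Fin i.1) i.2 X = L'.val (Fin i.1) i.2 X) :
    pair L A = pair L' A := by
  rw [pair_eq_sum, pair_eq_sum]
  refine Finset.sum_congr rfl fun i hi => integral_congr_ae (ae_of_all _ fun X => ?_)
  by_cases hX : A i X = 0
  · simp only [hX, zero_mul]
  · simp only [h i hi X hX]

theorem smulc_kernel_apply {l : ℕ} (q : C(Fin l → Spacetime, ℂ)) (f : Kernel l)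
    (X : Fin l → Spacetime) : (q • f) X = q X * f X := rfl

theorem pair_expQuad (L : Observer) {l : ℕ} (Q : Fin l → Fin l → C(Fin l → Spacetime, ℂ))
    (n : Fin l → ℕ) (f : Kernel l) : pair L (expQuad Q n f) =
      ∫ X, f X * wick (contr fun i j => Q i j X) (fun r => L.val (Fin l) r X) n := by
  classical
  rw [expQuad, map_sum]
  simp only [pair_monomial, wick_contr, Finset.mul_sum]
  rw [integral_finsetSum]
  · refine Finset.sum_congr (by congr!) fun c _ => ?_
    congr 1
    funext X
    rw [CompactlySupportedContinuousMap.smul_apply, smulc_kernel_apply]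
    simp only [ContinuousMap.coe_prod, ContinuousMap.coe_pow, Finset.prod_apply, Pi.pow_apply,
      smul_eq_mul, legs]
    ring
  · intro c _
    have hv := L.continuous_val fun i => n i - ∑ j, (c i j + c j i)
    have hf := f.continuous
    exact Continuous.integrable_of_hasCompactSupport (by fun_prop) f.hasCompactSupport.mul_right

namespace Observer

/-- The value of the field monomials at a continuous field. -/
def field (φ : Spacetime → ℝ) (hφ : Continuous φ) : Observer where
  val ι _ n X := ∏ k, (φ (X k) : ℂ) ^ n k
  natural e n X := e.prod_comp fun k => (φ (X k) : ℂ) ^ n k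
  continuous_val n := by fun_prop

theorem eval_eq_pair (φ : Spacetime → ℝ) (hφ : Continuous φ) (A : Obs) :
    A.eval φ = pair (field φ hφ) A := by
  classical
  rw [pair_eq_sum, Obs.eval]
  rfl

/-- The observer deformed by contractions among all points. -/
def deform (L : Observer) (W : C(Spacetime, ℂ)) : Observer where
  val ι _ n X := wick (contr fun i j => (1 / 2 : ℂ) * W (X i - X j)) (fun r => L.val ι r X) n
  natural {ι κ} _ _ e n X := by
    rw [← wick_contr_equiv e (fun i j => (1 / 2 : ℂ) * W (X i - X j)) (fun r => L.val κ r X) n]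
    congr 1
    funext r
    rw [← L.natural e (r ∘ e.symm)]
    congr 1
    funext i; simp
  continuous_val n := by
    refine continuous_wick (fun i j => by fun_prop) (fun n => L.continuous_val n) n

theorem pair_deform (L : Observer) (W : C(Spacetime, ℂ)) (A : Obs) :
    pair L (A.deform W) = pair (L.deform W) A := by
  classical
  rw [Obs.deform, map_dfinsuppSum, pair_eq_sum]
  simp only [pair_expQuad]
  rfl

/-- The observer `X ↦ L(X ⋆ Y)` for given points `Y` to the exponents `m`. -/
def point (L : Observer) (D : C(Spacetime, ℂ)) {κ : Type} [Fintype κ] (m : κ → ℕ)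
    (Y : κ → Spacetime) : Observer where
  val ι _ n X := wick (contr (block 0 (fun i j => D (X i - Y j)) 0))
    (fun r => L.val (ι ⊕ κ) r (Sum.elim X Y)) (Sum.elim n m)
  natural {ι ι'} _ _ e n X := by
    rw [← wick_contr_equiv (Equiv.sumCongr e (Equiv.refl κ))
      (block 0 (fun i j => D (X i - Y j)) 0) (fun r => L.val (ι' ⊕ κ) r (Sum.elim X Y))
      (Sum.elim n m)]
    congr 1
    · congr 1
      funext x y
      rcases x with i | i <;> rcases y with j | j <;> simp [block]
    · funext r
      rw [← L.natural (Equiv.sumCongr e (Equiv.refl κ)) (r ∘ (Equiv.sumCongr e (Equiv.refl κ)).symm)]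
      congr 1
      · funext x; simp
      · funext x; rcases x with i | i <;> rfl
    · funext x; rcases x with i | i <;> rfl
  continuous_val n := by
    refine continuous_wick (fun i j => ?_) (fun r => (L.continuous_val r).comp
      (continuous_sumElim.comp (Continuous.prodMk continuous_id continuous_const))) _
    rcases i with i | i <;> rcases j with j | j <;> simp only [block, Sum.elim_inl, Sum.elim_inr,
      Pi.zero_apply] <;> fun_prop

theorem continuous_point (L : Observer) (D : C(Spacetime, ℂ)) {ι κ : Type} [Fintype ι] [Fintype κ]
    (n : ι → ℕ) (m : κ → ℕ) : Continuous fun p : (κ → Spacetime) × (ι → Spacetime) =>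
      (L.point D m p.1).val ι n p.2 := by
  refine continuous_wick (fun i j => ?_) (fun r => (L.continuous_val r).comp
      (continuous_sumElim.comp continuous_swap)) _
  rcases i with i | i <;> rcases j with j | j <;> simp only [block, Sum.elim_inl, Sum.elim_inr,
      Pi.zero_apply] <;> fun_prop

/-- The observer `X ↦ L(A ⋆ X)`. -/
def left (L : Observer) (D : C(Spacetime, ℂ)) (A : Obs) : Observer where
  val κ _ m Y := pair (L.point D m Y) A
  natural {κ κ'} _ _ e m Y := by
    refine pair_congr (fun ι _ n X => ?_) A
    change wick _ _ _ = wick _ _ _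
    rw [← wick_contr_equiv (Equiv.sumCongr (Equiv.refl ι) e)
      (block 0 (fun i j => D (X i - Y j)) 0) (fun r => L.val (ι ⊕ κ') r (Sum.elim X Y))
      (Sum.elim n m)]
    congr 1
    · congr 1
      funext x y
      rcases x with i | i <;> rcases y with j | j <;> simp [block]
    · funext r
      rw [← L.natural (Equiv.sumCongr (Equiv.refl ι) e) (r ∘ (Equiv.sumCongr (Equiv.refl ι) e).symm)]
      congr 1
      · funext x; simp
      · funext x; rcases x with i | i <;> rfl
    · funext x; rcases x with i | i <;> rfl
  continuous_val {κ} _ m := by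
    classical
    simp only [pair_eq_sum]
    exact continuous_finsetSum _ fun i _ => continuous_integral_of_tsupport
      (A i).continuous (A i).hasCompactSupport (continuous_point L D i.2 m)

end Observer

/-- Splitting `Fin (l + l')` into its two blocks turns the conditional matrix into a `block` with
only cross contractions; Fubini then separates the two groups of points. -/
theorem pair_expQuad_tensor (L : Observer) (D : C(Spacetime, ℂ)) {l l' : ℕ} (n : Fin l → ℕ)
    (m : Fin l' → ℕ) (f : Kernel l) (g : Kernel l') :
    pair L (expQuad (fun r s : Fin (l + l') => if r.val < l ∧ l ≤ s.val then edge D r s else 0)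
      (Fin.append n m) (tensor f g)) =
      ∫ Y, g Y * ∫ X, f X * (L.point D m Y).val (Fin l) n X := by
  rw [pair_expQuad, integral_reindex (finSumFinEquiv (m := l) (n := l'))]
  have key : ∀ Z : Fin l ⊕ Fin l' → Spacetime,
      tensor f g (Z ∘ finSumFinEquiv.symm) * wick (contr fun i j : Fin (l + l') =>
        (if i.val < l ∧ l ≤ j.val then edge D i j else 0 : C(Fin (l + l') → Spacetime, ℂ))
          (Z ∘ finSumFinEquiv.symm)) (fun r => L.val (Fin (l + l')) r (Z ∘ finSumFinEquiv.symm))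
        (Fin.append n m) =
      (f (Z ∘ Sum.inl) * g (Z ∘ Sum.inr)) *
        (L.point D m (Z ∘ Sum.inr)).val (Fin l) n (Z ∘ Sum.inl) := by
    intro Z
    congr 1
    · change f _ * g _ = _
      congr 2
      · funext i; simp
      · funext i; simp
    · rw [← wick_contr_equiv (finSumFinEquiv (m := l) (n := l'))]
      change wick _ _ _ = wick _ _ _
      congr 1
      · congr 1
        funext x y
        rcases x with i | i <;> rcases y with j | j
        · simp [block, j.isLt.not_ge]
        · simp [block, edge]
        · simp [block]
        · simp [block]
      · funext r
        rw [← L.natural (finSumFinEquiv (m := l) (n := l')) (r ∘ finSumFinEquiv.symm)]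
        congr 1
        · funext x; simp
        · funext x; rcases x with i | i <;> simp
      · funext x; rcases x with i | i <;> simp
  simp only [key]
  rw [integral_sumElim]
  · simp only [← integral_const_mul]
    congr 1
    funext Y
    congr 1
    funext X
    simp only [Sum.elim_comp_inl, Sum.elim_comp_inr]
    ring
  · have hp := L.continuous_point D n m
    have hf := f.continuous
    have hg := g.continuous
    refine Continuous.mul ?_ (hp.comp (f := fun Z : Fin l ⊕ Fin l' → Spacetime =>
      (Z ∘ Sum.inr, Z ∘ Sum.inl)) ?_)
    · refine (hf.comp ?_).mul (hg.comp ?_) <;> exact continuous_pi fun i => continuous_apply _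
    · refine Continuous.prodMk ?_ ?_ <;> exact continuous_pi fun i => continuous_apply _
  · exact (hasCompactSupport_sum f.hasCompactSupport g.hasCompactSupport).mul_right

/-- Left multiplication is transposed to the observer. Iterated products are thus evaluated by
successive changes of the observer, without associativity of the products on `Obs`. -/
theorem pair_mul (L : Observer) (D : C(Spacetime, ℂ)) (A B : Obs) :
    pair L (A.mul D B) = pair (L.left D A) B := by
  classical
  have h : pair L (A.mul D B) = A.sum fun i f => B.sum fun (j : (l : ℕ) × (Fin l → ℕ)) (g : Kernel j.1) =>
      ∫ Y, g Y * ∫ X, f X * (L.point D j.2 Y).val (Fin i.1) i.2 X := by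
    rw [Obs.mul, map_dfinsuppSum]
    simp only [map_dfinsuppSum, pair_expQuad_tensor]
  rw [h, pair_eq_sum, DFinsupp.sum]
  simp only [DFinsupp.sum]
  rw [Finset.sum_comm]
  refine Finset.sum_congr rfl fun j _ => ?_
  rw [← integral_finsetSum]
  · congr 1
    funext Y
    rw [← Finset.mul_sum]
    congr 1
    exact (pair_eq_sum (L.point D j.2 Y) A).symm
  · intro i _
    exact Continuous.integrable_of_hasCompactSupport ((B j).continuous.mul
      (continuous_integral_of_tsupport (A i).continuous (A i).hasCompactSupport
        (L.continuous_point D i.2 j.2))) (B j).hasCompactSupport.mul_right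

/-! ### Observables given by contractions within one group of points -/

/-- The observable `A` is, under the integral sign with weight `f`, the exponential of the
contractions `Q` of the points, acting on field monomials with exponents `n`. -/
structure Rep (A : Obs) {ι : Type} [Fintype ι] (f : (ι → Spacetime) → ℂ)
    (Q : (ι → Spacetime) → ι → ι → ℂ) (n : ι → ℕ) : Prop where
  continuous_weight : Continuous f
  hasCompactSupport : HasCompactSupport f
  continuous_contr : ∀ i j, Continuous fun X => Q X i j
  pair_eq : ∀ L : Observer,
    pair L A = ∫ X, f X * wick (contr (Q X)) (fun r => L.val ι r X) n

namespace Rep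

variable {ι κ τ : Type} [Fintype ι] [Fintype κ] [Fintype τ] {A B : Obs}
  {f : (ι → Spacetime) → ℂ} {Q : (ι → Spacetime) → ι → ι → ℂ} {n : ι → ℕ}
  {g : (κ → Spacetime) → ℂ} {H : (κ → Spacetime) → κ → κ → ℂ} {m : κ → ℕ}

/-- Contractions inside the second group commute with the integral over the first one and with its
contractions, so everything merges into a single block matrix. -/
theorem left_wick (hA : Rep A f Q n) (L : Observer) (D : C(Spacetime, ℂ)) (m : κ → ℕ)
    (Y : κ → Spacetime) (H : κ → κ → ℂ) :
    wick (contr H) (fun r => (L.left D A).val κ r Y) m =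
      ∫ X, f X * wick (contr (block (Q X) (fun i j => D (X i - Y j)) H))
        (fun r => L.val (ι ⊕ κ) r (Sum.elim X Y)) (Sum.elim n m) := by
  have h : ∀ r, (L.left D A).val κ r Y = ∫ X, f X * wick (contr (Q X)) (fun s =>
      wick (contr (block 0 (fun i j => D (X i - Y j)) 0))
        (fun q => L.val (ι ⊕ κ) q (Sum.elim X Y)) (Sum.elim s r)) n := fun r =>
    hA.pair_eq (L.point D r Y)
  simp only [h]
  rw [wick_integral]
  · simp only [wick_block]
  · intro r
    refine Continuous.integrable_of_hasCompactSupport (hA.continuous_weight.mul ?_)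
      hA.hasCompactSupport.mul_right
    exact continuous_wick hA.continuous_contr (fun s => (L.point D r Y).continuous_val s) n

theorem left_val (hA : Rep A f Q n) (L : Observer) (D : C(Spacetime, ℂ)) (m : κ → ℕ)
    (Y : κ → Spacetime) : (L.left D A).val κ m Y =
      ∫ X, f X * wick (contr (block (Q X) (fun i j => D (X i - Y j)) 0))
        (fun r => L.val (ι ⊕ κ) r (Sum.elim X Y)) (Sum.elim n m) := by
  rw [← hA.left_wick, contr_zero, wick_one]

/-- The contractions of two groups of points to the right of which there are further points. -/
theorem integral_integral_eq (hA : Rep A f Q n) (hB : Rep B g H m) (L : Observer)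
    (D D' : C(Spacetime, ℂ)) (r : τ → ℕ) (Y : τ → Spacetime) :
    ((L.left D A).left D' B).val τ r Y =
      ∫ Z : ι ⊕ κ → Spacetime, f (Z ∘ Sum.inl) * g (Z ∘ Sum.inr) *
        wick (contr (block (block (Q (Z ∘ Sum.inl)) (fun i j => D (Z (Sum.inl i) - Z (Sum.inr j)))
          (H (Z ∘ Sum.inr))) (Sum.elim (fun i j => D (Z (Sum.inl i) - Y j))
            (fun i j => D' (Z (Sum.inr i) - Y j))) 0))
          (fun q => L.val ((ι ⊕ κ) ⊕ τ) q (Sum.elim Z Y)) (Sum.elim (Sum.elim n m) r) := by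
  have hQ := hA.continuous_contr
  have hH := hB.continuous_contr
  have hinl : Continuous fun Z : ι ⊕ κ → Spacetime => Z ∘ Sum.inl :=
    continuous_pi fun i => continuous_apply _
  have hinr : Continuous fun Z : ι ⊕ κ → Spacetime => Z ∘ Sum.inr :=
    continuous_pi fun i => continuous_apply _
  rw [integral_sumElim]
  · rw [hB.left_val]
    congr 1
    funext Z
    rw [hA.left_wick, ← integral_const_mul]
    congr 1
    funext X
    rw [← wick_contr_equiv (Equiv.sumAssoc ι κ τ)]
    simp only [Sum.elim_comp_inl, Sum.elim_comp_inr]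
    rw [mul_left_comm, mul_assoc]
    congr 2
    congr 1
    · congr 1
      funext x y
      rcases x with (i | i) | i <;> rcases y with (j | j) | j <;> simp [block]
    · funext q
      rw [← L.natural (Equiv.sumAssoc ι κ τ) (q ∘ (Equiv.sumAssoc ι κ τ).symm)]
      congr 1
      · funext x; simp
      · funext x; rcases x with (i | i) | i <;> rfl
    · funext x; rcases x with (i | i) | i <;> rfl
  · refine Continuous.mul ((hA.continuous_weight.comp hinl).mul (hB.continuous_weight.comp hinr)) ?_
    refine continuous_wick (fun x y => ?_) (fun q => (L.continuous_val q).comp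
      (continuous_sumElim.comp (Continuous.prodMk continuous_id continuous_const))) _
    rcases x with (i | i) | i <;> rcases y with (j | j) | j <;>
      simp only [block, Sum.elim_inl, Sum.elim_inr, Pi.zero_apply]
    · exact (hQ i j).comp hinl
    all_goals fun_prop
  · exact (hasCompactSupport_sum hA.hasCompactSupport hB.hasCompactSupport).mul_right

theorem mul (hA : Rep A f Q n) (hB : Rep B g H m) (D : C(Spacetime, ℂ)) :
    Rep (A.mul D B) (fun Z : ι ⊕ κ → Spacetime => f (Z ∘ Sum.inl) * g (Z ∘ Sum.inr))
      (fun Z => block (Q (Z ∘ Sum.inl)) (fun i j => D (Z (Sum.inl i) - Z (Sum.inr j)))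
        (H (Z ∘ Sum.inr))) (Sum.elim n m) := by
  have hQ := hA.continuous_contr
  have hH := hB.continuous_contr
  have hinl : Continuous fun Z : ι ⊕ κ → Spacetime => Z ∘ Sum.inl :=
    continuous_pi fun i => continuous_apply _
  have hinr : Continuous fun Z : ι ⊕ κ → Spacetime => Z ∘ Sum.inr :=
    continuous_pi fun i => continuous_apply _
  have hcQ : ∀ x y, Continuous fun Z : ι ⊕ κ → Spacetime => block (Q (Z ∘ Sum.inl))
      (fun i j => D (Z (Sum.inl i) - Z (Sum.inr j))) (H (Z ∘ Sum.inr)) x y := by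
    intro x y
    rcases x with i | i <;> rcases y with j | j <;>
      simp only [block, Sum.elim_inl, Sum.elim_inr]
    · exact (hQ i j).comp hinl
    · fun_prop
    · fun_prop
    · exact (hH i j).comp hinr
  have hcf : Continuous fun Z : ι ⊕ κ → Spacetime => f (Z ∘ Sum.inl) * g (Z ∘ Sum.inr) :=
    (hA.continuous_weight.comp hinl).mul (hB.continuous_weight.comp hinr)
  have hs := hasCompactSupport_sum hA.hasCompactSupport hB.hasCompactSupport
  refine ⟨hcf, hs, hcQ, fun L => ?_⟩
  rw [pair_mul, hB.pair_eq, integral_sumElim]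
  · congr 1
    funext Z
    rw [hA.left_wick, ← integral_const_mul]
    congr 1
    funext X
    simp only [Sum.elim_comp_inl, Sum.elim_comp_inr, Sum.elim_inl, Sum.elim_inr]
    ring
  · exact hcf.mul (continuous_wick hcQ (fun q => L.continuous_val q) _)
  · exact hs.mul_right

theorem reindex (hA : Rep A f Q n) (e : ι ≃ κ) : Rep A (fun X : κ → Spacetime => f (X ∘ e))
    (fun X i j => Q (X ∘ e) (e.symm i) (e.symm j)) (n ∘ e.symm) := by
  have he : Continuous fun X : κ → Spacetime => X ∘ e := continuous_pi fun i => continuous_apply _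
  have hs : HasCompactSupport fun X : κ → Spacetime => f (X ∘ e) :=
    hA.hasCompactSupport.comp_homeomorph (Homeomorph.piCongrLeft (Y := fun _ => Spacetime) e).symm
  refine ⟨hA.continuous_weight.comp he, hs, fun i j => (hA.continuous_contr _ _).comp he,
    fun L => ?_⟩
  rw [hA.pair_eq, integral_reindex e.symm]
  congr 1
  funext X
  congr 1
  rw [← wick_contr_equiv e]
  congr 1
  · simp
  · funext r
    rw [← L.natural e (r ∘ e.symm)]
    congr 1
    funext x; simp
  · funext x; simp

theorem congr (hA : Rep A f Q n) {f' : (ι → Spacetime) → ℂ} {Q' : (ι → Spacetime) → ι → ι → ℂ}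
    {n' : ι → ℕ} (hf : ∀ X, f X = f' X)
    (hQ : ∀ X i j, Q X i j + Q X j i = Q' X i j + Q' X j i)
    (hQ' : ∀ i j, Continuous fun X => Q' X i j) (hn : n = n') : Rep A f' Q' n' := by
  obtain rfl : f = f' := funext hf
  subst hn
  refine ⟨hA.continuous_weight, hA.hasCompactSupport, hQ', fun L => ?_⟩
  rw [hA.pair_eq]
  simp only [contr_congr (hQ _)]

theorem smul (hA : Rep A f Q n) (c : ℂ) : Rep (c • A) (fun X => c * f X) Q n := by
  refine ⟨continuous_const.mul hA.continuous_weight, hA.hasCompactSupport.mul_left,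
    hA.continuous_contr, fun L => ?_⟩
  rw [map_smul, hA.pair_eq, smul_eq_mul, ← integral_const_mul]
  simp only [mul_assoc]

end Rep

/-! ### The time-ordered and anti-time-ordered propagators -/

/-- The substitution 𝐩 ↦ -𝐩. Because of it ties in the time ordering cause no trouble: both formulas
for the Feynman propagator hold at equal times. -/
theorem vacuumFun_neg_of_time_eq_zero (P : Params) {x : Spacetime} (hx : x.1 = 0) :
    vacuumFun P (-x) = vacuumFun P x := by
  unfold vacuumFun
  congr 1
  rw [← integral_neg_eq_self]
  refine integral_congr_ae (ae_of_all _ fun p => ?_)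
  simp [hx, weight, energy]

theorem feynman_of_nonneg (P : Params) {x : Spacetime} (hx : 0 ≤ x.1) :
    feynman P x = vacuum P x := if_pos hx

theorem feynman_of_nonpos (P : Params) {x : Spacetime} (hx : x.1 ≤ 0) :
    feynman P x = vacuum P (-x) := by
  rcases hx.lt_or_eq with h | h
  · exact if_neg h.not_ge
  · rw [feynman_of_nonneg P h.ge]
    exact (vacuumFun_neg_of_time_eq_zero P h).symm

theorem feynman_neg (P : Params) (x : Spacetime) : feynman P (-x) = feynman P x := by
  rcases le_total 0 x.1 with h | h
  · rw [feynman_of_nonneg P h, feynman_of_nonpos P (by simpa using h), neg_neg]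
  · rw [feynman_of_nonpos P h, feynman_of_nonneg P (by simpa using h)]

/-- The anti-time-ordered propagator. -/
def antiFeynman (P : Params) : C(Spacetime, ℂ) :=
  ⟨fun x => vacuum P x + vacuum P (-x) - feynman P x, by fun_prop⟩

theorem antiFeynman_of_nonneg (P : Params) {x : Spacetime} (hx : 0 ≤ x.1) :
    antiFeynman P x = vacuum P (-x) := by
  change vacuum P x + vacuum P (-x) - feynman P x = _
  rw [feynman_of_nonneg P hx]; ring

theorem antiFeynman_of_nonpos (P : Params) {x : Spacetime} (hx : x.1 ≤ 0) :
    antiFeynman P x = vacuum P x := by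
  change vacuum P x + vacuum P (-x) - feynman P x = _
  rw [feynman_of_nonpos P hx]; ring

/-! ### Contractions of two groups of vertices -/

section Marked

open Classical

variable {ι κ τ : Type}

/-- Contractions, by the symmetric propagator `w`, of all pairs of points. -/
def offDiag (w : C(Spacetime, ℂ)) (z : ι → Spacetime) (i j : ι) : ℂ :=
  if i = j then 0 else (1 / 2 : ℂ) * w (z i - z j)

/-- Contractions of all pairs of points, by `w₁` within `I`, by `w₂` within the complement of `I`,
and by `c` from `I` to its complement. -/
def marked (w₁ w₂ c : C(Spacetime, ℂ)) (I : Finset ι) (z : ι → Spacetime) (i j : ι) : ℂ :=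
  if i = j then 0
  else if i ∈ I then
    if j ∈ I then (1 / 2 : ℂ) * w₁ (z i - z j) else (1 / 2 : ℂ) * c (z i - z j)
  else
    if j ∈ I then (1 / 2 : ℂ) * c (z j - z i) else (1 / 2 : ℂ) * w₂ (z i - z j)

theorem continuous_offDiag (w : C(Spacetime, ℂ)) (i j : ι) :
    Continuous fun z : ι → Spacetime => offDiag w z i j := by
  unfold offDiag
  split_ifs <;> fun_prop

theorem continuous_marked (w₁ w₂ c : C(Spacetime, ℂ)) (I : Finset ι) (i j : ι) :
    Continuous fun z : ι → Spacetime => marked w₁ w₂ c I z i j := by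
  unfold marked
  split_ifs <;> fun_prop

theorem marked_empty (w₁ w₂ c : C(Spacetime, ℂ)) (z : ι → Spacetime) :
    marked w₁ w₂ c ∅ z = offDiag w₂ z := by
  funext i j
  simp [marked, offDiag]

/-- A product of two groups of vertices becomes a contraction of one set of vertices with a marked
subset; only symmetrizations are compared, which suffices by `contr_congr`. -/
theorem block_offDiag_add (w₁ w₂ c : C(Spacetime, ℂ)) (e : ι ⊕ κ ≃ τ) (I : Finset τ)
    (h₁ : ∀ i, e (Sum.inl i) ∈ I) (h₂ : ∀ j, e (Sum.inr j) ∉ I) (z : τ → Spacetime) (s t : τ) :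
    block (offDiag w₁ ((z ∘ e) ∘ Sum.inl))
        (fun i j => c ((z ∘ e) (Sum.inl i) - (z ∘ e) (Sum.inr j)))
        (offDiag w₂ ((z ∘ e) ∘ Sum.inr)) (e.symm s) (e.symm t) +
      block (offDiag w₁ ((z ∘ e) ∘ Sum.inl))
        (fun i j => c ((z ∘ e) (Sum.inl i) - (z ∘ e) (Sum.inr j)))
        (offDiag w₂ ((z ∘ e) ∘ Sum.inr)) (e.symm t) (e.symm s) =
      marked w₁ w₂ c I z s t + marked w₁ w₂ c I z t s := by
  obtain ⟨x, rfl⟩ := e.surjective s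
  obtain ⟨y, rfl⟩ := e.surjective t
  rcases x with i | i <;> rcases y with j | j <;>
    simp [block, offDiag, marked, h₁, h₂] <;> ring

/-- The product of the values of a function at the points. -/
def vprod [Fintype ι] (v : Spacetime → ℂ) (z : ι → Spacetime) : ℂ := ∏ i, v (z i)

theorem vprod_comp [Fintype ι] [Fintype κ] (v : Spacetime → ℂ) (e : ι ≃ κ) (z : κ → Spacetime) :
    vprod v (z ∘ e) = vprod v z := e.prod_comp fun k => v (z k)

theorem vprod_sum [Fintype ι] [Fintype κ] (v : Spacetime → ℂ) (z : ι ⊕ κ → Spacetime) :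
    vprod v (z ∘ Sum.inl) * vprod v (z ∘ Sum.inr) = vprod v z := by
  simp [vprod, Fintype.prod_sum_type]

end Marked

/-! ### The `S` matrix -/

theorem rep_unit (v : Spacetime → ℂ) (w : C(Spacetime, ℂ)) (n : ℕ) :
    Rep Obs.unit (ι := Fin 0) (vprod v) (offDiag w) fun _ => n := by
  refine ⟨continuous_of_const fun X Y => by simp [vprod], HasCompactSupport.of_compactSpace _,
    fun i => i.elim0, fun L => ?_⟩
  rw [Obs.unit, pair_monomial]
  congr 1
  funext X
  have h : contr (offDiag w X) = 1 := by simp [contr]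
  rw [h, wick_one]
  rw [Subsingleton.elim (![] : Fin 0 → ℕ) fun _ => n]
  simp [vprod]

theorem rep_timeOrdPow (P : Params) {V : Obs} {v : Spacetime → ℂ} {n : ℕ}
    (hV : Rep V (ι := Unit) (vprod v) 0 fun _ => n) (b : ℕ) :
    Rep (timeOrdPow P V b) (ι := Fin b) (vprod v) (offDiag (feynman P)) fun _ => n := by
  classical
  induction b with
  | zero => exact rep_unit v _ n
  | succ b ih =>
    let e : Unit ⊕ Fin b ≃ Fin (b + 1) := Fintype.equivFinOfCardEq (by simp [add_comm])
    refine ((hV.mul ih (feynman P)).reindex e).congr (fun X => ?_) (fun X s t => ?_)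
      (fun i j => continuous_offDiag _ i j) ?_
    · rw [vprod_sum, vprod_comp]
    · obtain ⟨x, rfl⟩ := e.surjective s
      obtain ⟨y, rfl⟩ := e.surjective t
      -- Since the propagator is even, the single contraction to a new vertex equals half of it in
      -- each direction, as in `offDiag`.
      have hF : ∀ x y, feynman P (x - y) = feynman P (y - x) := fun x y => by
        rw [← feynman_neg, neg_sub]
      rcases x with i | i <;> rcases y with j | j <;> simp [block, offDiag]
      · rw [hF (X (e (Sum.inr j)))]; ring
      · rw [hF (X (e (Sum.inr i)))]; ring
    · funext s
      obtain ⟨x, rfl⟩ := e.surjective s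
      rcases x with i | i <;> simp

theorem rep_sMatrix (P : Params) {V : Obs} {v : Spacetime → ℂ} {n : ℕ}
    (hV : Rep V (ι := Unit) (vprod v) 0 fun _ => n) (b : ℕ) :
    Rep (sMatrix P V b) (ι := Fin b)
      (fun z => ((-Complex.I) ^ b / (b.factorial : ℂ)) * vprod v z)
      (offDiag (feynman P)) fun _ => n :=
  (rep_timeOrdPow P hV b).smul _

/-- The same product is obtained for every marked subset of the right cardinality, because the
weight is symmetric in the vertices. This permits replacing one product by a sum over all such
subsets. -/
theorem rep_mul_marked {A B : Obs} {a b p : ℕ} {α γ : ℂ} {v : Spacetime → ℂ}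
    {w₁ w₂ : C(Spacetime, ℂ)} {n : ℕ}
    (hA : Rep A (ι := Fin a) (fun z => α * vprod v z) (offDiag w₁) fun _ => n)
    (hB : Rep B (ι := Fin b) (fun z => γ * vprod v z) (offDiag w₂) fun _ => n)
    (D : C(Spacetime, ℂ)) (I : Finset (Fin p)) (ha : I.card = a) (hb : Iᶜ.card = b) :
    Rep (A.mul D B) (fun z => α * γ * vprod v z) (marked w₁ w₂ D I) fun _ => n := by
  classical
  have h₁ : ∀ i, finSumEquivOfFinset ha hb (Sum.inl i) ∈ I := fun i => by
    rw [finSumEquivOfFinset_inl]; exact Finset.orderEmbOfFin_mem _ _ _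
  have h₂ : ∀ j, finSumEquivOfFinset ha hb (Sum.inr j) ∉ I := fun i => by
    rw [finSumEquivOfFinset_inr, ← Finset.mem_compl]; exact Finset.orderEmbOfFin_mem _ _ _
  refine ((hA.mul hB D).reindex (finSumEquivOfFinset ha hb)).congr (fun X => ?_)
    (fun X s t => block_offDiag_add w₁ w₂ D _ I h₁ h₂ X s t)
    (fun i j => continuous_marked _ _ _ _ i j) ?_
  · rw [← vprod_comp v (finSumEquivOfFinset ha hb), ← vprod_sum]; ring
  · funext s
    obtain ⟨x, rfl⟩ := (finSumEquivOfFinset ha hb).surjective s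
    rcases x with i | i <;> simp

/-! ### Grouping the contractions at one of the two vertices -/

section Rows

open Classical

variable {ι κ : Type} [Fintype ι] [Fintype κ]

/-- The matrix with a single nonzero row. -/
def row (x : ι) (a : ι → ℂ) : ι → ι → ℂ := fun y => if y = x then a else 0

theorem contr_eq_prod_row (A : ι → ι → ℂ) : contr A = ∏ x, contr (row x (A x)) := by
  rw [← contr_sum]
  congr 1
  funext y
  rw [Finset.sum_apply]
  simp [row]

theorem contr_row_zero (x : ι) : contr (row x 0) = 1 := by
  rw [← contr_zero]
  congr 1
  funext y
  simp [row]

theorem contr_sumElim_eq_prod_row (A : ι → ι ⊕ κ → ℂ) :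
    contr (Sum.elim A 0) = ∏ i, contr (row (Sum.inl i) (A i)) := by
  rw [contr_eq_prod_row, Fintype.prod_sum_type]
  simp [contr_row_zero]

end Rows

/-- Once the contribution of each vertex depends only on its own mark, the sum over markings is an
expanded product. With ε = -1 each vertex contributes a difference. -/
theorem sum_marks_prod {ι R : Type*} [Fintype ι] [DecidableEq ι] [CommRing R] [Algebra ℂ R] (ε : ℂ) (p n : ι → R) :
    ∑ I ∈ Finset.univ.powerset, ε ^ (Iᶜ : Finset ι).card • ∏ i, (if i ∈ I then p i else n i) =
      ∏ i, (p i + ε • n i) := by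
  rw [Finset.prod_add]
  refine Finset.sum_congr rfl fun I _ => ?_
  rw [Finset.prod_ite, Finset.prod_smul, Finset.prod_const, ← Finset.compl_eq_univ_sdiff,
    mul_smul_comm]
  congr! 3
  · ext i; simp
  · ext i; simp

/-! ### Time ordering -/

/-- The points, enumerated by `r`, have decreasing times. -/
def TimeOrdered {p : ℕ} (r : Equiv.Perm (Fin p)) (z : Fin p → Spacetime) : Prop :=
  ∀ i j, r i < r j → (z j).1 ≤ (z i).1

theorem exists_timeOrdered {p : ℕ} (z : Fin p → Spacetime) :
    ∃ r : Equiv.Perm (Fin p), TimeOrdered r z := by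
  refine ⟨(Tuple.sort fun i => -(z i).1).symm, fun i j hij => ?_⟩
  have h := Tuple.monotone_sort (fun i => -(z i).1) hij.le
  simpa using h

/-- There are p!/(a!(p-a)!) subsets of size a, so the factorials of the two exponential series
combine into a sum over subsets with the common weight 1/p!. -/
theorem sum_factorial_card {p : ℕ} (t : ℕ → ℂ) :
    ∑ I ∈ (Finset.univ : Finset (Fin p)).powerset,
      (I.card.factorial : ℂ) * (Iᶜ.card.factorial : ℂ) * t I.card =
      (p.factorial : ℂ) * ∑ a ∈ Finset.range (p + 1), t a := by
  have h := Finset.sum_powerset_apply_card (fun a : ℕ =>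
    (a.factorial : ℂ) * ((p - a).factorial : ℂ) * t a) (x := (Finset.univ : Finset (Fin p)))
  simp only [Finset.card_univ, Fintype.card_fin] at h
  simp only [Finset.card_compl, Fintype.card_fin]
  rw [h, Finset.mul_sum]
  refine Finset.sum_congr rfl fun a ha => ?_
  have hap : a ≤ p := Nat.lt_succ_iff.1 (Finset.mem_range.1 ha)
  rw [← Nat.choose_mul_factorial_mul_factorial hap, nsmul_eq_mul]
  push_cast
  ring

/-- Here the time-ordered vertices stand to the left of the anti-time-ordered ones. In all four
cases the contraction of two vertices is fixed by the mark of the later one, so each pair is booked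
in its row. -/
theorem contr_marked_antiFeynman (P : Params) {p : ℕ} {z : Fin p → Spacetime}
    {r : Equiv.Perm (Fin p)} (hr : TimeOrdered r z) (I : Finset (Fin p)) :
    contr (marked (feynman P) (antiFeynman P) (vacuum P) I z) =
      ∏ i, if i ∈ I then contr (row i fun j => if r i < r j then vacuum P (z i - z j) else 0)
        else contr (row i fun j => if r i < r j then vacuum P (z j - z i) else 0) := by
  rw [contr_congr (R := fun i j => if i ∈ I then (if r i < r j then vacuum P (z i - z j) else 0)
    else (if r i < r j then vacuum P (z j - z i) else 0)), contr_eq_prod_row]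
  · refine Finset.prod_congr rfl fun i _ => ?_
    split_ifs <;> rfl
  · have key : ∀ i j, r i < r j → marked (feynman P) (antiFeynman P) (vacuum P) I z i j +
        marked (feynman P) (antiFeynman P) (vacuum P) I z j i =
        if i ∈ I then vacuum P (z i - z j) else vacuum P (z j - z i) := by
      intro i j hij
      have hne : i ≠ j := fun h => by simp [h] at hij
      have ht := hr i j hij
      have h1 : 0 ≤ (z i - z j).1 := by simpa using ht
      have h2 : (z j - z i).1 ≤ 0 := by simpa using ht
      unfold marked
      rw [if_neg hne, if_neg hne.symm, feynman_of_nonneg P h1, feynman_of_nonpos P h2,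
        antiFeynman_of_nonneg P h1, antiFeynman_of_nonpos P h2, neg_sub, neg_sub]
      split_ifs <;> ring
    intro i j
    rcases lt_trichotomy (r i) (r j) with h | h | h
    · rw [key i j h]
      simp [h, h.not_gt]
    · obtain rfl := r.injective h
      simp [marked]
    · rw [add_comm, key j i h]
      simp [h, h.not_gt]

theorem sum_contr_marked_antiFeynman (P : Params) {p : ℕ} (hp : p ≠ 0) (z : Fin p → Spacetime) :
    ∑ I ∈ Finset.univ.powerset, (-1 : ℂ) ^ (Iᶜ : Finset (Fin p)).card •
      contr (marked (feynman P) (antiFeynman P) (vacuum P) I z) = 0 := by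
  classical
  obtain ⟨r, hr⟩ := exists_timeOrdered z
  simp only [contr_marked_antiFeynman P hr]
  have h := sum_marks_prod (-1 : ℂ)
    (fun i => contr (row i fun j => if r i < r j then vacuum P (z i - z j) else 0))
    (fun i => contr (row i fun j => if r i < r j then vacuum P (z j - z i) else 0))
  refine h.trans ?_
  have : NeZero p := ⟨hp⟩
  -- The last vertex in the order `r` is the earliest in time; its row is empty for either mark, so
  -- its factor is 1 - 1.
  refine Finset.prod_eq_zero (Finset.mem_univ (r.symm ⊤)) ?_
  have e : ∀ j, ¬ (⊤ : Fin p) < r j := fun j => not_top_lt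
  simp only [Equiv.apply_symm_apply, e, if_false]
  simp

theorem pair_neg (L : Observer) (A : Obs) : pair L (-A) = -pair L A := by
  refine eq_neg_of_add_eq_zero_left ?_
  exact ((pair L).map_add (-A) A).symm.trans
    ((congrArg (pair L) (neg_add_cancel A)).trans (pair L).map_zero)

/-- The inverse S matrix is the anti-time-ordered exponential: it satisfies the recursion of
`Series.starInv`, by the vanishing of the alternating sum over markings. -/
theorem rep_starInv (P : Params) {V : Obs} {v : Spacetime → ℂ} {n : ℕ}
    (hV : Rep V (ι := Unit) (vprod v) 0 fun _ => n) (k : ℕ) :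
    Rep (Series.starInv P (sMatrix P V) k) (ι := Fin k)
      (fun z => (Complex.I ^ k / (k.factorial : ℂ)) * vprod v z)
      (offDiag (antiFeynman P)) fun _ => n := by
  classical
  induction k using Nat.strong_induction_on with
  | _ k ih =>
  rcases k with _ | k
  · rw [Series.starInv]
    exact (rep_unit v (antiFeynman P) n).congr (fun X => by simp) (fun _ i => i.elim0)
      (fun i => i.elim0) rfl
  have hT := rep_timeOrdPow P hV (k + 1)
  have hv := hT.continuous_weight
  have hvs := hT.hasCompactSupport
  refine ⟨continuous_const.mul hv, hvs.mul_left, fun i j => continuous_offDiag _ i j, fun L => ?_⟩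
  set Φ : Finset (Fin (k + 1)) → ℂ := fun I => ∫ z, vprod v z *
    wick (contr (marked (feynman P) (antiFeynman P) (vacuum P) I z))
      (fun r => L.val (Fin (k + 1)) r z) (fun _ => n) with hΦ
  have hint : ∀ I, Integrable fun z => vprod v z *
    wick (contr (marked (feynman P) (antiFeynman P) (vacuum P) I z))
      (fun r => L.val (Fin (k + 1)) r z) (fun _ => n) := fun I =>
    Continuous.integrable_of_hasCompactSupport (hv.mul (continuous_wick
      (fun i j => continuous_marked _ _ _ I i j) (fun q => L.continuous_val q) _)) hvs.mul_right
  have hsum : ∑ I ∈ Finset.univ.powerset, (-1 : ℂ) ^ (Iᶜ : Finset (Fin (k + 1))).card * Φ I = 0 := by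
    simp only [hΦ, ← integral_const_mul]
    rw [← integral_finsetSum _ fun I _ => (hint I).const_mul _]
    rw [← integral_zero (Fin (k + 1) → Spacetime) ℂ]
    congr 1
    funext z
    have h := congrArg (fun H => vprod v z * wick H (fun r => L.val (Fin (k + 1)) r z) (fun _ => n))
      (sum_contr_marked_antiFeynman P k.succ_ne_zero z)
    simp only [wick_sum, wick_smul, wick_zero, Finset.mul_sum, mul_zero] at h
    rw [← h]
    exact Finset.sum_congr rfl fun I _ => by ring
  -- The term a = 0 is the claimed value at order k + 1, the others are those of the recursion.
  -- Proving that they add up to 0 proves the claim.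
  set t : ℕ → ℂ := fun a => if a = 0 then
      (Complex.I ^ (k + 1) / ((k + 1).factorial : ℂ)) * Φ ∅
    else pair L ((sMatrix P V a).mul (vacuum P) (Series.starInv P (sMatrix P V) (k + 1 - a)))
    with ht
  have hterm : ∀ I : Finset (Fin (k + 1)), (I.card.factorial : ℂ) * (Iᶜ.card.factorial : ℂ) *
      t I.card = (-Complex.I) ^ (k + 1) * ((-1 : ℂ) ^ Iᶜ.card * Φ I) := by
    intro I
    have hcard : I.card + Iᶜ.card = k + 1 := by rw [Finset.card_add_card_compl, Fintype.card_fin]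
    have f1 : (I.card.factorial : ℂ) ≠ 0 := Nat.cast_ne_zero.2 (Nat.factorial_ne_zero _)
    have f2 : (Iᶜ.card.factorial : ℂ) ≠ 0 := Nat.cast_ne_zero.2 (Nat.factorial_ne_zero _)
    have hI : Complex.I = -Complex.I * (-1) := by ring
    by_cases h0 : I.card = 0
    · obtain rfl := Finset.card_eq_zero.1 h0
      have f3 : ((k + 1).factorial : ℂ) ≠ 0 := Nat.cast_ne_zero.2 (Nat.factorial_ne_zero _)
      simp only [ht, Finset.card_empty, Finset.compl_empty, Finset.card_univ, Fintype.card_fin,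
        if_true]
      rw [← mul_assoc ((-Complex.I) ^ (k + 1)), ← mul_pow, ← hI]
      simp only [Nat.factorial_zero, Nat.cast_one]
      field_simp
    · have hk : k + 1 - I.card = Iᶜ.card := by omega
      have hlt : Iᶜ.card < k + 1 := by omega
      simp only [ht, if_neg h0, hk]
      rw [(rep_mul_marked (rep_sMatrix P hV I.card) (ih _ hlt) (vacuum P) I rfl rfl).pair_eq]
      simp only [mul_assoc]
      rw [integral_const_mul, integral_const_mul]
      change _ * (_ * (_ * (_ * Φ I))) = _
      rw [show (-Complex.I) ^ (k + 1) = (-Complex.I) ^ I.card * (-Complex.I) ^ Iᶜ.card by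
        rw [← pow_add, hcard]]
      have hI2 : Complex.I ^ Iᶜ.card = (-Complex.I) ^ Iᶜ.card * (-1) ^ Iᶜ.card := by
        rw [← mul_pow, ← hI]
      rw [hI2]
      field_simp
  have htot := sum_factorial_card (p := k + 1) t
  rw [Finset.sum_congr rfl fun I _ => hterm I, ← Finset.mul_sum, hsum, mul_zero,
    Finset.sum_range_succ'] at htot
  have f3 : ((k + 1).factorial : ℂ) ≠ 0 := Nat.cast_ne_zero.2 (Nat.factorial_ne_zero _)
  have h0 := (mul_eq_zero.1 htot.symm).resolve_left f3
  rw [Series.starInv, pair_neg, map_sum]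
  have e1 : ∑ j : Fin (k + 1), pair L ((sMatrix P V (j.val + 1)).mul (vacuum P)
      (Series.starInv P (sMatrix P V) (k - j.val))) = ∑ a ∈ Finset.range (k + 1), t (a + 1) := by
    rw [Finset.sum_range]
    refine Finset.sum_congr rfl fun j _ => ?_
    simp [ht]
  rw [e1, neg_eq_of_add_eq_zero_right h0]
  simp only [ht, hΦ, if_true, marked_empty, mul_assoc]
  rw [integral_const_mul]

/-! ### Observers composed with the Bogoliubov map -/

/-- Finite sums of observers. -/
def Observer.sum {τ : Type} (s : Finset τ) (L : τ → Observer) : Observer where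
  val ι _ n X := ∑ t ∈ s, (L t).val ι n X
  natural e n X := Finset.sum_congr rfl fun t _ => (L t).natural e n X
  continuous_val n := continuous_finsetSum _ fun t _ => (L t).continuous_val n

theorem pair_sum {τ : Type} (s : Finset τ) (L : τ → Observer) (A : Obs) :
    pair (Observer.sum s L) A = ∑ t ∈ s, pair (L t) A := by
  classical
  simp only [pair_eq_sum, DFinsupp.sum]
  rw [Finset.sum_comm]
  refine Finset.sum_congr rfl fun i _ => ?_
  rw [← integral_finsetSum]
  · simp only [Observer.sum, Finset.mul_sum]
  · intro t _
    exact ((A i).continuous.mul ((L t).continuous_val i.2)).integrable_of_hasCompactSupport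
      (A i).hasCompactSupport.mul_right

theorem pair_series_mul (L : Observer) (D : C(Spacetime, ℂ)) (A B : Series) (k : ℕ) :
    pair L (Series.mul D A B k) =
      ∑ a ∈ Finset.range (k + 1), pair (L.left D (A a)) (B (k - a)) := by
  rw [Series.mul, map_sum]
  simp only [pair_mul]

/-- The observer `X ↦ L(∑ₐ Aₐ ·_D (B_{p-a} ·_{D'} X))`. -/
def twoLeft (L : Observer) (D D' : C(Spacetime, ℂ)) (A B : Series) (p : ℕ) : Observer :=
  Observer.sum (Finset.range (p + 1)) fun a => (L.left D (A a)).left D' (B (p - a))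

/-- Terms are regrouped by the total order p of the two left factors, so that all divisions of p
vertices between them can later be summed together. -/
theorem pair_series_mul_mul (L : Observer) (D D' : C(Spacetime, ℂ)) (A B X : Series) (k : ℕ) :
    pair L (Series.mul D A (Series.mul D' B X) k) =
      ∑ p ∈ Finset.range (k + 1), pair (twoLeft L D D' A B p) (X (k - p)) := by
  rw [pair_series_mul]
  simp only [pair_series_mul, twoLeft, pair_sum]
  rw [Finset.sum_sigma', Finset.sum_sigma']
  refine Finset.sum_bij' (fun x _ => ⟨x.1 + x.2, x.1⟩) (fun x _ => ⟨x.2, x.1 - x.2⟩) ?_ ?_ ?_ ?_ ?_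
  · rintro ⟨a, b⟩ h
    simp only [Finset.mem_sigma, Finset.mem_range] at h ⊢
    omega
  · rintro ⟨a, b⟩ h
    simp only [Finset.mem_sigma, Finset.mem_range] at h ⊢
    omega
  · rintro ⟨a, b⟩ h
    simp only [Finset.mem_sigma, Finset.mem_range] at h ⊢
    simp
  · rintro ⟨a, b⟩ h
    simp only [Finset.mem_sigma, Finset.mem_range] at h ⊢
    simp only [Sigma.mk.injEq, heq_eq_eq, and_true]
    omega
  · rintro ⟨a, b⟩ h
    simp only [Finset.mem_sigma, Finset.mem_range] at h ⊢
    rw [Nat.add_sub_cancel_left, Nat.sub_sub]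

/-! ### Alternating sums over the origins of the vertices: causality and connectedness -/

section TwoGroups

open Classical

variable {κ : Type}

/-- The contractions of two marked groups of vertices with each other and with points `Y`. -/
def groupContr (w₁ w₂ D D' : C(Spacetime, ℂ)) {p : ℕ} (I : Finset (Fin p))
    (z : Fin p → Spacetime) (Y : κ → Spacetime) : Fin p ⊕ κ → Fin p ⊕ κ → ℂ :=
  block (marked w₁ w₂ D I z)
    (fun i j => if i ∈ I then D (z i - Y j) else D' (z i - Y j)) 0

theorem continuous_groupContr (w₁ w₂ D D' : C(Spacetime, ℂ)) {p : ℕ} (I : Finset (Fin p))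
    (x y : Fin p ⊕ κ) : Continuous fun q : (Fin p → Spacetime) × (κ → Spacetime) =>
      groupContr w₁ w₂ D D' I q.1 q.2 x y := by
  have hm := fun i j => continuous_marked w₁ w₂ D I i j
  unfold groupContr
  rcases x with i | i <;> rcases y with j | j <;>
    simp only [block, Sum.elim_inl, Sum.elim_inr, Pi.zero_apply]
  · exact (hm i j).comp continuous_fst
  · split_ifs <;> fun_prop
  · exact continuous_const
  · exact continuous_const

variable [Fintype κ]

/-- The alternating sum, over the ways of dividing the vertices into two groups, of the symbols of
their contractions. -/
def groupSymbol (w₁ w₂ D D' : C(Spacetime, ℂ)) {p : ℕ} (z : Fin p → Spacetime)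
    (Y : κ → Spacetime) : MvPowerSeries (Fin p ⊕ κ) ℂ :=
  ∑ I ∈ Finset.univ.powerset, (-1 : ℂ) ^ (Iᶜ : Finset (Fin p)).card •
    contr (groupContr w₁ w₂ D D' I z Y)

theorem wick_groupContr (L : Observer) (w₁ w₂ D D' : C(Spacetime, ℂ)) {a b p : ℕ}
    (I : Finset (Fin p)) (e : Fin a ⊕ Fin b ≃ Fin p) (h₁ : ∀ i, e (Sum.inl i) ∈ I)
    (h₂ : ∀ j, e (Sum.inr j) ∉ I) (n : ℕ) (z : Fin p → Spacetime) (m : κ → ℕ)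
    (Y : κ → Spacetime) :
    wick (contr (block (block (offDiag w₁ ((z ∘ e) ∘ Sum.inl))
        (fun i j => D ((z ∘ e) (Sum.inl i) - (z ∘ e) (Sum.inr j)))
        (offDiag w₂ ((z ∘ e) ∘ Sum.inr))) (Sum.elim (fun i j => D ((z ∘ e) (Sum.inl i) - Y j))
            (fun i j => D' ((z ∘ e) (Sum.inr i) - Y j))) 0))
        (fun q => L.val ((Fin a ⊕ Fin b) ⊕ κ) q (Sum.elim (z ∘ e) Y))
        (Sum.elim (Sum.elim (fun _ => n) (fun _ => n)) m) =
      wick (contr (groupContr w₁ w₂ D D' I z Y))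
        (fun q => L.val (Fin p ⊕ κ) q (Sum.elim z Y)) (Sum.elim (fun _ => n) m) := by
  rw [← wick_contr_equiv (Equiv.sumCongr e (Equiv.refl κ))]
  have hm := block_offDiag_add w₁ w₂ D e I h₁ h₂ z
  congr 1
  · refine contr_congr fun x y => ?_
    rcases x with i | i <;> rcases y with j | j
    · have h := hm (e i) (e j)
      simp only [Equiv.symm_apply_apply] at h
      exact h
    · rcases i with i | i <;> simp [groupContr, block, h₁, h₂]
    · rcases j with i | i <;> simp [groupContr, block, h₁, h₂]
    · simp [groupContr, block]
  · funext q
    rw [← L.natural (Equiv.sumCongr e (Equiv.refl κ)) (q ∘ (Equiv.sumCongr e (Equiv.refl κ)).symm)]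
    congr 1
    · funext x; simp
    · funext x; rcases x with i | i <;> rfl
  · funext x; rcases x with (i | i) | i <;> rfl

/-- The coefficients i^a/a! and (-i)^b/b! have product i^p (-1)^b/(a! b!). Symmetrizing over the
marked subsets leaves i^p/p! and the alternating sum `groupSymbol`. -/
theorem twoLeft_val {A B : Series} {v : Spacetime → ℂ} {w₁ w₂ : C(Spacetime, ℂ)} {n : ℕ}
    (hA : ∀ a, Rep (A a) (ι := Fin a) (fun z => (Complex.I ^ a / (a.factorial : ℂ)) * vprod v z)
      (offDiag w₁) fun _ => n)
    (hB : ∀ b, Rep (B b) (ι := Fin b) (fun z => ((-Complex.I) ^ b / (b.factorial : ℂ)) * vprod v z)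
      (offDiag w₂) fun _ => n)
    (hv : Continuous v) (hvs : HasCompactSupport v)
    (L : Observer) (D D' : C(Spacetime, ℂ)) (p : ℕ) (m : κ → ℕ) (Y : κ → Spacetime) :
    (twoLeft L D D' A B p).val κ m Y = (Complex.I ^ p / (p.factorial : ℂ)) *
      ∫ z : Fin p → Spacetime, vprod v z * wick (groupSymbol w₁ w₂ D D' z Y)
        (fun q => L.val (Fin p ⊕ κ) q (Sum.elim z Y)) (Sum.elim (fun _ => n) m) := by
  set Φ : Finset (Fin p) → ℂ := fun I => ∫ z, vprod v z *
    wick (contr (groupContr w₁ w₂ D D' I z Y))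
      (fun q => L.val (Fin p ⊕ κ) q (Sum.elim z Y)) (Sum.elim (fun _ => n) m) with hΦ
  have hvp : Continuous (vprod v : (Fin p → Spacetime) → ℂ) := by
    unfold vprod; fun_prop
  have hvps : HasCompactSupport (vprod v : (Fin p → Spacetime) → ℂ) := by
    refine HasCompactSupport.intro (isCompact_univ_pi fun _ : Fin p => hvs.isCompact) fun z hz => ?_
    simp only [Set.mem_univ_pi, not_forall] at hz
    obtain ⟨i, hi⟩ := hz
    exact Finset.prod_eq_zero (Finset.mem_univ i) (image_eq_zero_of_notMem_tsupport hi)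
  have hint : ∀ I, Integrable fun z => vprod v z *
      wick (contr (groupContr w₁ w₂ D D' I z Y))
        (fun q => L.val (Fin p ⊕ κ) q (Sum.elim z Y)) (Sum.elim (fun _ => n) m) := fun I => by
    refine Continuous.integrable_of_hasCompactSupport (hvp.mul (continuous_wick
      (fun i j => (continuous_groupContr w₁ w₂ D D' I i j).comp
        (f := fun z : Fin p → Spacetime => (z, Y)) (by fun_prop)) (fun q => ?_) _)) hvps.mul_right
    exact (L.continuous_val q).comp (continuous_sumElim.comp
      (Continuous.prodMk continuous_id continuous_const))
  set t : ℕ → ℂ := fun a => ((L.left D (A a)).left D' (B (p - a))).val κ m Y with ht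
  have hterm : ∀ I : Finset (Fin p), (I.card.factorial : ℂ) * (Iᶜ.card.factorial : ℂ) *
      t I.card = Complex.I ^ p * ((-1 : ℂ) ^ Iᶜ.card * Φ I) := by
    intro I
    have hcard : I.card + Iᶜ.card = p := by rw [Finset.card_add_card_compl, Fintype.card_fin]
    have f1 : (I.card.factorial : ℂ) ≠ 0 := Nat.cast_ne_zero.2 (Nat.factorial_ne_zero _)
    have f2 : (Iᶜ.card.factorial : ℂ) ≠ 0 := Nat.cast_ne_zero.2 (Nat.factorial_ne_zero _)
    have hk : p - I.card = Iᶜ.card := by omega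
    set e := finSumEquivOfFinset (rfl : I.card = I.card) (rfl : Iᶜ.card = Iᶜ.card)
    have h₁ : ∀ i, e (Sum.inl i) ∈ I := fun i => by
      rw [finSumEquivOfFinset_inl]; exact Finset.orderEmbOfFin_mem _ _ _
    have h₂ : ∀ j, e (Sum.inr j) ∉ I := fun i => by
      rw [finSumEquivOfFinset_inr, ← Finset.mem_compl]; exact Finset.orderEmbOfFin_mem _ _ _
    simp only [ht, hk]
    rw [(hA I.card).integral_integral_eq (hB Iᶜ.card) L D D' m Y, integral_reindex e.symm]
    simp only [Equiv.symm_symm]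
    simp only [wick_groupContr L w₁ w₂ D D' I e h₁ h₂]
    have hI : -Complex.I = Complex.I * (-1) := by ring
    rw [show Complex.I ^ p = Complex.I ^ I.card * Complex.I ^ Iᶜ.card by rw [← pow_add, hcard],
      hI, mul_pow, hΦ]
    simp only [← integral_const_mul]
    congr 1
    funext z
    rw [← vprod_comp v e, ← vprod_sum]
    field_simp
  have htot := sum_factorial_card (p := p) t
  have f3 : (p.factorial : ℂ) ≠ 0 := Nat.cast_ne_zero.2 (Nat.factorial_ne_zero _)
  have hval : (twoLeft L D D' A B p).val κ m Y = ∑ a ∈ Finset.range (p + 1), t a := rfl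
  rw [hval, ← mul_right_inj' f3, ← htot, Finset.sum_congr rfl fun I _ => hterm I, ← Finset.mul_sum,
    ← mul_assoc, mul_div_cancel₀ _ f3]
  congr 1
  simp only [hΦ, ← integral_const_mul]
  rw [← integral_finsetSum _ fun I _ => (hint I).const_mul _]
  congr 1
  funext z
  simp only [groupSymbol, wick_sum, wick_smul, Finset.mul_sum]
  exact Finset.sum_congr rfl fun I _ => by ring

/-! Time-ordered vertices. -/

/-- The contractions of an anti-time-ordered vertex with the later ones and the points `Y`. -/
def rowFirst (P : Params) {p : ℕ} (r : Equiv.Perm (Fin p)) (z : Fin p → Spacetime)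
    (Y : κ → Spacetime) (i : Fin p) : Fin p ⊕ κ → ℂ :=
  Sum.elim (fun j => if r j < r i then vacuum P (z i - z j) else 0) fun y => vacuum P (z i - Y y)

/-- The contractions of a time-ordered vertex with the later ones and the points `Y`. -/
def rowSecond (P : Params) {p : ℕ} (r : Equiv.Perm (Fin p)) (z : Fin p → Spacetime)
    (Y : κ → Spacetime) (i : Fin p) : Fin p ⊕ κ → ℂ :=
  Sum.elim (fun j => if r j < r i then vacuum P (z j - z i) else 0) fun y => feynman P (z i - Y y)

/-- Now the anti-time-ordered group stands on the left, and the mark of the earlier vertex of a pair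
decides. The contraction with a point of `Y` also depends only on the mark of the vertex. -/
theorem contr_groupContr_bogoliubov (P : Params) {p : ℕ} {z : Fin p → Spacetime}
    {r : Equiv.Perm (Fin p)} (hr : TimeOrdered r z) (I : Finset (Fin p)) (Y : κ → Spacetime) :
    contr (groupContr (antiFeynman P) (feynman P) (vacuum P) (feynman P) I z Y) =
      ∏ i, if i ∈ I then contr (row (Sum.inl i) (rowFirst P r z Y i))
        else contr (row (Sum.inl i) (rowSecond P r z Y i)) := by
  rw [contr_congr (R := Sum.elim (fun i => if i ∈ I then rowFirst P r z Y i
    else rowSecond P r z Y i) 0), contr_sumElim_eq_prod_row]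
  · refine Finset.prod_congr rfl fun i _ => ?_
    split_ifs <;> rfl
  · have key : ∀ i j, r j < r i → marked (antiFeynman P) (feynman P) (vacuum P) I z i j +
        marked (antiFeynman P) (feynman P) (vacuum P) I z j i =
        if i ∈ I then vacuum P (z i - z j) else vacuum P (z j - z i) := by
      intro i j hij
      have hne : i ≠ j := fun h => by simp [h] at hij
      have ht := hr j i hij
      have h1 : (z i - z j).1 ≤ 0 := by simpa using ht
      have h2 : 0 ≤ (z j - z i).1 := by simpa using ht
      unfold marked
      rw [if_neg hne, if_neg hne.symm, feynman_of_nonpos P h1, feynman_of_nonneg P h2,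
        antiFeynman_of_nonpos P h1, antiFeynman_of_nonneg P h2, neg_sub, neg_sub]
      split_ifs <;> ring
    rintro (i | i) (j | j)
    · simp only [groupContr, block, Sum.elim_inl]
      rcases lt_trichotomy (r j) (r i) with h | h | h
      · rw [key i j h]
        split_ifs <;> simp [rowFirst, rowSecond, h, h.not_gt]
      · obtain rfl := r.injective h
        split_ifs <;> simp [marked, rowFirst, rowSecond]
      · rw [add_comm, key j i h]
        split_ifs <;> simp [rowFirst, rowSecond, h, h.not_gt]
    · simp only [groupContr, block, Sum.elim_inl, Sum.elim_inr]
      split_ifs <;> simp [rowFirst, rowSecond]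
    · simp only [groupContr, block, Sum.elim_inl, Sum.elim_inr]
      split_ifs <;> simp [rowFirst, rowSecond]
    · simp [groupContr, block]

/-- The central cancellation. The terms 1 in each difference cancel, so no vertex is left without a
link to a later vertex or to a point of `Y`. -/
theorem groupSymbol_bogoliubov (P : Params) {p : ℕ} {z : Fin p → Spacetime}
    {r : Equiv.Perm (Fin p)} (hr : TimeOrdered r z) (Y : κ → Spacetime) :
    groupSymbol (antiFeynman P) (feynman P) (vacuum P) (feynman P) z Y =
      ∏ i, (contr (row (Sum.inl i) (rowFirst P r z Y i)) -
        contr (row (Sum.inl i) (rowSecond P r z Y i))) := by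
  simp only [groupSymbol, contr_groupContr_bogoliubov P hr]
  rw [sum_marks_prod]
  simp only [neg_smul, one_smul, sub_eq_add_neg]

/-- Causality of R_V: if some vertex is not earlier than any point of `Y`, neither is the latest
one. That vertex has links only to `Y`, where Feynman and vacuum propagators then agree, so its
difference vanishes. -/
theorem groupSymbol_bogoliubov_eq_zero (P : Params) {p : ℕ} {z : Fin p → Spacetime}
    {Y : κ → Spacetime} {i : Fin p} (hi : ∀ y, (Y y).1 ≤ (z i).1) :
    groupSymbol (antiFeynman P) (feynman P) (vacuum P) (feynman P) z Y = 0 := by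
  obtain ⟨r, hr⟩ := exists_timeOrdered z
  rw [groupSymbol_bogoliubov P hr]
  have : NeZero p := ⟨fun h => by subst h; exact i.elim0⟩
  have hbot : ∀ y, (Y y).1 ≤ (z (r.symm ⊥)).1 := fun y => by
    rcases (bot_le : ⊥ ≤ r i).lt_or_eq with h | h
    · exact (hi y).trans (hr _ _ (by simpa using h))
    · rw [h, Equiv.symm_apply_apply]; exact hi y
  refine Finset.prod_eq_zero (Finset.mem_univ (r.symm ⊥)) (sub_eq_zero.2 ?_)
  congr 2
  funext x
  rcases x with j | y
  · simp [rowFirst, rowSecond]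
  · simp only [rowFirst, rowSecond, Sum.elim_inr]
    rw [feynman_of_nonneg]
    simpa using hbot y

/-- For R_V^{-1} every contraction among vertices is a Feynman propagator, regardless of the marks.
It can be factored out without any time ordering; only the links to `Y` see the marks. -/
theorem contr_groupContr_inv (P : Params) {p : ℕ} (z : Fin p → Spacetime)
    (I : Finset (Fin p)) (Y : κ → Spacetime) :
    contr (groupContr (feynman P) (feynman P) (feynman P) (vacuum P) I z Y) =
      contr (block (offDiag (feynman P) z) 0 0) *
      ∏ i, if i ∈ I then contr (row (Sum.inl i) (Sum.elim 0 fun y => feynman P (z i - Y y)))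
        else contr (row (Sum.inl i) (Sum.elim 0 fun y => vacuum P (z i - Y y))) := by
  have h : (∏ i, if i ∈ I then
        contr (row (Sum.inl i) (Sum.elim (0 : Fin p → ℂ) fun y => feynman P (z i - Y y)))
        else contr (row (Sum.inl i) (Sum.elim 0 fun y => vacuum P (z i - Y y)))) =
      contr (Sum.elim (fun i => if i ∈ I then Sum.elim 0 fun y => feynman P (z i - Y y)
        else Sum.elim 0 fun y => vacuum P (z i - Y y)) 0) := by
    rw [contr_sumElim_eq_prod_row]
    refine Finset.prod_congr rfl fun i _ => ?_
    split_ifs <;> rfl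
  rw [h, ← contr_add]
  refine contr_congr fun x y => ?_
  rcases x with i | i <;> rcases y with j | j
  · simp only [groupContr, block, Sum.elim_inl, Pi.add_apply, marked, offDiag]
    rw [show z i - z j = -(z j - z i) by abel, feynman_neg]
    split_ifs <;> simp
  · simp only [groupContr, block, Sum.elim_inl, Sum.elim_inr, Pi.add_apply]
    split_ifs <;> simp
  · simp only [groupContr, block, Sum.elim_inl, Sum.elim_inr, Pi.add_apply]
    split_ifs <;> simp
  · simp [groupContr, block]

/-- Here the vertex `i` itself has a vanishing factor; it need not be the latest one. -/
theorem groupSymbol_inv_eq_zero (P : Params) {p : ℕ} {z : Fin p → Spacetime}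
    {Y : κ → Spacetime} {i : Fin p} (hi : ∀ y, (Y y).1 ≤ (z i).1) :
    groupSymbol (feynman P) (feynman P) (feynman P) (vacuum P) z Y = 0 := by
  simp only [groupSymbol, contr_groupContr_inv, ← mul_smul_comm]
  rw [← Finset.mul_sum, sum_marks_prod, Finset.prod_eq_zero (Finset.mem_univ i), mul_zero]
  rw [neg_smul, one_smul, add_neg_eq_zero]
  congr 2
  funext x
  rcases x with j | y
  · rfl
  · exact feynman_of_nonneg P (by simpa using hi y)

end TwoGroups

/-! ### Locality of the interacting evolution -/

/-- The observer composed with the free time evolution. -/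
def Observer.shift (L : Observer) (t : ℝ) : Observer where
  val ι _ n X := L.val ι n fun i => X i + (t, 0)
  natural e n X := L.natural e n fun i => X i + (t, 0)
  continuous_val n := (L.continuous_val n).comp (by fun_prop)

theorem isAddHaarMeasure_spacetime : (volume : Measure Spacetime).IsAddHaarMeasure :=
  inferInstanceAs (Measure.prod volume volume).IsAddHaarMeasure

theorem pair_evolve (L : Observer) (t : ℝ) (A : Obs) :
    pair L (A.evolve t) = pair (L.shift t) A := by
  classical
  rw [Obs.evolve, map_dfinsuppSum, pair_eq_sum]
  simp only [pair_monomial]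
  refine Finset.sum_congr rfl fun i _ => ?_
  have := isAddHaarMeasure_spacetime
  have hv : (volume : Measure (Fin i.1 → Spacetime)).IsAddRightInvariant :=
    inferInstanceAs (Measure.pi fun _ => volume).IsAddRightInvariant
  simp only
  rw [← integral_add_right_eq_self _ (fun _ => ((t, 0) : Spacetime))]
  refine integral_congr_ae (ae_of_all _ fun X => ?_)
  change A i (fun k => X k + (t, 0) - (t, 0)) * L.val (Fin i.1) i.2 (fun k => X k + (t, 0)) = _
  simp only [add_sub_cancel_right]
  rfl

/-- The observer composed with the Bogoliubov map, at order `p` of the interaction. -/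
def bogoliubovObserver (P : Params) (V : Obs) (L : Observer) (p : ℕ) : Observer :=
  twoLeft L (vacuum P) (feynman P) (Series.starInv P (sMatrix P V)) (sMatrix P V) p

/-- The observer composed with the inverse of the Bogoliubov map, at order `p`. -/
def bogoliubovInvObserver (P : Params) (V : Obs) (L : Observer) (p : ℕ) : Observer :=
  twoLeft L (feynman P) (vacuum P) (sMatrix P (-V)) (sMatrix P V) p

theorem pair_bogoliubov (P : Params) (V : Obs) (L : Observer) (A : Series) (k : ℕ) :
    pair L (bogoliubov P V A k) =
      ∑ p ∈ Finset.range (k + 1), pair (bogoliubovObserver P V L p) (A (k - p)) :=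
  pair_series_mul_mul _ _ _ _ _ _ _

theorem pair_bogoliubovInv (P : Params) (V : Obs) (L : Observer) (B : Series) (k : ℕ) :
    pair L (bogoliubovInv P V B k) =
      ∑ p ∈ Finset.range (k + 1), pair (bogoliubovInvObserver P V L p) (B (k - p)) :=
  pair_series_mul_mul _ _ _ _ _ _ _

theorem pair_evolveWith (P : Params) (V : Obs) (t : ℝ) (L : Observer) (B : Series) (k : ℕ) :
    pair L (evolveWith P V t B k) = ∑ p ∈ Finset.range (k + 1),
      pair ((bogoliubovObserver P V L p).shift t) (bogoliubovInv P V B (k - p)) := by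
  rw [evolveWith, pair_bogoliubov]
  simp only [pair_evolve]

/-- `V = ∫ v(x) φ(x)^n dx`. -/
structure IsVertex (V : Obs) (v : Spacetime → ℂ) (n : ℕ) : Prop where
  continuous : Continuous v
  hasCompactSupport : HasCompactSupport v
  rep : Rep V (ι := Unit) (vprod v) 0 fun _ => n

theorem isVertex_interaction (n : ℕ) (χ : C_c(ℝ, ℝ)) (h : C_c(Space, ℝ)) :
    IsVertex (interaction n χ h) (fun x => ((χ x.1 * h x.2 : ℝ) : ℂ)) n := by
  have h1 := χ.continuous
  have h2 := h.continuous
  have hc : Continuous fun x : Spacetime => ((χ x.1 * h x.2 : ℝ) : ℂ) := by fun_prop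
  have hs : HasCompactSupport fun x : Spacetime => ((χ x.1 * h x.2 : ℝ) : ℂ) := by
    refine HasCompactSupport.intro (χ.hasCompactSupport.isCompact.prod h.hasCompactSupport.isCompact)
      fun x hx => ?_
    by_contra hne
    have hne' := Complex.ofReal_ne_zero.1 hne
    exact hx ⟨subset_tsupport _ (left_ne_zero_of_mul hne'),
      subset_tsupport _ (right_ne_zero_of_mul hne')⟩
  refine ⟨hc, hs, ?_⟩
  have hv : Continuous (vprod (fun x : Spacetime => ((χ x.1 * h x.2 : ℝ) : ℂ)) :
      (Unit → Spacetime) → ℂ) := by unfold vprod; fun_prop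
  refine ⟨hv, ?_, fun i j => continuous_const, fun L => ?_⟩
  · have e := hs.comp_homeomorph (Homeomorph.funUnique Unit Spacetime)
    convert! e using 1
    funext z
    simp [vprod]
  · rw [interaction, pair_monomial, integral_reindex (finOneEquiv.symm : Unit ≃ Fin 1)]
    refine integral_congr_ae (ae_of_all _ fun X => ?_)
    simp only [Pi.zero_apply, contr_zero, wick_one, Equiv.symm_symm]
    rw [← L.natural (finOneEquiv.symm : Unit ≃ Fin 1)]
    congr 1
    simp [vprod]

theorem IsVertex.neg {V : Obs} {v : Spacetime → ℂ} {n : ℕ} (hV : IsVertex V v n) :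
    Rep (-V) (ι := Unit) (vprod fun x => -v x) 0 fun _ => n := by
  have h := hV.rep.smul (-1)
  rw [show (-1 : ℂ) • V = -V from DFinsupp.ext fun i => by
    rw [DFinsupp.smul_apply, DFinsupp.neg_apply, neg_one_smul]] at h
  exact h.congr (fun X => by simp [vprod]) (fun _ _ _ => rfl) (fun _ _ => continuous_const) rfl

section Locality

variable {κ : Type} [Fintype κ] {P : Params} {V : Obs} {v : Spacetime → ℂ} {n : ℕ}

theorem bogoliubovObserver_val (hV : IsVertex V v n) (L : Observer) (p : ℕ) (m : κ → ℕ)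
    (Y : κ → Spacetime) :
    (bogoliubovObserver P V L p).val κ m Y = (Complex.I ^ p / (p.factorial : ℂ)) *
      ∫ z : Fin p → Spacetime, vprod v z *
        wick (groupSymbol (antiFeynman P) (feynman P) (vacuum P) (feynman P) z Y)
          (fun q => L.val (Fin p ⊕ κ) q (Sum.elim z Y)) (Sum.elim (fun _ => n) m) :=
  twoLeft_val (rep_starInv P hV.rep) (rep_sMatrix P hV.rep) hV.continuous hV.hasCompactSupport
    _ _ _ _ _ _

theorem bogoliubovInvObserver_val (hV : IsVertex V v n) (L : Observer) (p : ℕ) (m : κ → ℕ)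
    (Y : κ → Spacetime) :
    (bogoliubovInvObserver P V L p).val κ m Y = (Complex.I ^ p / (p.factorial : ℂ)) *
      ∫ z : Fin p → Spacetime, vprod v z *
        wick (groupSymbol (feynman P) (feynman P) (feynman P) (vacuum P) z Y)
          (fun q => L.val (Fin p ⊕ κ) q (Sum.elim z Y)) (Sum.elim (fun _ => n) m) := by
  refine twoLeft_val (fun a => ?_) (rep_sMatrix P hV.rep) hV.continuous hV.hasCompactSupport
    _ _ _ _ _ _
  refine (rep_sMatrix P hV.neg a).congr (fun X => ?_) (fun _ _ _ => rfl)
    (fun i j => continuous_offDiag _ i j) rfl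
  -- The signs from -V turn the coefficients (-i)^a of S(-V) into i^a, the form required by
  -- `twoLeft_val`.
  have : vprod (fun x => -v x) X = (-1) ^ a * vprod v X := by
    simp [vprod, Finset.prod_neg]
  rw [this, neg_pow]
  have h1 : ((-1 : ℂ) ^ a) * (-1) ^ a = 1 := by rw [← mul_pow]; simp
  linear_combination (Complex.I ^ a / (a.factorial : ℂ) * vprod v X) * h1

/-- If some vertex is later than `T`, it is later than all of `Y` and the symbol vanishes; all other
configurations see the interaction and the observer only up to time `T`. -/
theorem integral_wick_congr {p : ℕ} {v' : Spacetime → ℂ} {L L' : Observer} {T : ℝ}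
    {Y : κ → Spacetime} {G : (Fin p → Spacetime) → MvPowerSeries (Fin p ⊕ κ) ℂ}
    (hG : ∀ z i, (∀ y, (Y y).1 ≤ (z i).1) → G z = 0) (hY : ∀ y, (Y y).1 ≤ T)
    (hv : ∀ x : Spacetime, x.1 ≤ T → v x = v' x)
    (hL : ∀ (q : Fin p ⊕ κ → ℕ) (X : Fin p ⊕ κ → Spacetime), (∀ x, (X x).1 ≤ T) →
      L.val _ q X = L'.val _ q X) (m : Fin p ⊕ κ → ℕ) :
    ∫ z : Fin p → Spacetime, vprod v z * wick (G z) (fun q => L.val _ q (Sum.elim z Y)) m =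
      ∫ z : Fin p → Spacetime, vprod v' z * wick (G z) (fun q => L'.val _ q (Sum.elim z Y)) m := by
  congr 1
  funext z
  by_cases hz : ∀ i, (z i).1 ≤ T
  · congr 1
    · exact Finset.prod_congr rfl fun i _ => hv _ (hz i)
    · congr 1
      funext q
      refine hL q _ fun x => ?_
      rcases x with i | y
      · exact hz i
      · exact hY y
  · push Not at hz
    obtain ⟨i, hi⟩ := hz
    rw [hG z i fun y => (hY y).trans hi.le, wick_zero, wick_zero, mul_zero, mul_zero]

/-- The observer composed with the Bogoliubov map depends only on the past. -/
theorem bogoliubovObserver_congr {V' : Obs} {v' : Spacetime → ℂ} (hV : IsVertex V v n)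
    (hV' : IsVertex V' v' n) {T : ℝ} (hv : ∀ x : Spacetime, x.1 ≤ T → v x = v' x) (L : Observer)
    (p : ℕ) (m : κ → ℕ) {Y : κ → Spacetime} (hY : ∀ y, (Y y).1 ≤ T) :
    (bogoliubovObserver P V L p).val κ m Y = (bogoliubovObserver P V' L p).val κ m Y := by
  rw [bogoliubovObserver_val hV, bogoliubovObserver_val hV']
  congr 1
  exact integral_wick_congr (fun z i hi => groupSymbol_bogoliubov_eq_zero P hi) hY hv
    (fun _ _ _ => rfl) _

theorem bogoliubovInvObserver_congr {V' : Obs} {v' : Spacetime → ℂ} (hV : IsVertex V v n)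
    (hV' : IsVertex V' v' n) {T : ℝ} (hv : ∀ x : Spacetime, x.1 ≤ T → v x = v' x)
    {L L' : Observer} (hL : ∀ (ι : Type) [Fintype ι] (q : ι → ℕ) (X : ι → Spacetime),
      (∀ x, (X x).1 ≤ T) → L.val _ q X = L'.val _ q X)
    (p : ℕ) (m : κ → ℕ) {Y : κ → Spacetime} (hY : ∀ y, (Y y).1 ≤ T) :
    (bogoliubovInvObserver P V L p).val κ m Y = (bogoliubovInvObserver P V' L' p).val κ m Y := by
  rw [bogoliubovInvObserver_val hV, bogoliubovInvObserver_val hV']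
  congr 1
  exact integral_wick_congr (fun z i hi => groupSymbol_inv_eq_zero P hi) hY hv
    (fun q X hX => hL _ q X hX) _

end Locality

open Classical in
/-- The kernels of the coefficients of `B` up to order `k` are supported in times at most `T`. -/
def SupportedBefore (B : Series) (k : ℕ) (T : ℝ) : Prop :=
  ∀ j ≤ k, ∀ i ∈ (B j).support, ∀ X, B j i X ≠ 0 → ∀ x, (X x).1 ≤ T

theorem exists_supportedBefore (B : Series) (k : ℕ) : ∃ T, SupportedBefore B k T := by
  classical
  have h1 : ∀ (l : ℕ) (f : Kernel l), ∃ T : ℝ, ∀ X, f X ≠ 0 → ∀ x, (X x).1 ≤ T := by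
    intro l f
    obtain ⟨R, hR⟩ := f.hasCompactSupport.isCompact.isBounded.exists_norm_le
    refine ⟨R, fun X hX x => ?_⟩
    have := hR X (subset_tsupport _ hX)
    exact (le_abs_self _).trans (((norm_fst_le (X x)).trans (norm_le_pi_norm X x)).trans this)
  choose T hT using h1
  refine ⟨∑ j ∈ Finset.range (k + 1), ∑ i ∈ (B j).support, |T i.1 (B j i)|,
    fun j hj i hi X hX x => ?_⟩
  calc (X x).1 ≤ |T i.1 (B j i)| := (hT _ _ X hX x).trans (le_abs_self _)
    _ ≤ ∑ i ∈ (B j).support, |T i.1 (B j i)| :=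
      Finset.single_le_sum (f := fun i => |T i.1 (B j i)|) (fun _ _ => abs_nonneg _) hi
    _ ≤ _ := Finset.single_le_sum
      (f := fun j => ∑ i ∈ (B j).support, |T i.1 (B j i)|)
      (fun _ _ => Finset.sum_nonneg fun _ _ => abs_nonneg _)
      (Finset.mem_range.2 (Nat.lt_succ_of_le hj))

section Evolution

variable {P : Params} {V V' : Obs} {v v' : Spacetime → ℂ} {n : ℕ}

theorem pair_bogoliubovInv_congr (hV : IsVertex V v n) (hV' : IsVertex V' v' n) {T : ℝ}
    (hv : ∀ x : Spacetime, x.1 ≤ T → v x = v' x) {L L' : Observer}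
    (hL : ∀ (ι : Type) [Fintype ι] (q : ι → ℕ) (X : ι → Spacetime),
      (∀ x, (X x).1 ≤ T) → L.val _ q X = L'.val _ q X) {B : Series} {k : ℕ}
    (hB : SupportedBefore B k T) :
    pair L (bogoliubovInv P V B k) = pair L' (bogoliubovInv P V' B k) := by
  rw [pair_bogoliubovInv, pair_bogoliubovInv]
  refine Finset.sum_congr rfl fun p _ => pair_congr_support fun i hi X hX => ?_
  exact bogoliubovInvObserver_congr hV hV' hv hL p _ (hB _ (Nat.sub_le _ _) i hi X hX)

theorem SupportedBefore.mono {B : Series} {k k' : ℕ} {T T' : ℝ} (hB : SupportedBefore B k T)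
    (hk : k' ≤ k) (hT : T ≤ T') : SupportedBefore B k' T' :=
  fun j hj i hi X hX x => (hB j (hj.trans hk) i hi X hX x).trans hT

/-- The interacting evolution up to order `k` does not depend on the late interaction. -/
theorem pair_evolveWith_congr (hV : IsVertex V v n) (hV' : IsVertex V' v' n) {T t : ℝ}
    {B : Series} {k : ℕ} (hB : SupportedBefore B k T)
    (hv : ∀ x : Spacetime, x.1 ≤ T + |t| → v x = v' x) (L : Observer) :
    pair L (evolveWith P V t B k) = pair L (evolveWith P V' t B k) := by
  rw [pair_evolveWith, pair_evolveWith]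
  refine Finset.sum_congr rfl fun p _ => ?_
  have h1 : ∀ x : Spacetime, x.1 ≤ T → v x = v' x := fun x hx =>
    hv x (hx.trans (by linarith [abs_nonneg t]))
  -- The free evolution moves the points by t, hence at most to T + |t|. This is why the cutoffs
  -- must agree up to that time.
  have h2 : ∀ (ι : Type) [Fintype ι] (q : ι → ℕ) (X : ι → Spacetime), (∀ x, (X x).1 ≤ T) →
      (bogoliubovObserver P V L p).val ι q (fun x => X x + (t, 0)) =
        (bogoliubovObserver P V' L p).val ι q (fun x => X x + (t, 0)) := by
    intro ι _ q X hX
    refine bogoliubovObserver_congr hV hV' hv L p q fun x => ?_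
    have := hX x
    simp only [Prod.fst_add]
    linarith [le_abs_self t]
  exact pair_bogoliubovInv_congr hV hV' h1 h2 (hB.mono (Nat.sub_le _ _) le_rfl)

/-- The interacting evolution in terms of a fixed inverse Bogoliubov map. -/
theorem pair_evolveWith_eq (hV : IsVertex V v n) (hV' : IsVertex V' v' n) {T : ℝ}
    {B : Series} {k : ℕ} (hB : SupportedBefore B k T)
    (hv : ∀ x : Spacetime, x.1 ≤ T → v x = v' x) (L : Observer) (t : ℝ) :
    pair L (evolveWith P V t B k) = ∑ p ∈ Finset.range (k + 1),
      pair ((bogoliubovObserver P V L p).shift t) (bogoliubovInv P V' B (k - p)) := by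
  rw [pair_evolveWith]
  exact Finset.sum_congr rfl fun p _ => pair_bogoliubovInv_congr hV hV' hv
    (fun _ _ _ _ _ => rfl) (hB.mono (Nat.sub_le _ _) le_rfl)

end Evolution

/-! ### Decay of the propagators in time -/

/-- `u` and its first two derivatives are bounded by `K (1 + r)^{-N}` on the half line. -/
def IsSymbol (K : ℝ) (N : ℕ) (u : ℝ → ℂ) : Prop :=
  ∃ u₁ u₂ : ℝ → ℂ, (∀ r, HasDerivAt u (u₁ r) r) ∧ (∀ r, HasDerivAt u₁ (u₂ r) r) ∧
    ∀ r, 0 ≤ r → ‖u r‖ ≤ K / (1 + r) ^ N ∧ ‖u₁ r‖ ≤ K / (1 + r) ^ N ∧ ‖u₂ r‖ ≤ K / (1 + r) ^ N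

theorem IsSymbol.nonneg {K : ℝ} {N : ℕ} {u : ℝ → ℂ} (hu : IsSymbol K N u) : 0 ≤ K := by
  obtain ⟨_, _, _, _, h⟩ := hu
  have := (norm_nonneg _).trans (h 0 le_rfl).1
  simpa using this

/-- The factor 4 counts the terms of the second derivative of a product. -/
theorem IsSymbol.mul {K K' : ℝ} {N : ℕ} {u v : ℝ → ℂ} (hu : IsSymbol K N u)
    (hv : IsSymbol K' 0 v) : IsSymbol (4 * K * K') N fun r => u r * v r := by
  have hK := hu.nonneg
  have hK' := hv.nonneg
  obtain ⟨u₁, u₂, h1, h2, hb⟩ := hu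
  obtain ⟨v₁, v₂, g1, g2, gb⟩ := hv
  refine ⟨fun r => u₁ r * v r + u r * v₁ r,
    fun r => (u₂ r * v r + u₁ r * v₁ r) + (u₁ r * v₁ r + u r * v₂ r),
    fun r => (h1 r).mul (g1 r), fun r => ((h2 r).mul (g1 r)).add ((h1 r).mul (g2 r)),
    fun r hr => ?_⟩
  obtain ⟨a0, a1, a2⟩ := hb r hr
  obtain ⟨b0, b1, b2⟩ := gb r hr
  simp only [pow_zero, div_one] at b0 b1 b2
  have key : ∀ x y : ℂ, ‖x‖ ≤ K / (1 + r) ^ N → ‖y‖ ≤ K' → ‖x * y‖ ≤ K / (1 + r) ^ N * K' :=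
    fun x y hx hy => by
      rw [norm_mul]
      exact mul_le_mul hx hy (norm_nonneg _) (by positivity)
  have e : 4 * K * K' / (1 + r) ^ N = 4 * (K / (1 + r) ^ N * K') := by ring
  have hp : 0 ≤ K / (1 + r) ^ N * K' := by positivity
  rw [e]
  refine ⟨?_, ?_, ?_⟩
  · linarith [key _ _ a0 b0]
  · linarith [norm_add_le (u₁ r * v r) (u r * v₁ r), key _ _ a1 b0, key _ _ a0 b1]
  · linarith [norm_add_le (u₂ r * v r + u₁ r * v₁ r) (u₁ r * v₁ r + u r * v₂ r),
      norm_add_le (u₂ r * v r) (u₁ r * v₁ r), norm_add_le (u₁ r * v₁ r) (u r * v₂ r),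
      key _ _ a2 b0, key _ _ a1 b1, key _ _ a0 b2]

theorem hasDerivAt_sqrt_sq_add {m : ℝ} (hm : 0 < m) (r : ℝ) :
    HasDerivAt (fun r : ℝ => √(r ^ 2 + m ^ 2)) (r / √(r ^ 2 + m ^ 2)) r := by
  have h := ((hasDerivAt_pow 2 r).add_const (m ^ 2)).sqrt (by positivity)
  convert! h using 1
  have : √(r ^ 2 + m ^ 2) ≠ 0 := by positivity
  field_simp
  simp [mul_comm]

theorem isSymbol_const (c : ℂ) : IsSymbol ‖c‖ 0 fun _ => c :=
  ⟨fun _ => 0, fun _ => 0, fun r => hasDerivAt_const r c, fun r => hasDerivAt_const r 0,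
    fun r _ => by simp⟩

/-- The spatial plane wave along a ray. It is treated as part of the amplitude and not of the phase,
so the bounds are uniform only for bounded positions. -/
theorem isSymbol_exp {R b : ℝ} (hb : |b| ≤ R) :
    IsSymbol ((1 + R) ^ 2) 0 fun r => Complex.exp (Complex.I * (r * b : ℝ)) := by
  have hd : ∀ r : ℝ, HasDerivAt (fun r : ℝ => Complex.exp (Complex.I * (r * b : ℝ)))
      (Complex.exp (Complex.I * (r * b : ℝ)) * (Complex.I * b)) r := fun r => by
    have h1 : HasDerivAt (fun r : ℝ => Complex.I * ((r * b : ℝ) : ℂ)) (Complex.I * b) r := by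
      have := ((hasDerivAt_id r).mul_const b).ofReal_comp.const_mul Complex.I
      simpa using this
    exact h1.cexp
  refine ⟨_, _, hd, fun r => (hd r).mul_const _, fun r _ => ?_⟩
  have h0 : 0 ≤ |b| := abs_nonneg b
  have : ‖Complex.exp (Complex.I * (r * b : ℝ))‖ = 1 := by simp [Complex.norm_exp]
  simp only [norm_mul, this, Complex.norm_I, Complex.norm_real, Real.norm_eq_abs, pow_zero, div_one]
  refine ⟨?_, ?_, ?_⟩ <;> nlinarith

/-- Four powers are the decay wanted of the Gaussian amplitude; two more pay for the quadratic
factor in its second derivative. -/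
theorem one_add_pow_six_mul_exp_le {c : ℝ} (hc : 0 < c) {r : ℝ} (hr : 0 ≤ r) :
    (1 + r) ^ 6 * Real.exp (-c * r ^ 2) ≤ 32 * (1 + 6 / c ^ 3) := by
  have hx : 0 ≤ c * r ^ 2 := by positivity
  have h1 : (c * r ^ 2) ^ 3 ≤ 6 * Real.exp (c * r ^ 2) := by
    have := Real.pow_div_factorial_le_exp _ hx 3
    rw [show ((Nat.factorial 3 : ℕ) : ℝ) = 6 by norm_num [Nat.factorial]] at this
    linarith [(div_le_iff₀ (by norm_num : (0 : ℝ) < 6)).1 this]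
  have h2 : 1 ≤ Real.exp (c * r ^ 2) := Real.one_le_exp hx
  have h3 : (1 + r) ^ 2 ≤ 2 * (1 + r ^ 2) := by nlinarith [sq_nonneg (1 - r)]
  have h4 : (1 + r) ^ 6 ≤ (2 * (1 + r ^ 2)) ^ 3 := by
    calc (1 + r) ^ 6 = ((1 + r) ^ 2) ^ 3 := by ring
      _ ≤ _ := by gcongr
  have h5 : (1 + r ^ 2) ^ 3 ≤ 4 * (1 + (r ^ 2) ^ 3) := by
    nlinarith [sq_nonneg r, sq_nonneg (1 - r ^ 2), mul_nonneg (sq_nonneg r) (sq_nonneg (1 - r ^ 2))]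
  have h6 : (r ^ 2) ^ 3 ≤ 6 / c ^ 3 * Real.exp (c * r ^ 2) := by
    rw [div_mul_eq_mul_div, le_div_iff₀ (by positivity)]
    calc _ = (c * r ^ 2) ^ 3 := by ring
      _ ≤ _ := h1
  have h7 : (1 + r) ^ 6 ≤ 32 * (1 + 6 / c ^ 3) * Real.exp (c * r ^ 2) := by
    calc (1 + r) ^ 6 ≤ 8 * (1 + r ^ 2) ^ 3 := by linarith [h4, mul_pow (2 : ℝ) (1 + r ^ 2) 3]
      _ ≤ _ := by nlinarith
  rw [neg_mul, Real.exp_neg, ← div_eq_mul_inv, div_le_iff₀ (Real.exp_pos _)]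
  exact h7

theorem exists_isSymbol_gauss {c : ℝ} (hc : 0 < c) :
    ∃ K, IsSymbol K 4 fun r => ((Real.exp (-c * r ^ 2) / 2 : ℝ) : ℂ) := by
  have hd : ∀ r : ℝ, HasDerivAt (fun r : ℝ => Real.exp (-c * r ^ 2) / 2)
      (Real.exp (-c * r ^ 2) / 2 * (-2 * c * r)) r := fun r => by
    have h1 : HasDerivAt (fun r : ℝ => -c * r ^ 2) (-c * (2 * r)) r := by
      simpa using (hasDerivAt_pow 2 r).const_mul (-c)
    convert! h1.exp.div_const 2 using 1
    ring
  refine ⟨32 * (1 + 6 / c ^ 3) * (1 + 2 * c + 4 * c ^ 2),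
    fun r => ((Real.exp (-c * r ^ 2) / 2 * (-2 * c * r) : ℝ) : ℂ),
    fun r => ((Real.exp (-c * r ^ 2) / 2 * (-2 * c * r) * (-2 * c * r) +
      Real.exp (-c * r ^ 2) / 2 * (-2 * c) : ℝ) : ℂ),
    fun r => (hd r).ofReal_comp, fun r => ?_, fun r hr => ?_⟩
  · have := (hd r).mul ((hasDerivAt_id r).const_mul (-2 * c))
    simp only [mul_one, id] at this
    exact this.ofReal_comp
  · have hb := one_add_pow_six_mul_exp_le hc hr
    set E := Real.exp (-c * r ^ 2)
    have hE : 0 < E := Real.exp_pos _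
    set K := 32 * (1 + 6 / c ^ 3)
    have main : ∀ x : ℝ, |x| ≤ (1 + r) ^ 2 * (1 + 2 * c + 4 * c ^ 2) →
        ‖((E / 2 * x : ℝ) : ℂ)‖ ≤ K * (1 + 2 * c + 4 * c ^ 2) / (1 + r) ^ 4 := fun x hx => by
      rw [Complex.norm_real, Real.norm_eq_abs, abs_mul, abs_of_pos (half_pos hE),
        le_div_iff₀ (by positivity)]
      have hx' := mul_le_mul_of_nonneg_left hx hE.le
      have h1 : E / 2 * |x| ≤ E * |x| := by gcongr; linarith
      calc E / 2 * |x| * (1 + r) ^ 4 ≤ E * ((1 + r) ^ 2 * (1 + 2 * c + 4 * c ^ 2)) * (1 + r) ^ 4 := by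
            gcongr; linarith
        _ = ((1 + r) ^ 6 * E) * (1 + 2 * c + 4 * c ^ 2) := by ring
        _ ≤ _ := by gcongr
    have hr1 : 1 ≤ (1 + r) ^ 2 := by nlinarith
    have hr2 : r ≤ (1 + r) ^ 2 := by nlinarith
    have hr3 : r ^ 2 ≤ (1 + r) ^ 2 := by nlinarith
    refine ⟨?_, ?_, ?_⟩
    · have := main 1 (by rw [abs_one]; nlinarith)
      rwa [mul_one] at this
    · refine main _ ?_
      rw [abs_mul, abs_of_nonneg hr, abs_of_nonpos (by linarith)]
      nlinarith
    · change ‖((E / 2 * (-2 * c * r) * (-2 * c * r) + E / 2 * (-2 * c) : ℝ) : ℂ)‖ ≤ _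
      rw [show E / 2 * (-2 * c * r) * (-2 * c * r) + E / 2 * (-2 * c) =
        E / 2 * (4 * c ^ 2 * r ^ 2 - 2 * c) by ring]
      refine main _ ?_
      rw [abs_le]
      constructor <;> nlinarith [sq_nonneg (c * r), sq_nonneg c, mul_pos hc hc,
        mul_le_mul_of_nonneg_left hr3 (by positivity : 0 ≤ 4 * c ^ 2),
        mul_le_mul_of_nonneg_left hr1 hc.le]

/-- The Bose factor as a function of the modulus of the momentum. -/
theorem exists_isSymbol_bose {m β : ℝ} (hm : 0 < m) (hβ : 0 < β) :
    ∃ K, IsSymbol K 0 fun r => ((1 / (Real.exp (β * √(r ^ 2 + m ^ 2)) - 1) : ℝ) : ℂ) := by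
  set Ω : ℝ → ℝ := fun r => √(r ^ 2 + m ^ 2) with hΩ
  set φ : ℝ → ℝ := fun s => 1 / (Real.exp (β * s) - 1) with hφ
  have hΩm : ∀ r, m ≤ Ω r := fun r => Real.le_sqrt_of_sq_le (by nlinarith [sq_nonneg r])
  have hΩ0 : ∀ r, 0 < Ω r := fun r => hm.trans_le (hΩm r)
  have hpos : ∀ s, 0 < s → 0 < Real.exp (β * s) - 1 := fun s hs => by
    have := Real.one_lt_exp_iff.2 (mul_pos hβ hs)
    linarith
  -- The Bose function solves a Riccati equation, so its derivatives are polynomials in it. They are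
  -- bounded because the energy is at least m > 0.
  have hdφ : ∀ s, 0 < s → HasDerivAt φ (-β * (φ s + φ s ^ 2)) s := fun s hs => by
    have h0 := hpos s hs
    have h1 : HasDerivAt (fun s => Real.exp (β * s) - 1) (Real.exp (β * s) * β) s := by
      have := ((hasDerivAt_id s).const_mul β).exp.sub_const 1
      simpa using this
    have h2 := h1.inv h0.ne'
    simp only [hφ, one_div]
    convert! h2 using 1
    field_simp
    ring
  have hdΩ : ∀ r, HasDerivAt Ω (r / Ω r) r := hasDerivAt_sqrt_sq_add hm
  have hd1 : ∀ r, HasDerivAt (fun r => φ (Ω r)) (-β * (φ (Ω r) + φ (Ω r) ^ 2) * (r / Ω r)) r :=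
    fun r => (hdφ _ (hΩ0 r)).comp r (hdΩ r)
  have hd2 : ∀ r, HasDerivAt (fun r => -β * (φ (Ω r) + φ (Ω r) ^ 2) * (r / Ω r))
      (-β * (-β * (φ (Ω r) + φ (Ω r) ^ 2) * (r / Ω r) +
        2 * φ (Ω r) * (-β * (φ (Ω r) + φ (Ω r) ^ 2) * (r / Ω r))) * (r / Ω r) +
        -β * (φ (Ω r) + φ (Ω r) ^ 2) * ((Ω r - r * (r / Ω r)) / Ω r ^ 2)) r := fun r => by
    have a := (((hd1 r).add ((hd1 r).pow 2)).const_mul (-β)).mul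
      ((hasDerivAt_id r).div (hdΩ r) (hΩ0 r).ne')
    convert! a using 1
    simp
  set N := φ m with hN
  have hN0 : 0 < N := by rw [hN]; exact one_div_pos.2 (hpos m hm)
  have hφ0 : ∀ r, 0 < φ (Ω r) := fun r => one_div_pos.2 (hpos _ (hΩ0 r))
  have hφN : ∀ r, φ (Ω r) ≤ N := fun r => by
    refine one_div_le_one_div_of_le (hpos m hm) ?_
    have : Real.exp (β * m) ≤ Real.exp (β * Ω r) := Real.exp_le_exp.2 (by have := hΩm r; gcongr)
    linarith
  set L := β * (N + N ^ 2) with hL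
  have hL0 : 0 < L := by positivity
  have hb1 : ∀ r, |-β * (φ (Ω r) + φ (Ω r) ^ 2)| ≤ L := fun r => by
    have := hφ0 r
    rw [abs_mul, abs_neg, abs_of_pos hβ, abs_of_pos (by positivity)]
    have h1 := hφN r
    exact mul_le_mul_of_nonneg_left (add_le_add h1 (pow_le_pow_left₀ this.le h1 2)) hβ.le
  have hq : ∀ r, 0 ≤ r → |r / Ω r| ≤ 1 := fun r hr => by
    rw [abs_of_nonneg (div_nonneg hr (hΩ0 r).le), div_le_one (hΩ0 r)]
    exact Real.le_sqrt_of_sq_le (by nlinarith)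
  have hq2 : ∀ r, |(Ω r - r * (r / Ω r)) / Ω r ^ 2| ≤ 1 / m := fun r => by
    have h0 := hΩ0 r
    have hsq : Ω r ^ 2 = r ^ 2 + m ^ 2 := Real.sq_sqrt (by positivity)
    rw [show (Ω r - r * (r / Ω r)) / Ω r ^ 2 = m ^ 2 / Ω r ^ 3 by
      field_simp; linarith, abs_of_nonneg (by positivity), div_le_div_iff₀ (by positivity) hm]
    have := hΩm r
    calc m ^ 2 * m = m ^ 3 := by ring
      _ ≤ Ω r ^ 3 := by gcongr
      _ = _ := by ring
  refine ⟨N + L + β * (L + 2 * N * L) + L * (1 / m), _, _, fun r => (hd1 r).ofReal_comp,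
    fun r => (hd2 r).ofReal_comp, fun r hr => ?_⟩
  simp only [Complex.norm_real, Real.norm_eq_abs, pow_zero, div_one]
  have p1 : 0 ≤ β * (L + 2 * N * L) := by positivity
  have p2 : 0 ≤ L * (1 / m) := by positivity
  have k1 : |-β * (φ (Ω r) + φ (Ω r) ^ 2) * (r / Ω r)| ≤ L := by
    rw [abs_mul]
    calc _ ≤ L * 1 := mul_le_mul (hb1 r) (hq r hr) (abs_nonneg _) hL0.le
      _ = L := mul_one L
  refine ⟨?_, ?_, ?_⟩
  · rw [abs_of_pos (one_div_pos.2 (hpos _ (hΩ0 r)))]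
    linarith [hφN r]
  · linarith
  · refine (abs_add_le _ _).trans ?_
    have k2 : |-β * (φ (Ω r) + φ (Ω r) ^ 2) * ((Ω r - r * (r / Ω r)) / Ω r ^ 2)| ≤ L * (1 / m) := by
      rw [abs_mul]
      exact mul_le_mul (hb1 r) (hq2 r) (abs_nonneg _) hL0.le
    have k3 : |-β * (-β * (φ (Ω r) + φ (Ω r) ^ 2) * (r / Ω r) +
        2 * φ (Ω r) * (-β * (φ (Ω r) + φ (Ω r) ^ 2) * (r / Ω r))) * (r / Ω r)| ≤
        β * (L + 2 * N * L) := by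
      rw [abs_mul, abs_mul, abs_neg, abs_of_pos hβ]
      have k4 : |-β * (φ (Ω r) + φ (Ω r) ^ 2) * (r / Ω r) +
        2 * φ (Ω r) * (-β * (φ (Ω r) + φ (Ω r) ^ 2) * (r / Ω r))| ≤ L + 2 * N * L := by
        refine (abs_add_le _ _).trans (add_le_add k1 ?_)
        rw [abs_mul, abs_mul, abs_two, abs_of_pos (hφ0 r)]
        exact mul_le_mul (by linarith [hφN r]) k1 (abs_nonneg _) (by positivity)
      calc _ ≤ β * (L + 2 * N * L) * 1 := by
            refine mul_le_mul ?_ (hq r hr) (abs_nonneg _) p1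
            gcongr
        _ = _ := mul_one _
    linarith [hφ0 r]

theorem integrableOn_of_le_div_one_add_sq {f : ℝ → ℂ} {K : ℝ} (hf : Measurable f)
    (hb : ∀ r, 0 < r → ‖f r‖ ≤ K / (1 + r) ^ 2) : IntegrableOn f (Set.Ioi 0) := by
  refine Integrable.mono' ((integrable_inv_one_add_sq.const_mul K).integrableOn)
    hf.aestronglyMeasurable ((ae_restrict_iff' measurableSet_Ioi).2 (ae_of_all _ fun r hr => ?_))
  have hr' : 0 < r := hr
  have h := hb r hr'
  have hK : 0 ≤ K := by
    have := (norm_nonneg _).trans h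
    by_contra hK
    have : K / (1 + r) ^ 2 < 0 := div_neg_of_neg_of_pos (not_le.1 hK) (by positivity)
    linarith
  refine h.trans ?_
  rw [div_eq_mul_inv]
  gcongr
  nlinarith

theorem tendsto_zero_of_le_div {f : ℝ → ℂ} {K : ℝ} (hb : ∀ r, 0 < r → ‖f r‖ ≤ K / r) :
    Tendsto f atTop (𝓝 0) := by
  have : Tendsto (fun r : ℝ => K / r) atTop (𝓝 0) := tendsto_const_nhds.div_atTop tendsto_id
  exact squeeze_zero_norm' ((eventually_gt_atTop 0).mono fun r hr => hb r hr) this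

/-- Stationary phase bound for the radial integrals. -/
theorem norm_integral_oscillatory_le {m K : ℝ} (hm : 0 < m) {u : ℝ → ℂ} (hu : IsSymbol K 4 u)
    {τ : ℝ} (hτ : τ ≠ 0) :
    ‖∫ r in Set.Ioi (0 : ℝ), ((r ^ 2 : ℝ) : ℂ) * (u r / (√(r ^ 2 + m ^ 2) : ℝ)) *
      Complex.exp (Complex.I * τ * (√(r ^ 2 + m ^ 2) : ℝ))‖ ≤
      K * (6 + 4 * m) * |τ| ^ (-(3 / 2) : ℝ) := by
  have hK := hu.nonneg
  obtain ⟨u₁, u₂, h1, h2, hb⟩ := hu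
  set Ω : ℝ → ℝ := fun r => √(r ^ 2 + m ^ 2) with hΩ
  have hΩ0 : ∀ r, 0 < Ω r := fun r => Real.sqrt_pos.2 (by positivity)
  have hΩr : ∀ r, 0 ≤ r → r ≤ Ω r := fun r hr => Real.le_sqrt_of_sq_le (by nlinarith)
  have hΩm : ∀ r, 0 ≤ r → Ω r ≤ (1 + m) * (1 + r) := fun r hr => by
    have : Ω r ≤ r + m := Real.sqrt_le_iff.2 ⟨by positivity, by nlinarith⟩
    nlinarith
  have hdΩ : ∀ r, HasDerivAt (fun r => (Ω r : ℂ)) ((r / Ω r : ℝ) : ℂ) r := fun r =>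
    (hasDerivAt_sqrt_sq_add hm r).ofReal_comp
  have hΩc : Continuous Ω := by fun_prop
  set E : ℝ → ℂ := fun r => Complex.exp (Complex.I * τ * (Ω r : ℝ)) with hE
  have hE1 : ∀ r, ‖E r‖ = 1 := fun r => by
    rw [hE, Complex.norm_exp]
    simp
  have hEc : Continuous E := by fun_prop
  have hdE : ∀ r, HasDerivAt E (E r * (Complex.I * τ * (r / Ω r : ℝ))) r := fun r =>
    ((hdΩ r).const_mul (Complex.I * τ)).cexp
  have huc : Continuous u := continuous_iff_continuousAt.2 fun r => (h1 r).continuousAt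
  have hu1c : Continuous u₁ := continuous_iff_continuousAt.2 fun r => (h2 r).continuousAt
  have hu2m : Measurable u₂ := by
    rw [show u₂ = deriv u₁ from funext fun r => (h2 r).deriv.symm]
    exact measurable_deriv u₁
  -- As (r/Ω) e^{iτΩ} is the derivative of e^{iτΩ} divided by iτ, integration by parts turns the
  -- integrand into the derivative of r u(r). The boundary term vanishes at r = 0 and at infinity.
  set G : ℝ → ℂ := fun r => u r + r * u₁ r with hG
  set G' : ℝ → ℂ := fun r => u₁ r + (u₁ r + r * u₂ r) with hG'
  have hGc : Continuous G := by fun_prop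
  have hdr : ∀ r : ℝ, HasDerivAt (fun r : ℝ => (r : ℂ)) 1 r := fun r => by
    simpa using (hasDerivAt_id r).ofReal_comp
  have hdru : ∀ r : ℝ, HasDerivAt (fun r : ℝ => (r : ℂ) * u r) (G r) r := fun r => by
    convert! (hdr r).mul (h1 r) using 1
    simp [hG]
  have hdG : ∀ r, HasDerivAt G (G' r) r := fun r => by
    convert! (h1 r).add ((hdr r).mul (h2 r)) using 1
    simp [hG']
  have bG : ∀ r, 0 ≤ r → ‖G r‖ ≤ K / (1 + r) ^ 3 := fun r hr => by
    obtain ⟨a0, a1, a2⟩ := hb r hr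
    have : ‖G r‖ ≤ ‖u r‖ + r * ‖u₁ r‖ := by
      refine (norm_add_le _ _).trans ?_
      rw [norm_mul, Complex.norm_real, Real.norm_of_nonneg hr]
    calc ‖G r‖ ≤ K / (1 + r) ^ 4 + r * (K / (1 + r) ^ 4) := by
          refine this.trans ?_
          gcongr
      _ = _ := by field_simp
  have bG' : ∀ r, 0 ≤ r → ‖G' r‖ ≤ 2 * K / (1 + r) ^ 3 := fun r hr => by
    obtain ⟨a0, a1, a2⟩ := hb r hr
    have : ‖G' r‖ ≤ ‖u₁ r‖ + (‖u₁ r‖ + r * ‖u₂ r‖) := by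
      refine (norm_add_le _ _).trans (add_le_add le_rfl ((norm_add_le _ _).trans ?_))
      rw [norm_mul, Complex.norm_real, Real.norm_of_nonneg hr]
    calc ‖G' r‖ ≤ K / (1 + r) ^ 4 + (K / (1 + r) ^ 4 + r * (K / (1 + r) ^ 4)) := by
          refine this.trans ?_
          gcongr
      _ = K / (1 + r) ^ 4 * (2 + r) := by ring
      _ ≤ K / (1 + r) ^ 4 * (2 * (1 + r)) := by gcongr; linarith
      _ = _ := by field_simp
  -- the first integration by parts
  set J : ℝ → ℂ := fun r => ((r ^ 2 : ℝ) : ℂ) * (u r / (Ω r : ℝ)) * E r with hJ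
  have hΩC : ∀ r, (Ω r : ℂ) ≠ 0 := fun r => Complex.ofReal_ne_zero.2 (hΩ0 r).ne'
  have hJc : Continuous J := by
    have : Continuous fun r => u r / (Ω r : ℝ) := huc.div (by fun_prop) hΩC
    fun_prop
  have iGE : IntegrableOn (fun r => G r * E r) (Set.Ioi 0) := by
    refine integrableOn_of_le_div_one_add_sq (K := K) (by fun_prop) fun r hr => ?_
    rw [norm_mul, hE1, mul_one]
    refine (bG r hr.le).trans ?_
    gcongr
    · linarith
    · norm_num
  have iJ : IntegrableOn J (Set.Ioi 0) := by
    refine integrableOn_of_le_div_one_add_sq (K := K) hJc.measurable fun r hr => ?_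
    obtain ⟨a0, -, -⟩ := hb r hr.le
    rw [hJ, norm_mul, hE1, mul_one, norm_mul, norm_div, Complex.norm_real, Complex.norm_real,
      Real.norm_of_nonneg (by positivity), Real.norm_of_nonneg (hΩ0 r).le]
    calc r ^ 2 * (‖u r‖ / Ω r) ≤ r ^ 2 * (‖u r‖ / r) := by
          have := hΩr r hr.le
          gcongr
      _ = r * ‖u r‖ := by field_simp
      _ ≤ (1 + r) ^ 2 * (K / (1 + r) ^ 4) := by gcongr; nlinarith
      _ = _ := by field_simp
  have first : Complex.I * τ * ∫ r in Set.Ioi (0 : ℝ), J r =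
      -∫ r in Set.Ioi (0 : ℝ), G r * E r := by
    have hd : ∀ r ∈ Set.Ici (0 : ℝ), HasDerivAt (fun r : ℝ => (r : ℂ) * u r * E r)
        (G r * E r + Complex.I * τ * J r) r := fun r _ => by
      convert! (hdru r).mul (hdE r) using 1
      simp only [hJ]
      push_cast
      ring
    have lim : Tendsto (fun r : ℝ => (r : ℂ) * u r * E r) atTop (𝓝 0) := by
      refine tendsto_zero_of_le_div (K := K) fun r hr => ?_
      obtain ⟨a0, -, -⟩ := hb r hr.le
      rw [norm_mul, hE1, mul_one, norm_mul, Complex.norm_real, Real.norm_of_nonneg hr.le]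
      calc r * ‖u r‖ ≤ r * (K / (1 + r) ^ 4) := by gcongr
        _ ≤ r * (K / r ^ 2) := by
          gcongr
          nlinarith [pow_pos hr 2, pow_pos hr 3, pow_pos hr 4]
        _ = _ := by field_simp
    have := integral_Ioi_of_hasDerivAt_of_tendsto' hd
      (iGE.add (iJ.const_mul (Complex.I * τ))) lim
    rw [integral_add iGE (iJ.const_mul (Complex.I * τ)), integral_const_mul] at this
    simp only [Complex.ofReal_zero, zero_mul, sub_zero] at this
    linear_combination this
  -- the second integration by parts
  set δ : ℝ := |τ| ^ (-(1 / 2) : ℝ) with hδ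
  have hτ0 : 0 < |τ| := abs_pos.2 hτ
  have hδ0 : 0 < δ := Real.rpow_pos_of_pos hτ0 _
  have hδτ : |τ| * δ = δ⁻¹ := by
    rw [hδ, ← Real.rpow_neg hτ0.le, ← Real.rpow_one_add' hτ0.le (by norm_num)]
    norm_num
  -- The derivative of GΩ/r, times the phase; dividing by the derivative r/Ω of Ω costs the
  -- singularity r^{-2}.
  set H : ℝ → ℂ := fun r => ((G' r * Ω r + G r * ((r / Ω r : ℝ) : ℂ)) * r - G r * Ω r) / r ^ 2 * E r
    with hH
  have bGΩ : ∀ r, 0 < r → ‖G r * Ω r‖ ≤ K * (1 + m) := fun r hr => by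
    rw [norm_mul, Complex.norm_real, Real.norm_of_nonneg (hΩ0 r).le]
    calc ‖G r‖ * Ω r ≤ K / (1 + r) ^ 3 * ((1 + m) * (1 + r)) :=
          mul_le_mul (bG r hr.le) (hΩm r hr.le) (hΩ0 r).le (by positivity)
      _ = K * (1 + m) / (1 + r) ^ 2 := by field_simp
      _ ≤ _ := div_le_self (by positivity) (by nlinarith)
  have bH : ∀ r, 0 < r → ‖H r‖ ≤ K * (4 + 3 * m) * r ^ (-2 : ℝ) := fun r hr => by
    rw [hH, norm_mul, hE1, mul_one, norm_div, norm_pow, Complex.norm_real,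
      Real.norm_of_nonneg hr.le, Real.rpow_neg hr.le, ← div_eq_mul_inv,
      show r ^ (2 : ℝ) = r ^ 2 by norm_cast]
    refine div_le_div_of_nonneg_right ?_ (by positivity)
    refine (norm_sub_le _ _).trans ?_
    have e1 : ‖(G' r * Ω r + G r * ((r / Ω r : ℝ) : ℂ)) * r‖ ≤ K * (3 + 2 * m) := by
      rw [norm_mul, Complex.norm_real, Real.norm_of_nonneg hr.le]
      have e2 : ‖G' r * Ω r‖ ≤ 2 * K * (1 + m) / (1 + r) ^ 2 := by
        rw [norm_mul, Complex.norm_real, Real.norm_of_nonneg (hΩ0 r).le]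
        calc ‖G' r‖ * Ω r ≤ 2 * K / (1 + r) ^ 3 * ((1 + m) * (1 + r)) :=
              mul_le_mul (bG' r hr.le) (hΩm r hr.le) (hΩ0 r).le (by positivity)
          _ = _ := by field_simp
      have e3 : ‖G r * ((r / Ω r : ℝ) : ℂ)‖ ≤ K / (1 + r) ^ 2 := by
        rw [norm_mul, Complex.norm_real, Real.norm_of_nonneg (div_nonneg hr.le (hΩ0 r).le)]
        calc ‖G r‖ * (r / Ω r) ≤ K / (1 + r) ^ 3 * 1 :=
              mul_le_mul (bG r hr.le) ((div_le_one (hΩ0 r)).2 (hΩr r hr.le))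
                (div_nonneg hr.le (hΩ0 r).le) (by positivity)
          _ = K / (1 + r) ^ 3 := mul_one _
          _ ≤ _ := by
            gcongr
            · linarith
            · norm_num
      calc _ ≤ (2 * K * (1 + m) / (1 + r) ^ 2 + K / (1 + r) ^ 2) * r := by
            gcongr
            exact (norm_add_le _ _).trans (add_le_add e2 e3)
        _ = K * (3 + 2 * m) * (r / (1 + r) ^ 2) := by ring
        _ ≤ K * (3 + 2 * m) * 1 := by
            gcongr
            rw [div_le_one (by positivity)]
            nlinarith
        _ = _ := mul_one _
    linarith [bGΩ r hr]
  have hpow : IntegrableOn (fun r : ℝ => K * (4 + 3 * m) * r ^ (-2 : ℝ)) (Set.Ioi δ) :=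
    (integrableOn_Ioi_rpow_of_lt (by norm_num) hδ0).const_mul _
  have hHm : Measurable H := by
    have : Measurable G' := by
      rw [hG']
      have := hu1c.measurable
      fun_prop
    have := hGc.measurable
    have := hΩc.measurable
    have := hEc.measurable
    rw [hH]
    fun_prop
  have hHb : ∀ᵐ r ∂volume.restrict (Set.Ioi δ), ‖H r‖ ≤ K * (4 + 3 * m) * r ^ (-2 : ℝ) :=
    (ae_restrict_iff' measurableSet_Ioi).2 (ae_of_all _ fun r hr => bH r (hδ0.trans hr))
  have iH : IntegrableOn H (Set.Ioi δ) := Integrable.mono' hpow hHm.aestronglyMeasurable hHb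
  have iGE' : IntegrableOn (fun r => G r * E r) (Set.Ioi δ) :=
    iGE.mono_set (Set.Ioi_subset_Ioi hδ0.le)
  have second : Complex.I * τ * ∫ r in Set.Ioi δ, G r * E r =
      -(G δ * Ω δ / δ * E δ) - ∫ r in Set.Ioi δ, H r := by
    have hd : ∀ r ∈ Set.Ici δ, HasDerivAt (fun r : ℝ => G r * Ω r / r * E r)
        (H r + Complex.I * τ * (G r * E r)) r := fun r hr => by
      have hr0 : (r : ℂ) ≠ 0 := Complex.ofReal_ne_zero.2 (hδ0.trans_le hr).ne'
      convert! ((((hdG r).mul (hdΩ r)).div (hdr r) hr0).mul (hdE r)) using 1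
      have := hΩC r
      simp only [hH, Complex.ofReal_div, Pi.mul_apply, Pi.div_apply]
      field_simp
    have lim : Tendsto (fun r : ℝ => G r * Ω r / r * E r) atTop (𝓝 0) := by
      refine tendsto_zero_of_le_div (K := K * (1 + m)) fun r hr => ?_
      rw [norm_mul, hE1, mul_one, norm_div, Complex.norm_real, Real.norm_of_nonneg hr.le]
      exact div_le_div_of_nonneg_right (bGΩ r hr) hr.le
    have := integral_Ioi_of_hasDerivAt_of_tendsto' hd
      (iH.add (iGE'.const_mul (Complex.I * τ))) lim
    rw [integral_add iH (iGE'.const_mul (Complex.I * τ)), integral_const_mul] at this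
    linear_combination this
  have bound2 : ‖∫ r in Set.Ioi δ, G r * E r‖ ≤ K * (5 + 4 * m) * δ := by
    have e1 : ‖∫ r in Set.Ioi δ, H r‖ ≤ K * (4 + 3 * m) / δ := by
      refine (norm_integral_le_of_norm_le hpow hHb).trans_eq ?_
      rw [integral_const_mul, integral_Ioi_rpow_of_lt (by norm_num) hδ0]
      norm_num
      rw [Real.rpow_neg_one, div_eq_mul_inv]
    have e2 : ‖G δ * Ω δ / δ * E δ‖ ≤ K * (1 + m) / δ := by
      rw [norm_mul, hE1, mul_one, norm_div, Complex.norm_real, Real.norm_of_nonneg hδ0.le]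
      exact div_le_div_of_nonneg_right (bGΩ δ hδ0) hδ0.le
    have e3 : |τ| * ‖∫ r in Set.Ioi δ, G r * E r‖ ≤ K * (5 + 4 * m) / δ := by
      have := congrArg norm second
      rw [norm_mul, norm_mul, Complex.norm_I, one_mul, Complex.norm_real, Real.norm_eq_abs] at this
      rw [this]
      refine (norm_sub_le _ _).trans ?_
      rw [norm_neg]
      refine (add_le_add e2 e1).trans_eq ?_
      ring
    rw [div_eq_mul_inv, ← hδτ] at e3
    refine le_of_mul_le_mul_left (e3.trans_eq ?_) hτ0
    ring
  have bound1 : ‖∫ r in Set.Ioc 0 δ, G r * E r‖ ≤ K * δ := by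
    refine (norm_setIntegral_le_of_norm_le_const (C := K) measure_Ioc_lt_top fun r hr => ?_).trans_eq ?_
    · rw [norm_mul, hE1, mul_one]
      exact (bG r hr.1.le).trans (div_le_self hK (one_le_pow₀ (by linarith [hr.1])))
    · simp [hδ0.le]
  have bound : ‖∫ r in Set.Ioi (0 : ℝ), G r * E r‖ ≤ K * (6 + 4 * m) * δ := by
    rw [← Set.Ioc_union_Ioi_eq_Ioi hδ0.le, setIntegral_union (Set.Ioc_disjoint_Ioi le_rfl)
      measurableSet_Ioi (iGE.mono_set Set.Ioc_subset_Ioi_self) iGE']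
    refine (norm_add_le _ _).trans ((add_le_add bound1 bound2).trans_eq ?_)
    ring
  have fin : |τ| * ‖∫ r in Set.Ioi (0 : ℝ), J r‖ ≤ K * (6 + 4 * m) * δ := by
    have := congrArg norm first
    rw [norm_mul, norm_mul, Complex.norm_I, one_mul, Complex.norm_real, Real.norm_eq_abs,
      norm_neg] at this
    rw [this]
    exact bound
  refine le_of_mul_le_mul_left (fin.trans_eq ?_) hτ0
  rw [hδ, mul_left_comm, ← Real.rpow_one_add' hτ0.le (by norm_num)]
  norm_num

/-- Polar coordinates in three dimensions; the Jacobian r² supplies the vanishing of the integrand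
at the stationary point. -/
theorem norm_integral_le_of_radial {f : Space → ℂ} (hf : Integrable f) {C : ℝ}
    (hC : ∀ e : Space, ‖e‖ = 1 →
      ‖∫ r in Set.Ioi (0 : ℝ), ((r ^ 2 : ℝ) : ℂ) * f (r • e)‖ ≤ C) :
    ‖∫ p, f p‖ ≤ C * (volume : Measure Space).toSphere.real Set.univ := by
  have hdim : Module.finrank ℝ Space - 1 = 2 := by simp
  have mp := (volume : Measure Space).measurePreserving_homeomorphUnitSphereProd
  have emb := (homeomorphUnitSphereProd Space).measurableEmbedding
  set g : Metric.sphere (0 : Space) 1 × Set.Ioi (0 : ℝ) → ℂ := fun q => f (q.2.1 • q.1.1) with hg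
  have hgf : ∀ x : ({0}ᶜ : Set Space), g (homeomorphUnitSphereProd Space x) = f x := fun x => by
    have hx : ‖(x : Space)‖ ≠ 0 := norm_ne_zero_iff.2 x.2
    simp [hg, smul_smul, hx]
  have e1 : ∫ p, f p = ∫ q, g q ∂((volume : Measure Space).toSphere.prod
      (Measure.volumeIoiPow (Module.finrank ℝ Space - 1))) := by
    rw [← mp.integral_comp emb]
    simp only [hgf]
    rw [integral_subtype_comap (measurableSet_singleton _).compl f, restrict_compl_singleton]
  have hi : Integrable g ((volume : Measure Space).toSphere.prod
      (Measure.volumeIoiPow (Module.finrank ℝ Space - 1))) := by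
    rw [← mp.integrable_comp_emb emb]
    have : g ∘ homeomorphUnitSphereProd Space = f ∘ Subtype.val := funext hgf
    rw [this, ← integrableOn_iff_comap_subtypeVal (measurableSet_singleton _).compl]
    exact hf.integrableOn
  rw [e1, integral_prod _ hi]
  refine norm_integral_le_of_norm_le_const (ae_of_all _ fun e => ?_)
  refine le_of_eq_of_le ?_ (hC e.1 (by simp))
  congr 1
  rw [Measure.volumeIoiPow, hdim]
  simp only [ENNReal.ofReal]
  rw [integral_withDensity_eq_integral_smul (measurable_subtype_coe.pow_const _).real_toNNReal,
    integral_subtype_comap measurableSet_Ioi fun r => Real.toNNReal (r ^ 2) • f (r • e.1)]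
  refine setIntegral_congr_fun measurableSet_Ioi fun r hr => ?_
  simp only [NNReal.smul_def, Real.coe_toNNReal _ (sq_nonneg r), Complex.real_smul]

/-- The superposition of plane waves with an amplitude depending on the modulus of the momentum. -/
def waves (P : Params) (q : ℝ → ℂ) (τ : ℝ) (x : Space) : ℂ :=
  ∫ p : Space, (weight P p : ℂ) * Complex.exp (Complex.I * (⟪p, x⟫ : ℝ)) *
    (q ‖p‖ * Complex.exp (Complex.I * τ * energy P p))

theorem integrable_waves (P : Params) {K : ℝ} {q : ℝ → ℂ} (hq : IsSymbol K 0 q) (τ : ℝ)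
    (x : Space) : Integrable fun p : Space => (weight P p : ℂ) *
      Complex.exp (Complex.I * (⟪p, x⟫ : ℝ)) *
      (q ‖p‖ * Complex.exp (Complex.I * τ * energy P p)) := by
  obtain ⟨q₁, q₂, h1, -, hb⟩ := hq
  have hqc : Continuous q := continuous_iff_continuousAt.2 fun r => (h1 r).continuousAt
  have hE := continuous_energy P
  have hw := continuous_weight P
  refine Integrable.mono' ((integrable_weight P).mul_const K) (by fun_prop)
    (ae_of_all _ fun p => ?_)
  have hq0 := (hb ‖p‖ (norm_nonneg p)).1
  simp only [pow_zero, div_one] at hq0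
  simp only [norm_mul, Complex.norm_real, Real.norm_of_nonneg (weight_nonneg P p),
    Complex.norm_exp]
  simpa using mul_le_mul_of_nonneg_left hq0 (weight_nonneg P p)

theorem exists_norm_waves_le (P : Params) {K : ℝ} {q : ℝ → ℂ} (hq : IsSymbol K 0 q) (R : ℝ) :
    ∃ C, 0 ≤ C ∧ ∀ (τ : ℝ) (x : Space), ‖x‖ ≤ R →
      ‖waves P q τ x‖ ≤ C * (1 + |τ|) ^ (-(3 / 2) : ℝ) := by
  have hK := hq.nonneg
  obtain ⟨Kg, hγ⟩ := exists_isSymbol_gauss (c := 2 * P.planck ^ 2)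
    (by have := P.planck_pos; positivity)
  have hKg := hγ.nonneg
  have hm := P.mass_pos
  set C₀ : ℝ := 4 * (4 * Kg * K) * (1 + R) ^ 2 * (6 + 4 * P.mass) *
    (volume : Measure Space).toSphere.real Set.univ with hC₀
  set C₁ : ℝ := ∫ p : Space, weight P p * K with hC₁
  have hC₁0 : 0 ≤ C₁ := integral_nonneg fun p => mul_nonneg (weight_nonneg P p) hK
  have hC₀0 : 0 ≤ C₀ := by positivity
  have large : ∀ (τ : ℝ) (x : Space), ‖x‖ ≤ R → τ ≠ 0 →
      ‖waves P q τ x‖ ≤ C₀ * |τ| ^ (-(3 / 2) : ℝ) := fun τ x hx hτ => by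
    refine (norm_integral_le_of_radial (integrable_waves P hq τ x)
      (C := 4 * (4 * Kg * K) * (1 + R) ^ 2 * (6 + 4 * P.mass) * |τ| ^ (-(3 / 2) : ℝ))
      fun e he => ?_).trans_eq (by rw [hC₀]; ring)
    have hb : |⟪e, x⟫| ≤ R := (abs_real_inner_le_norm e x).trans (by rwa [he, one_mul])
    refine le_of_eq_of_le ?_ (norm_integral_oscillatory_le hm ((hγ.mul hq).mul (isSymbol_exp hb)) hτ)
    congr 1
    refine setIntegral_congr_fun measurableSet_Ioi fun r hr => ?_
    have hr' : (0 : ℝ) < r := hr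
    have hn : ‖r • e‖ = r := by rw [norm_smul, he, mul_one, Real.norm_of_nonneg hr'.le]
    have h0 : (√(r ^ 2 + P.mass ^ 2) : ℂ) ≠ 0 :=
      Complex.ofReal_ne_zero.2 (Real.sqrt_pos.2 (by positivity)).ne'
    simp only [weight, energy, hn, real_inner_smul_left]
    push_cast
    field_simp
  have small : ∀ (τ : ℝ) (x : Space), ‖waves P q τ x‖ ≤ C₁ := fun τ x => by
    refine norm_integral_le_of_norm_le ((integrable_weight P).mul_const K) (ae_of_all _ fun p => ?_)
    obtain ⟨q₁, q₂, -, -, hb⟩ := hq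
    have hq0 := (hb ‖p‖ (norm_nonneg p)).1
    simp only [pow_zero, div_one] at hq0
    simp only [norm_mul, Complex.norm_real, Real.norm_of_nonneg (weight_nonneg P p),
      Complex.norm_exp]
    simpa using mul_le_mul_of_nonneg_left hq0 (weight_nonneg P p)
  -- For |τ| > 1 one has (1 + |τ|)/2 ≤ |τ|; for |τ| ≤ 1 the same quantity is at most 1 and the
  -- trivial bound is enough.
  refine ⟨(C₀ + C₁) * (1 / 2 : ℝ) ^ (-(3 / 2) : ℝ), by positivity, fun τ x hx => ?_⟩
  have hτ : 0 ≤ |τ| := abs_nonneg τ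
  rw [mul_assoc, ← Real.mul_rpow (by norm_num) (by positivity)]
  by_cases h : |τ| ≤ 1
  · have h1 : (1 : ℝ) ≤ (1 / 2 * (1 + |τ|)) ^ (-(3 / 2) : ℝ) :=
      Real.one_le_rpow_of_pos_of_le_one_of_nonpos (by positivity) (by linarith) (by norm_num)
    calc _ ≤ C₁ := small τ x
      _ ≤ (C₀ + C₁) * 1 := by linarith
      _ ≤ _ := by gcongr
  · push Not at h
    have h1 : |τ| ^ (-(3 / 2) : ℝ) ≤ (1 / 2 * (1 + |τ|)) ^ (-(3 / 2) : ℝ) :=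
      Real.rpow_le_rpow_of_nonpos (by positivity) (by linarith) (by norm_num)
    refine (large τ x hx (by rintro rfl; simp at h; linarith)).trans ?_
    exact mul_le_mul (by linarith) h1 (by positivity) (by positivity)

/-- The rate `(1 + |s|)^{-3/2}` of the decay in time. -/
def rate (s : ℝ) : ℝ := (1 + |s|) ^ (-(3 / 2) : ℝ)

theorem rate_nonneg (s : ℝ) : 0 ≤ rate s := Real.rpow_nonneg (by positivity) _

theorem rate_neg (s : ℝ) : rate (-s) = rate s := by rw [rate, abs_neg, rate]

theorem rate_le_one (s : ℝ) : rate s ≤ 1 :=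
  Real.rpow_le_one_of_one_le_of_nonpos (by linarith [abs_nonneg s]) (by norm_num)

theorem continuous_rate : Continuous rate := by
  refine Continuous.rpow_const (by fun_prop) fun s => Or.inl ?_
  positivity

/-- `D` decays like `(1 + |t|)^{-3/2}`, uniformly on compact subsets of space. -/
def Decays (D : C(Spacetime, ℂ)) : Prop :=
  ∀ R : ℝ, ∃ C, 0 ≤ C ∧ ∀ x : Spacetime, ‖x.2‖ ≤ R → ‖D x‖ ≤ C * rate x.1

theorem Decays.sub {D D' : C(Spacetime, ℂ)} (h : Decays D) (h' : Decays D') : Decays (D - D') :=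
  fun R => by
    obtain ⟨C, hC, hb⟩ := h R
    obtain ⟨C', hC', hb'⟩ := h' R
    refine ⟨C + C', by positivity, fun x hx => ?_⟩
    rw [add_mul]
    exact (norm_sub_le _ _).trans (add_le_add (hb x hx) (hb' x hx))

theorem decays_vacuum (P : Params) : Decays (vacuum P) := fun R => by
  obtain ⟨C, hC, hb⟩ := exists_norm_waves_le P (isSymbol_const 1) R
  refine ⟨‖(prefactor P : ℂ)‖ * C, by positivity, fun x hx => ?_⟩
  have h := hb (-x.1) x.2 hx
  have e : vacuum P x = (prefactor P : ℂ) * waves P (fun _ => 1) (-x.1) x.2 := by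
    change vacuumFun P x = _
    simp only [vacuumFun, waves, one_mul]
    simp
  rw [e, norm_mul, mul_assoc]
  rw [abs_neg] at h
  exact mul_le_mul_of_nonneg_left h (norm_nonneg _)

theorem decays_thermal (P : Params) {β : ℝ} (hβ : 0 < β) : Decays (thermal P hβ) := fun R => by
  obtain ⟨K, hK⟩ := exists_isSymbol_bose P.mass_pos hβ
  set φ : ℝ → ℂ := fun r => ((1 / (Real.exp (β * √(r ^ 2 + P.mass ^ 2)) - 1) : ℝ) : ℂ) with hφ
  obtain ⟨C, hC, hb⟩ := exists_norm_waves_le P (isSymbol_const 1) R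
  obtain ⟨C', hC', hb'⟩ := exists_norm_waves_le P hK R
  refine ⟨‖(prefactor P : ℂ)‖ * (C + C' + C'), by positivity, fun x hx => ?_⟩
  -- With the Bose factor N, one has 1/(1 - e^{-βω}) = 1 + N and 1/(1 - e^{βω}) = -N: a vacuum part
  -- and two thermal parts.
  have e : thermal P hβ x = (prefactor P : ℂ) * (waves P (fun _ => 1) (-x.1) x.2 +
      waves P φ (-x.1) x.2 + waves P φ x.1 x.2) := by
    change thermalFun P β x = _
    have i₁ := integrable_waves P (isSymbol_const 1) (-x.1) x.2
    have i₂ := integrable_waves P hK (-x.1) x.2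
    have i₃ := integrable_waves P hK x.1 x.2
    have e3 := (integral_add (i₁.add i₂) i₃).trans (congrArg (· + _) (integral_add i₁ i₂))
    rw [waves, waves, waves, ← e3, thermalFun]
    simp only [Pi.add_apply]
    congr 1
    refine integral_congr_ae (ae_of_all _ fun p => ?_)
    have hE : 1 < Real.exp (β * energy P p) :=
      Real.one_lt_exp_iff.2 (mul_pos hβ (energy_pos P p))
    have e0 : φ ‖p‖ = ((1 / (Real.exp (β * energy P p) - 1) : ℝ) : ℂ) := rfl
    have e1 : ((1 - Real.exp (-β * energy P p) : ℝ) : ℂ)⁻¹ = 1 + φ ‖p‖ := by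
      rw [e0, neg_mul, Real.exp_neg]
      norm_cast
      have : Real.exp (β * energy P p) - 1 ≠ 0 := by linarith
      field_simp
      ring
    have e2 : ((1 - Real.exp (β * energy P p) : ℝ) : ℂ)⁻¹ = -φ ‖p‖ := by
      rw [e0]
      norm_cast
      rw [one_div, ← inv_neg, neg_sub]
    simp only [div_eq_mul_inv, e1, e2]
    simp only [neg_mul, mul_neg, Complex.ofReal_neg]
    ring
  rw [e, norm_mul, mul_assoc]
  refine mul_le_mul_of_nonneg_left ?_ (norm_nonneg _)
  have h1 := hb (-x.1) x.2 hx
  have h2 := hb' (-x.1) x.2 hx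
  have h3 := hb' x.1 x.2 hx
  rw [abs_neg] at h1 h2
  rw [add_mul, add_mul]
  exact (norm_add_le _ _).trans (add_le_add ((norm_add_le _ _).trans (add_le_add h1 h2)) h3)

theorem decays_feynman (P : Params) : Decays (feynman P) := fun R => by
  obtain ⟨C, hC, hb⟩ := decays_vacuum P R
  refine ⟨C, hC, fun x hx => ?_⟩
  change ‖if 0 ≤ x.1 then vacuumFun P x else vacuumFun P (-x)‖ ≤ _
  split_ifs with h
  · exact hb x hx
  · have := hb (-x) (by simpa using hx)
    rwa [Prod.fst_neg, rate_neg] at this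

/-! ### Size of contractions -/

section Size

variable {ι : Type}

open Classical in
/-- The sum of the absolute values of the coefficients of order at most `n`. -/
def size (n : ι →₀ ℕ) (H : MvPowerSeries ι ℂ) : ℝ :=
  ∑ d ∈ Finset.Iic n, ‖MvPowerSeries.coeff d H‖

theorem size_nonneg (n : ι →₀ ℕ) (H : MvPowerSeries ι ℂ) : 0 ≤ size n H :=
  Finset.sum_nonneg fun _ _ => norm_nonneg _

theorem size_add_le (n : ι →₀ ℕ) (H K : MvPowerSeries ι ℂ) :
    size n (H + K) ≤ size n H + size n K := by
  rw [size, size, size, ← Finset.sum_add_distrib]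
  exact Finset.sum_le_sum fun d _ => by rw [map_add]; exact norm_add_le _ _

theorem size_sub_le (n : ι →₀ ℕ) (H K : MvPowerSeries ι ℂ) :
    size n (H - K) ≤ size n H + size n K := by
  rw [size, size, size, ← Finset.sum_add_distrib]
  exact Finset.sum_le_sum fun d _ => by rw [map_sub]; exact norm_sub_le _ _

theorem size_zero (n : ι →₀ ℕ) : size n (0 : MvPowerSeries ι ℂ) = 0 := by simp [size]

theorem size_smul (n : ι →₀ ℕ) (a : ℂ) (H : MvPowerSeries ι ℂ) :
    size n (a • H) = ‖a‖ * size n H := by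
  simp [size, Finset.mul_sum]

theorem size_monomial_le (n d : ι →₀ ℕ) :
    size n (MvPowerSeries.monomial d (1 : ℂ)) ≤ 1 := by
  classical
  rw [size]
  simp only [MvPowerSeries.coeff_monomial]
  calc ∑ e ∈ Finset.Iic n, ‖(if e = d then (1 : ℂ) else 0)‖
      = ∑ e ∈ Finset.Iic n, if e = d then (1 : ℝ) else 0 :=
        Finset.sum_congr rfl fun e _ => by split_ifs <;> simp
    _ ≤ 1 := by rw [Finset.sum_ite_eq']; split_ifs <;> norm_num

theorem size_one_le (n : ι →₀ ℕ) : size n (1 : MvPowerSeries ι ℂ) ≤ 1 := by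
  rw [← MvPowerSeries.monomial_zero_one]
  exact size_monomial_le n 0

/-- A truncated ℓ¹ norm. If a sum of two multi-indices is at most n, both of them are, so the
truncated Cauchy product is dominated by the full product of the two sums. -/
theorem size_mul_le (n : ι →₀ ℕ) (H K : MvPowerSeries ι ℂ) :
    size n (H * K) ≤ size n H * size n K := by
  classical
  set f : (ι →₀ ℕ) × (ι →₀ ℕ) → ℝ := fun p =>
    ‖MvPowerSeries.coeff p.1 H‖ * ‖MvPowerSeries.coeff p.2 K‖ with hf
  have h1 : size n (H * K) ≤ ∑ d ∈ Finset.Iic n, ∑ p ∈ Finset.HasAntidiagonal.antidiagonal d, f p := by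
    refine Finset.sum_le_sum fun d _ => ?_
    rw [MvPowerSeries.coeff_mul]
    refine (norm_sum_le _ _).trans (Finset.sum_le_sum fun p _ => ?_)
    rw [norm_mul]
  refine h1.trans ?_
  rw [size, size, Finset.sum_mul_sum, ← Finset.sum_product', Finset.sum_sigma']
  have hinj : Set.InjOn (fun x : (_ : ι →₀ ℕ) × (ι →₀ ℕ) × (ι →₀ ℕ) => x.2)
      ((Finset.Iic n).sigma fun d => Finset.HasAntidiagonal.antidiagonal d) := by
    rintro ⟨d, p⟩ hx ⟨e, q⟩ hy (rfl : p = q)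
    have h1 := Finset.HasAntidiagonal.mem_antidiagonal.1 (Finset.mem_sigma.1 hx).2
    have h2 := Finset.HasAntidiagonal.mem_antidiagonal.1 (Finset.mem_sigma.1 hy).2
    obtain rfl : d = e := h1.symm.trans h2
    rfl
  rw [← Finset.sum_image (f := f) hinj]
  refine Finset.sum_le_sum_of_subset_of_nonneg (fun p hp => ?_) fun p _ _ => by positivity
  obtain ⟨⟨d, q⟩, hx, rfl⟩ := Finset.mem_image.1 hp
  obtain ⟨hd, hq⟩ := Finset.mem_sigma.1 hx
  have h1 := Finset.HasAntidiagonal.mem_antidiagonal.1 hq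
  have h2 := Finset.mem_Iic.1 hd
  simp only at h1 h2
  rw [← h1] at h2
  exact Finset.mem_product.2 ⟨Finset.mem_Iic.2 (le_self_add.trans h2),
    Finset.mem_Iic.2 (le_add_self.trans h2)⟩

theorem size_prod_le {τ : Type*} (n : ι →₀ ℕ) (s : Finset τ) (H : τ → MvPowerSeries ι ℂ) :
    size n (∏ t ∈ s, H t) ≤ ∏ t ∈ s, size n (H t) := by
  classical
  induction s using Finset.induction_on with
  | empty => simpa using size_one_le n
  | insert a s ha ih =>
    rw [Finset.prod_insert ha, Finset.prod_insert ha]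
    exact (size_mul_le n _ _).trans (mul_le_mul_of_nonneg_left ih (size_nonneg n _))

theorem size_congr {n : ι →₀ ℕ} {H K : MvPowerSeries ι ℂ}
    (h : ∀ d ≤ n, MvPowerSeries.coeff d H = MvPowerSeries.coeff d K) : size n H = size n K := by
  classical exact Finset.sum_congr rfl fun d hd => by rw [h d (Finset.mem_Iic.1 hd)]

theorem size_pairExp_sub_one_le (n : ι →₀ ℕ) (q : ℂ) (i j : ι) :
    size n (pairExp q i j - 1) ≤ Real.exp ‖q‖ - 1 := by
  classical
  obtain ⟨r, hr⟩ := exists_pairExp_eq (n i + 1) q i j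
  have h1 : size n (pairExp q i j - 1) = size n (pairTrunc (n i + 1) q i j - 1) := by
    refine size_congr fun d hd => ?_
    rw [hr, add_sub_right_comm, map_add, MvPowerSeries.coeff_monomial_mul, if_neg, add_zero]
    intro h
    have h2 := (h i).trans (hd i)
    simp only [Finsupp.add_apply, Finsupp.single_eq_same] at h2
    omega
  have h2 : pairTrunc (n i + 1) q i j - 1 = ∑ c ∈ Finset.range (n i),
      (q ^ (c + 1) / ((c + 1).factorial : ℂ)) •
        MvPowerSeries.monomial (Finsupp.single i (c + 1) + Finsupp.single j (c + 1)) (1 : ℂ) := by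
    rw [pairTrunc, Finset.sum_range_succ']
    simp
  have h3 : ∀ (s : Finset ℕ) (H : ℕ → MvPowerSeries ι ℂ),
      size n (∑ c ∈ s, H c) ≤ ∑ c ∈ s, size n (H c) := fun s H =>
    Finset.le_sum_of_subadditive _ (size_zero n).le (fun _ _ => size_add_le n _ _) _ _
  rw [h1, h2]
  have h4 : ∑ c ∈ Finset.range (n i + 1), ‖q‖ ^ c / (c.factorial : ℝ) ≤ Real.exp ‖q‖ :=
    Real.sum_le_exp_of_nonneg (norm_nonneg q) _
  rw [Finset.sum_range_succ'] at h4
  simp only [pow_zero, Nat.factorial_zero, Nat.cast_one, div_one] at h4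
  refine (h3 _ _).trans ((Finset.sum_le_sum fun c _ => ?_).trans (le_sub_iff_add_le.2 h4))
  rw [size_smul, norm_div, norm_pow, Complex.norm_natCast]
  exact mul_le_of_le_one_right (by positivity) (size_monomial_le _ _)

theorem size_le_of_sub_one {n : ι →₀ ℕ} {H : MvPowerSeries ι ℂ} {a : ℝ}
    (h : size n (H - 1) ≤ Real.exp a - 1) : size n H ≤ Real.exp a := by
  have := size_add_le n (H - 1) 1
  rw [sub_add_cancel] at this
  linarith [size_one_le n]

/-- Keeping the 1 subtracted retains the information that at least one contraction is present, and
thus a bound which vanishes with the propagators. -/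
theorem size_prod_sub_one_le {τ : Type*} (n : ι →₀ ℕ) (s : Finset τ) (H : τ → MvPowerSeries ι ℂ)
    (a : τ → ℝ) (h : ∀ t ∈ s, size n (H t - 1) ≤ Real.exp (a t) - 1) :
    size n (∏ t ∈ s, H t - 1) ≤ Real.exp (∑ t ∈ s, a t) - 1 := by
  classical
  induction s using Finset.induction_on with
  | empty => simp [size_zero]
  | insert b s hb ih =>
    rw [Finset.prod_insert hb, Finset.sum_insert hb, Real.exp_add]
    have h1 := h b (Finset.mem_insert_self b s)
    have h2 := ih fun t ht => h t (Finset.mem_insert_of_mem ht)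
    rw [show H b * ∏ t ∈ s, H t - 1 = H b * (∏ t ∈ s, H t - 1) + (H b - 1) by ring]
    have h3 := size_mul_le n (H b) (∏ t ∈ s, H t - 1)
    have h4 := mul_le_mul (size_le_of_sub_one h1) h2 (size_nonneg n _) (Real.exp_pos _).le
    linarith [size_add_le n (H b * (∏ t ∈ s, H t - 1)) (H b - 1)]

variable [Fintype ι]

theorem size_contr_sub_one_le (n : ι →₀ ℕ) (Q : ι → ι → ℂ) :
    size n (contr Q - 1) ≤ Real.exp (∑ i, ∑ j, ‖Q i j‖) - 1 :=
  size_prod_sub_one_le n _ _ _ fun i _ =>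
    size_prod_sub_one_le n _ _ _ fun j _ => size_pairExp_sub_one_le n _ i j

theorem size_contr_le (n : ι →₀ ℕ) (Q : ι → ι → ℂ) :
    size n (contr Q) ≤ Real.exp (∑ i, ∑ j, ‖Q i j‖) :=
  size_le_of_sub_one (size_contr_sub_one_le n Q)

theorem exp_sub_one_le {a b : ℝ} (ha : 0 ≤ a) (hb : a ≤ b) :
    Real.exp a - 1 ≤ a * Real.exp b := by
  have h1 : 1 - a ≤ Real.exp (-a) := by linarith [Real.add_one_le_exp (-a)]
  have h2 : Real.exp (-a) * Real.exp a = 1 := by rw [← Real.exp_add]; simp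
  have h3 : Real.exp a ≤ Real.exp b := Real.exp_le_exp.2 hb
  nlinarith [Real.exp_pos a, mul_le_mul_of_nonneg_right h1 (Real.exp_pos a).le,
    mul_le_mul_of_nonneg_left h3 ha]

/-- A moment is bounded by the size of the symbol and the moments of lower order. -/
theorem norm_wick_le (H : MvPowerSeries ι ℂ) (μ : (ι → ℕ) → ℂ) (n : ι → ℕ) {b : ℝ} (hb : 0 ≤ b)
    (hμ : ∀ m ≤ n, ‖μ m‖ ≤ b) : ‖wick H μ n‖ ≤ ‖fac n‖ * (size (multi n) H * b) := by
  classical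
  rw [wick, norm_mul]
  refine mul_le_mul_of_nonneg_left ?_ (norm_nonneg _)
  rw [MvPowerSeries.coeff_mul]
  refine (norm_sum_le _ _).trans ?_
  rw [size, Finset.sum_mul]
  have h1 : ∀ p ∈ Finset.HasAntidiagonal.antidiagonal (multi n), ‖MvPowerSeries.coeff p.1 H *
      MvPowerSeries.coeff p.2 (egf μ)‖ ≤ ‖MvPowerSeries.coeff p.1 H‖ * b := fun p hp => by
    have hp2 : p.2 ≤ multi n := by
      rw [← Finset.HasAntidiagonal.mem_antidiagonal.1 hp]
      exact le_add_self
    rw [norm_mul, coeff_egf, norm_div]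
    refine mul_le_mul_of_nonneg_left ?_ (norm_nonneg _)
    have hf : 1 ≤ ‖fac (p.2 : ι → ℕ)‖ := by
      rw [fac, ← Nat.cast_prod, Complex.norm_natCast]
      exact_mod_cast Finset.prod_pos fun i _ => Nat.factorial_pos _
    exact (div_le_self (norm_nonneg _) hf).trans (hμ _ fun i => hp2 i)
  refine (Finset.sum_le_sum h1).trans ?_
  have hinj : Set.InjOn (fun p : (ι →₀ ℕ) × (ι →₀ ℕ) => p.1)
      (Finset.HasAntidiagonal.antidiagonal (multi n)) := by
    rintro ⟨p, q⟩ hx ⟨p', q'⟩ hy (rfl : p = p')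
    have h1 := Finset.HasAntidiagonal.mem_antidiagonal.1 hx
    have h2 := Finset.HasAntidiagonal.mem_antidiagonal.1 hy
    exact Prod.ext rfl (add_left_cancel (h1.trans h2.symm))
  rw [← Finset.sum_image (f := fun d => ‖MvPowerSeries.coeff d H‖ * b) hinj]
  refine Finset.sum_le_sum_of_subset_of_nonneg (fun d hd => ?_) fun d _ _ => by positivity
  obtain ⟨⟨p, q⟩, hx, rfl⟩ := Finset.mem_image.1 hd
  have h1 := Finset.HasAntidiagonal.mem_antidiagonal.1 hx
  exact Finset.mem_Iic.2 (le_self_add.trans h1.le)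

end Size

/-! ### Integration over the vertices -/

theorem rate_le_mul {a b c : ℝ} (hc : 0 < c) (h : c * (1 + |a|) ≤ 1 + |b|) :
    rate b ≤ c ^ (-(3 / 2) : ℝ) * rate a := by
  rw [rate, rate, ← Real.mul_rpow hc.le (by positivity)]
  exact Real.rpow_le_rpow_of_nonpos (by positivity) h (by norm_num)

/-- From 1 + |a| ≤ (1 + |T|)(1 + |a + b|). Points of a compact support can thus be moved to a common
time at the price of a constant. -/
theorem exists_rate_add_le (T : ℝ) : ∃ c, 0 < c ∧ ∀ a b : ℝ, |b| ≤ T →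
    rate (a + b) ≤ c * rate a := by
  refine ⟨(1 + |T|)⁻¹ ^ (-(3 / 2) : ℝ), Real.rpow_pos_of_pos (by positivity) _, fun a b hb => ?_⟩
  refine rate_le_mul (by positivity) ?_
  rw [inv_mul_le_iff₀ (by positivity)]
  have h1 : |a| ≤ |a + b| + |b| := by
    have := abs_sub (a + b) b
    rwa [add_sub_cancel_right] at this
  have h2 : |b| ≤ |T| := hb.trans (le_abs_self T)
  nlinarith [abs_nonneg (a + b), abs_nonneg T, abs_nonneg b]

/-- One of |x| and |x - s| is at least |s|/2. Integrated over x, this says that the convolution of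
the rate with itself is bounded by a multiple of the rate. -/
theorem exists_rate_mul_le : ∃ c, 0 < c ∧ ∀ x s : ℝ,
    rate (x - s) * rate x ≤ c * (rate s * (rate (x - s) + rate x)) := by
  refine ⟨(1 / 2 : ℝ) ^ (-(3 / 2) : ℝ), Real.rpow_pos_of_pos (by positivity) _, fun x s => ?_⟩
  set c := (1 / 2 : ℝ) ^ (-(3 / 2) : ℝ)
  have hc : 0 < c := Real.rpow_pos_of_pos (by positivity) _
  have h0 : |s| ≤ |x| + |x - s| := by
    have := abs_sub x (x - s)
    rwa [sub_sub_cancel] at this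
  have p1 := rate_nonneg s
  have p2 := rate_nonneg x
  have p3 := rate_nonneg (x - s)
  by_cases h : |x| ≤ |x - s|
  · have := rate_le_mul (a := s) (b := x - s) (c := 1 / 2) (by norm_num) (by linarith)
    nlinarith [mul_le_mul_of_nonneg_right this p2, mul_nonneg (mul_nonneg hc.le p1) p3]
  · push Not at h
    have := rate_le_mul (a := s) (b := x) (c := 1 / 2) (by norm_num) (by linarith)
    nlinarith [mul_le_mul_of_nonneg_left this p3, mul_nonneg (mul_nonneg hc.le p1) p2]

theorem integrable_rate : Integrable rate := by
  have := integrable_one_add_norm (E := ℝ) (μ := volume) (r := 3 / 2) (by simp; norm_num)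
  simp only [Real.norm_eq_abs] at this
  exact this

/-! ### Rooted trees of decaying links, integrated vertex by vertex -/

section Tree

open scoped ENNReal

variable {M : Type*}

/-- Each vertex is linked to an earlier one or to the root; one of the vertices or the root is
linked to the origin. -/
def treeWeight (φ : M → ℝ≥0∞) (g : M → M → ℝ≥0∞) (k G : M → ℝ≥0∞) (G₀ : ℝ≥0∞) {p : ℕ}
    (z : Fin p → M) : ℝ≥0∞ :=
  (∏ i, φ (z i) * ((∑ j, if j < i then g (z i) (z j) else 0) + k (z i))) * (∑ i, G (z i) + G₀)

theorem measurable_treeWeight [MeasurableSpace M] {φ : M → ℝ≥0∞} {g : M → M → ℝ≥0∞} {k G : M → ℝ≥0∞} (G₀ : ℝ≥0∞)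
    (hφ : Measurable φ) (hg : Measurable (Function.uncurry g)) (hk : Measurable k)
    (hG : Measurable G) (p : ℕ) :
    Measurable (treeWeight φ g k G G₀ : (Fin p → M) → ℝ≥0∞) := by
  unfold treeWeight
  have h1 : ∀ i : Fin p, Measurable fun z : Fin p → M => z i := fun i => measurable_pi_apply i
  have h2 : ∀ i j : Fin p, Measurable fun z : Fin p → M => g (z i) (z j) := fun i j =>
    hg.comp ((h1 i).prodMk (h1 j))
  refine Measurable.mul (Finset.measurable_fun_prod _ fun i _ => (hφ.comp (h1 i)).mul
    (Measurable.add (Finset.measurable_fun_sum _ fun j _ => ?_) (hk.comp (h1 i))))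
    ((Finset.measurable_fun_sum _ fun i _ => hG.comp (h1 i)).add_const _)
  by_cases hj : j < i
  · simpa only [if_pos hj] using h2 i j
  · simpa only [if_neg hj] using measurable_const

theorem treeWeight_snoc (φ : M → ℝ≥0∞) (g : M → M → ℝ≥0∞) (k G : M → ℝ≥0∞) (G₀ : ℝ≥0∞) {p : ℕ}
    (y : Fin p → M) (x : M) : treeWeight φ g k G G₀ (Fin.snoc y x : Fin (p + 1) → M) =
      (∏ i, φ (y i) * ((∑ j, if j < i then g (y i) (y j) else 0) + k (y i))) *
        ((∑ j, (φ x * g x (y j) * (∑ i, G (y i) + G₀) + φ x * g x (y j) * G x)) +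
          (φ x * k x * (∑ i, G (y i) + G₀) + φ x * k x * G x)) := by
  have h : ∀ i : Fin p, ¬ Fin.last p < i.castSucc := fun i => (Fin.castSucc_lt_last i).not_gt
  simp only [treeWeight, Fin.prod_univ_castSucc, Fin.sum_univ_castSucc, Fin.snoc_castSucc,
    Fin.snoc_last, Fin.castSucc_lt_castSucc_iff, Fin.castSucc_lt_last, if_true, lt_irrefl, if_false,
    add_zero, h]
  simp only [← mul_add, ← Finset.mul_sum, ← Finset.sum_mul]
  ring

/-- No vertex is linked to the last one, so it can be integrated out first. Its link either
disappears (`g1`, `k1`) or, when it carried the link to the origin, hands that link on to its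
partner (`g2`, `k2`). Its p + 1 possible partners give p + 1 times the remaining sum, and the links
handed on give that sum once more; hence p + 2. -/
theorem lintegral_treeWeight_le [MeasureSpace M] [SigmaFinite (volume : Measure M)] {φ : M → ℝ≥0∞}
    {g : M → M → ℝ≥0∞} {k G : M → ℝ≥0∞} {G₀ C : ℝ≥0∞}
    (hφ : Measurable φ) (hg : Measurable (Function.uncurry g)) (hk : Measurable k)
    (hG : Measurable G) (g1 : ∀ y, ∫⁻ x, φ x * g x y ≤ C) (k1 : ∫⁻ x, φ x * k x ≤ C)
    (g2 : ∀ y, ∫⁻ x, φ x * g x y * G x ≤ C * G y) (k2 : ∫⁻ x, φ x * k x * G x ≤ C * G₀) (p : ℕ) :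
    ∫⁻ z : Fin p → M, treeWeight φ g k G G₀ z ≤ (∏ i ∈ Finset.range p, ((i + 2 : ℕ) * C)) * G₀ := by
  induction p with
  | zero => simp [treeWeight, volume_pi]
  | succ p ih =>
    have mp := volume_preserving_piFinSuccAbove (fun _ : Fin (p + 1) => M) (Fin.last p)
    rw [← mp.symm.lintegral_comp_emb (MeasurableEquiv.measurableEmbedding _)]
    have hm := (measurable_treeWeight G₀ hφ hg hk hG (p + 1)).comp
      (MeasurableEquiv.piFinSuccAbove (fun _ : Fin (p + 1) => M) (Fin.last p)).symm.measurable
    have e := lintegral_prod_symm' (μ := (volume : Measure M))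
      (ν := (volume : Measure (Fin p → M))) _ hm
    refine le_trans (le_of_eq e) ?_
    have hs : ∀ (y : Fin p → M) (x : M),
        (MeasurableEquiv.piFinSuccAbove (fun _ : Fin (p + 1) => M) (Fin.last p)).symm (x, y) =
          Fin.snoc y x := fun y x => Fin.insertNth_last' x y
    have hgx : ∀ y, Measurable fun x => g x y := fun y => hg.comp (measurable_id.prodMk measurable_const)
    have inner : ∀ y : Fin p → M, ∫⁻ x, treeWeight φ g k G G₀ (Fin.snoc y x : Fin (p + 1) → M) ≤
        ((p + 2 : ℕ) * C) * treeWeight φ g k G G₀ y := fun y => by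
      set S := ∑ i, G (y i) + G₀ with hS
      have m1 : ∀ j, Measurable fun x => φ x * g x (y j) := fun j => hφ.mul (hgx _)
      simp only [treeWeight_snoc]
      rw [lintegral_const_mul _ (by fun_prop), lintegral_add_left (by fun_prop),
        lintegral_finsetSum _ (fun j _ => by fun_prop)]
      have b1 : ∀ j, ∫⁻ x, (φ x * g x (y j) * S + φ x * g x (y j) * G x) ≤
          C * S + C * G (y j) := fun j => by
        rw [lintegral_add_left ((m1 j).mul_const _), lintegral_mul_const _ (m1 j)]
        exact add_le_add (mul_le_mul_left (g1 _) _) (g2 _)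
      have b2 : ∫⁻ x, (φ x * k x * S + φ x * k x * G x) ≤ C * S + C * G₀ := by
        have m2 : Measurable fun x => φ x * k x := hφ.mul hk
        rw [lintegral_add_left (m2.mul_const _), lintegral_mul_const _ m2]
        exact add_le_add (mul_le_mul_left k1 _) k2
      calc _ ≤ (∏ i, φ (y i) * ((∑ j, if j < i then g (y i) (y j) else 0) + k (y i))) *
            ((∑ j, (C * S + C * G (y j))) + (C * S + C * G₀)) := by
            gcongr with j _
            exact b1 j
        _ = _ := by
            have e1 : ∑ j, (C * S + C * G (y j)) = (p : ℝ≥0∞) * (C * S) + C * ∑ i, G (y i) := by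
              rw [Finset.sum_add_distrib, ← Finset.mul_sum Finset.univ (fun j => G (y j))]
              simp
            rw [treeWeight, ← hS, e1]
            have : (p : ℝ≥0∞) * (C * S) + C * ∑ i, G (y i) + (C * S + C * G₀) =
                ((p + 2 : ℕ) * C) * S := by
              push_cast
              rw [show C * S + C * G₀ = C * G₀ + C * S from add_comm _ _, ← add_assoc, add_assoc (_ * _),
                ← mul_add, ← hS]
              ring
            rw [this]
            ring
    calc _ ≤ ∫⁻ y : Fin p → M, ((p + 2 : ℕ) * C) * treeWeight φ g k G G₀ y := by
          refine lintegral_mono fun y => ?_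
          simp only [Function.comp_apply, hs]
          exact inner y
      _ = ((p + 2 : ℕ) * C) * ∫⁻ y : Fin p → M, treeWeight φ g k G G₀ y :=
          lintegral_const_mul _ (measurable_treeWeight G₀ hφ hg hk hG p)
      _ ≤ ((p + 2 : ℕ) * C) * ((∏ i ∈ Finset.range p, ((i + 2 : ℕ) * C)) * G₀) := by gcongr
      _ = _ := by rw [Finset.prod_range_succ]; ring

end Tree

section VertexIntegral

open scoped ENNReal

/-- The bound of the contractions of `p` vertices with weight `b` in space, of which each is linked
to a later one or to the time `t`. -/
def treeBound (b : Space → ℝ) {p : ℕ} (r : Equiv.Perm (Fin p)) (t : ℝ) (z : Fin p → Spacetime) : ℝ :=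
  (∏ i, b (z i).2 * ((∑ j, if r j < r i then rate ((z i).1 - (z j).1) else 0) +
    rate ((z i).1 - t))) * (∑ i, rate (z i).1 + rate t)

theorem ofReal_treeBound {b : Space → ℝ} (hb : ∀ x, 0 ≤ b x) {p : ℕ} (r : Equiv.Perm (Fin p))
    (t : ℝ) (z : Fin p → Spacetime) : ENNReal.ofReal (treeBound b r t z) =
      treeWeight (fun x : Spacetime => ENNReal.ofReal (b x.2))
        (fun x y => ENNReal.ofReal (rate (x.1 - y.1))) (fun x => ENNReal.ofReal (rate (x.1 - t)))
        (fun x => ENNReal.ofReal (rate x.1)) (ENNReal.ofReal (rate t)) (z ∘ r.symm) := by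
  have h0 : ∀ i j, 0 ≤ if r j < r i then rate ((z i).1 - (z j).1) else 0 := fun i j => by
    split_ifs
    exacts [rate_nonneg _, le_rfl]
  have h1 : ∀ i, 0 ≤ ∑ j, if r j < r i then rate ((z i).1 - (z j).1) else 0 := fun i =>
    Finset.sum_nonneg fun j _ => h0 i j
  have h2 : 0 ≤ ∑ i, rate (z i).1 := Finset.sum_nonneg fun i _ => rate_nonneg _
  rw [treeBound, treeWeight, ENNReal.ofReal_mul' (add_nonneg h2 (rate_nonneg t)),
    ENNReal.ofReal_prod_of_nonneg fun i _ =>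
      mul_nonneg (hb _) (add_nonneg (h1 i) (rate_nonneg _)),
    ENNReal.ofReal_add h2 (rate_nonneg t), ENNReal.ofReal_sum_of_nonneg fun i _ => rate_nonneg _]
  congr 1
  · refine Fintype.prod_equiv r _ _ fun i => ?_
    rw [ENNReal.ofReal_mul (hb _), ENNReal.ofReal_add (h1 i) (rate_nonneg _),
      ENNReal.ofReal_sum_of_nonneg fun j _ => h0 i j]
    simp only [Function.comp_apply, Equiv.symm_apply_apply]
    congr 2
    refine Fintype.sum_equiv r _ _ fun j => ?_
    split_ifs <;> simp
  · congr 1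
    exact Fintype.sum_equiv r _ _ fun j => by simp

theorem exists_lintegral_treeBound_le {b : Space → ℝ} (hb : ∀ x, 0 ≤ b x) (hbc : Continuous b)
    (hbi : Integrable b) (p : ℕ) : ∃ C, 0 ≤ C ∧ ∀ (r : Equiv.Perm (Fin p)) (t : ℝ),
      ∫⁻ z, ENNReal.ofReal (treeBound b r t z) ≤ ENNReal.ofReal (C * rate t) := by
  obtain ⟨c, hc, hrate⟩ := exists_rate_mul_le
  have mr : Measurable rate := continuous_rate.measurable
  have mb : Measurable b := hbc.measurable
  set I : ℝ := (∫ x, b x) * ∫ s, rate s with hI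
  have hI0 : 0 ≤ I := mul_nonneg (integral_nonneg hb) (integral_nonneg rate_nonneg)
  have e0 : ∫⁻ s, ENNReal.ofReal (rate s) = ENNReal.ofReal (∫ s, rate s) :=
    (ofReal_integral_eq_lintegral_ofReal integrable_rate (ae_of_all _ rate_nonneg)).symm
  have e1 : ∀ s : ℝ, ∫⁻ x : Spacetime, ENNReal.ofReal (b x.2) * ENNReal.ofReal (rate (x.1 - s)) =
      ENNReal.ofReal I := fun s => by
    have h := lintegral_prod_mul (μ := (volume : Measure ℝ)) (ν := (volume : Measure Space))
      (f := fun u => ENNReal.ofReal (rate (u - s))) (g := fun x => ENNReal.ofReal (b x))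
      (by fun_prop) (by fun_prop)
    rw [lintegral_sub_right_eq_self (fun u => ENNReal.ofReal (rate u)) s, e0,
      ← ofReal_integral_eq_lintegral_ofReal hbi (ae_of_all _ hb),
      ← ENNReal.ofReal_mul (integral_nonneg rate_nonneg), mul_comm] at h
    rw [hI, ← h]
    refine lintegral_congr fun x => ?_
    rw [mul_comm]
  have e2 : ∀ s : ℝ, ∫⁻ x : Spacetime, ENNReal.ofReal (b x.2) * ENNReal.ofReal (rate (x.1 - s)) *
      ENNReal.ofReal (rate x.1) ≤ ENNReal.ofReal ((1 + 2 * c) * I) * ENNReal.ofReal (rate s) :=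
    fun s => by
    have h0 := e1 0
    simp only [sub_zero] at h0
    calc _ ≤ ∫⁻ x : Spacetime, ENNReal.ofReal (c * rate s) *
          (ENNReal.ofReal (b x.2) * ENNReal.ofReal (rate (x.1 - s)) +
            ENNReal.ofReal (b x.2) * ENNReal.ofReal (rate x.1)) := by
          refine lintegral_mono fun x => ?_
          simp only
          rw [mul_assoc, ← ENNReal.ofReal_mul (rate_nonneg _), ← mul_add,
            ← ENNReal.ofReal_add (rate_nonneg _) (rate_nonneg _), mul_left_comm,
            ← ENNReal.ofReal_mul (mul_nonneg hc.le (rate_nonneg s)), mul_assoc c]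
          exact mul_le_mul_right (ENNReal.ofReal_le_ofReal (hrate x.1 s)) _
      _ = ENNReal.ofReal (c * rate s) * (ENNReal.ofReal I + ENNReal.ofReal I) := by
          rw [lintegral_const_mul _ (by fun_prop), lintegral_add_left (by fun_prop), e1, h0]
      _ = ENNReal.ofReal (2 * c * I) * ENNReal.ofReal (rate s) := by
          rw [← ENNReal.ofReal_add hI0 hI0, ← ENNReal.ofReal_mul (mul_nonneg hc.le (rate_nonneg s)),
            ← ENNReal.ofReal_mul (by positivity)]
          congr 1
          ring
      _ ≤ _ := by
          gcongr
          linarith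
  -- The constant (1 + 2c)I dominates both I, from integrating a single link, and 2cI, from the
  -- convolution of two.
  refine ⟨∏ i ∈ Finset.range p, ((i + 2 : ℕ) * ((1 + 2 * c) * I)), by positivity, fun r t => ?_⟩
  have mp : MeasurePreserving (fun z : Fin p → Spacetime => z ∘ r.symm) :=
    volume_preserving_arrowCongr' r (MeasurableEquiv.refl _) (.id _)
  simp only [ofReal_treeBound hb]
  rw [mp.lintegral_comp (measurable_treeWeight _ (by fun_prop) (by unfold Function.uncurry; fun_prop)
    (by fun_prop) (by fun_prop) p)]
  have hIle : ENNReal.ofReal I ≤ ENNReal.ofReal ((1 + 2 * c) * I) :=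
    ENNReal.ofReal_le_ofReal (by nlinarith [mul_nonneg hc.le hI0])
  refine (lintegral_treeWeight_le (C := ENNReal.ofReal ((1 + 2 * c) * I)) (by fun_prop)
    (by unfold Function.uncurry; fun_prop) (by fun_prop) (by fun_prop) (fun y => (e1 _).trans_le hIle)
    ((e1 _).trans_le hIle) (fun y => e2 _) (e2 _) p).trans_eq ?_
  have hK : 0 ≤ (1 + 2 * c) * I := by positivity
  rw [ENNReal.ofReal_mul (Finset.prod_nonneg fun i _ => mul_nonneg (Nat.cast_nonneg _) hK),
    ENNReal.ofReal_prod_of_nonneg fun i _ => mul_nonneg (Nat.cast_nonneg _) hK]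
  congr 1
  refine Finset.prod_congr rfl fun i _ => ?_
  rw [ENNReal.ofReal_mul (Nat.cast_nonneg _), ENNReal.ofReal_natCast]

end VertexIntegral

/-! ### The connected part of a quasifree state -/

/-- The observer `X ↦ L(A ⋆ X) - L(A) L(X)`. -/
def Observer.connected (L : Observer) (D : C(Spacetime, ℂ)) (A : Obs) : Observer where
  val κ _ m Y := (L.left D A).val κ m Y - pair L A * L.val κ m Y
  natural e m Y := by rw [(L.left D A).natural e, L.natural e]
  continuous_val m := ((L.left D A).continuous_val m).sub ((L.continuous_val m).const_smul (pair L A))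

theorem pair_connected (L : Observer) (D : C(Spacetime, ℂ)) (A X : Obs) :
    pair (L.connected D A) X = pair L (A.mul D X) - pair L A * pair L X := by
  classical
  rw [pair_mul, pair_eq_sum, pair_eq_sum (L.left D A), pair_eq_sum L X, DFinsupp.sum, DFinsupp.sum,
    DFinsupp.sum, Finset.mul_sum, ← Finset.sum_sub_distrib]
  refine Finset.sum_congr rfl fun i _ => ?_
  have h : ∀ L' : Observer, Integrable fun Y => X i Y * L'.val (Fin i.1) i.2 Y := fun L' =>
    ((X i).continuous.mul (L'.continuous_val i.2)).integrable_of_hasCompactSupport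
      (X i).hasCompactSupport.mul_right
  rw [← integral_const_mul, ← integral_sub (h _) ((h L).const_mul _)]
  congr 1
  funext Y
  change X i Y * ((L.left D A).val _ i.2 Y - pair L A * L.val _ i.2 Y) = _
  ring

/-- The quasifree functional with covariance `W` and mean `0`. -/
def gaussian (W : C(Spacetime, ℂ)) : Observer :=
  (Observer.field (fun _ => 0) continuous_const).deform W

theorem kmsState_eq_pair (P : Params) {β : ℝ} (hβ : 0 < β) (A : Obs) :
    kmsState P hβ A = pair (gaussian (thermal P hβ - vacuum P)) A := by
  rw [kmsState, vacuumState, gaussian, ← Observer.pair_deform]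
  exact Observer.eval_eq_pair _ continuous_const _

section Moments

variable {ι κ : Type} [Fintype ι] [Fintype κ]

/-- The moments of the field configuration `0`. -/
def zeroMoments (n : ι → ℕ) : ℂ := ∏ k, ((0 : ℝ) : ℂ) ^ n k

theorem norm_zeroMoments_le (n : ι → ℕ) : ‖zeroMoments n‖ ≤ 1 := by
  rw [zeroMoments, norm_prod]
  refine Finset.prod_le_one (fun _ _ => norm_nonneg _) fun k _ => ?_
  rcases Nat.eq_zero_or_pos (n k) with h | h
  · simp [h]
  · simp [h.ne']

theorem gaussian_val (W : C(Spacetime, ℂ)) (n : ι → ℕ) (X : ι → Spacetime) :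
    (gaussian W).val ι n X = wick (contr fun i j => (1 / 2 : ℂ) * W (X i - X j)) zeroMoments n :=
  rfl

theorem wick_const_mul (Q : ι → ι → ℂ) (a : ℂ) (μ : (ι → ℕ) → ℂ) (n : ι → ℕ) :
    wick (contr Q) (fun r => a * μ r) n = a * wick (contr Q) μ n := by
  rw [wick_contr, wick_contr, Finset.mul_sum]
  exact Finset.sum_congr rfl fun c _ => by ring

/-- Moments at the zero field are multiplicative over disjoint groups, so a product of expectations
is an expectation without crossing contractions. -/
theorem wick_zeroMoments_mul (K : ι → ι → ℂ) (H : κ → κ → ℂ) (n : ι → ℕ) (m : κ → ℕ) :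
    wick (contr K) zeroMoments n * wick (contr H) zeroMoments m =
      wick (contr (block K 0 H)) zeroMoments (Sum.elim n m) := by
  rw [← wick_block]
  have h0 : block (0 : ι → ι → ℂ) (0 : ι → κ → ℂ) (0 : κ → κ → ℂ) = 0 := by
    funext x y
    rcases x with i | i <;> rcases y with j | j <;> simp [block]
  have h1 : ∀ (n' : ι → ℕ) (m' : κ → ℕ), (zeroMoments (Sum.elim n' m') : ℂ) =
      zeroMoments m' * zeroMoments n' := fun n' m' => by
    simp [zeroMoments, Fintype.prod_sum_type, mul_comm]
  simp only [h0, contr_zero, wick_one, h1, wick_const_mul]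
  rw [← wick_const_mul]
  congr 1
  funext m'
  ring

/-- The contractions between two groups of points in a quasifree state. -/
def crossing (W D : C(Spacetime, ℂ)) (X : ι → Spacetime) (Y : κ → Spacetime) (i : ι) (j : κ) : ℂ :=
  D (X i - Y j) + ((1 / 2 : ℂ) * W (X i - Y j) + (1 / 2 : ℂ) * W (Y j - X i))

/-- Contractions inside each group are common to both terms and factor out. What truncation leaves
is the exponential of the crossing contractions minus 1. -/
theorem gaussian_point_val (W D : C(Spacetime, ℂ)) (n : ι → ℕ) (m : κ → ℕ) (X : ι → Spacetime)
    (Y : κ → Spacetime) : ((gaussian W).point D m Y).val ι n X -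
      (gaussian W).val ι n X * (gaussian W).val κ m Y =
      wick (contr (block (fun i j => (1 / 2 : ℂ) * W (X i - X j)) 0
        fun i j => (1 / 2 : ℂ) * W (Y i - Y j)) *
        (contr (block 0 (crossing W D X Y) 0) - 1)) zeroMoments (Sum.elim n m) := by
  have e : ((gaussian W).point D m Y).val ι n X =
      wick (contr (block 0 (fun i j => D (X i - Y j)) 0)) (wick (contr fun i j =>
        (1 / 2 : ℂ) * W (Sum.elim X Y i - Sum.elim X Y j)) zeroMoments) (Sum.elim n m) := rfl
  rw [e, gaussian_val, gaussian_val, wick_zeroMoments_mul, ← wick_mul, ← wick_sub]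
  congr 1
  rw [mul_sub, mul_one, ← contr_add, ← contr_add]
  congr 1
  refine contr_congr fun x y => ?_
  rcases x with i | i <;> rcases y with j | j <;> simp [block, crossing] <;> ring

end Moments

/-- The moments vanish like `(1 + |t|)^{-3/2}` when all the points are far from time `0`. -/
def Observer.Clusters (L : Observer) : Prop :=
  ∀ (κ : Type) [Fintype κ] (m : κ → ℕ) (R : ℝ), ∃ C, 0 ≤ C ∧ ∀ Y : κ → Spacetime,
    (∀ j, ‖(Y j).2‖ ≤ R) → ‖L.val κ m Y‖ ≤ C * ∑ j, rate (Y j).1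

/-- The factor of the inner contractions is bounded; the crossing factor minus 1 is linear in the
crossing propagators up to a bounded exponential, and these decay in the times of `Y` because `X`
stays bounded. -/
theorem exists_norm_gaussian_point_le {W D : C(Spacetime, ℂ)} (hW : Decays W) (hD : Decays D)
    {ι κ : Type} [Fintype ι] [Fintype κ] (n : ι → ℕ) (m : κ → ℕ) (R : ℝ) :
    ∃ C, 0 ≤ C ∧ ∀ (X : ι → Spacetime) (Y : κ → Spacetime), (∀ i, ‖X i‖ ≤ R) →
      (∀ j, ‖(Y j).2‖ ≤ R) → ‖((gaussian W).point D m Y).val ι n X -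
        (gaussian W).val ι n X * (gaussian W).val κ m Y‖ ≤ C * ∑ j, rate (Y j).1 := by
  obtain ⟨w, hw, bw⟩ := hW (R + R)
  obtain ⟨d, hd, bd⟩ := hD (R + R)
  obtain ⟨c, hc, hrate⟩ := exists_rate_add_le R
  set a : ℝ := (d + w) * c with ha
  have ha0 : 0 ≤ a := by positivity
  set N₁ : ℝ := (Fintype.card ι : ℝ) * Fintype.card ι * w + (Fintype.card κ : ℝ) * Fintype.card κ * w
  set N₂ : ℝ := (Fintype.card ι : ℝ) * (a * Fintype.card κ)
  refine ⟨‖fac (Sum.elim n m)‖ * (Real.exp N₁ * ((Fintype.card ι : ℝ) * a * Real.exp N₂)),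
    by positivity, fun X Y hX hY => ?_⟩
  have hXs : ∀ i, ‖(X i).2‖ ≤ R := fun i => (norm_snd_le _).trans (hX i)
  have hXt : ∀ i, |(X i).1| ≤ R := fun i => (norm_fst_le (X i)).trans (hX i)
  have sub_le : ∀ {u v : Spacetime}, ‖u.2‖ ≤ R → ‖v.2‖ ≤ R → ‖(u - v).2‖ ≤ R + R :=
    fun hu hv => (norm_sub_le _ _).trans (add_le_add hu hv)
  have hhalf : ∀ {u v : Spacetime}, ‖u.2‖ ≤ R → ‖v.2‖ ≤ R → ‖(1 / 2 : ℂ) * W (u - v)‖ ≤ w :=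
    fun {u v} hu hv => by
      have h1 := bw (u - v) (sub_le hu hv)
      have h2 := rate_le_one (u - v).1
      rw [norm_mul]
      norm_num
      nlinarith [rate_nonneg (u - v).1]
  have half : ‖(1 / 2 : ℂ)‖ = 1 / 2 := by norm_num
  have hcross : ∀ i j, ‖crossing W D X Y i j‖ ≤ a * rate (Y j).1 := fun i j => by
    have h1 := bw (X i - Y j) (sub_le (hXs i) (hY j))
    have h2 := bw (Y j - X i) (sub_le (hY j) (hXs i))
    have h3 := bd (X i - Y j) (sub_le (hXs i) (hY j))
    have e1 : rate (X i - Y j).1 ≤ c * rate (Y j).1 := by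
      rw [Prod.fst_sub, sub_eq_neg_add, ← rate_neg (Y j).1]
      exact hrate _ _ (hXt i)
    have e2 : rate (Y j - X i).1 ≤ c * rate (Y j).1 := by
      rw [Prod.fst_sub, sub_eq_add_neg]
      exact hrate _ _ (by rw [abs_neg]; exact hXt i)
    have n1 : ‖(1 / 2 : ℂ) * W (X i - Y j)‖ ≤ 1 / 2 * (w * rate (X i - Y j).1) := by
      rw [norm_mul, half]; linarith
    have n2 : ‖(1 / 2 : ℂ) * W (Y j - X i)‖ ≤ 1 / 2 * (w * rate (Y j - X i).1) := by
      rw [norm_mul, half]; linarith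
    have n3 := norm_add_le (D (X i - Y j))
      ((1 / 2 : ℂ) * W (X i - Y j) + (1 / 2 : ℂ) * W (Y j - X i))
    have n4 := norm_add_le ((1 / 2 : ℂ) * W (X i - Y j)) ((1 / 2 : ℂ) * W (Y j - X i))
    rw [crossing, ha]
    nlinarith [mul_le_mul_of_nonneg_left e1 hw, mul_le_mul_of_nonneg_left e2 hw,
      mul_le_mul_of_nonneg_left e1 hd]
  rw [gaussian_point_val]
  refine (norm_wick_le _ _ _ zero_le_one fun q _ => norm_zeroMoments_le q).trans ?_
  rw [mul_one, mul_assoc]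
  refine mul_le_mul_of_nonneg_left ?_ (norm_nonneg _)
  refine (size_mul_le _ _ _).trans ?_
  rw [mul_assoc]
  refine mul_le_mul ?_ ?_ (size_nonneg _ _) (Real.exp_pos _).le
  · refine (size_contr_le _ _).trans (Real.exp_le_exp.2 ?_)
    simp only [Fintype.sum_sum_type, block, Sum.elim_inl, Sum.elim_inr, Pi.zero_apply, norm_zero,
      Finset.sum_const_zero, add_zero, zero_add]
    refine add_le_add ?_ ?_
    · refine (Finset.sum_le_sum fun i _ => Finset.sum_le_sum fun j _ =>
        hhalf (hXs i) (hXs j)).trans_eq ?_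
      simp [mul_assoc]
    · refine (Finset.sum_le_sum fun i _ => Finset.sum_le_sum fun j _ =>
        hhalf (hY i) (hY j)).trans_eq ?_
      simp [mul_assoc]
  · refine (size_contr_sub_one_le _ _).trans ?_
    simp only [Fintype.sum_sum_type, block, Sum.elim_inl, Sum.elim_inr, Pi.zero_apply, norm_zero,
      Finset.sum_const_zero, add_zero, zero_add]
    have s1 : ∑ i, ∑ j, ‖crossing W D X Y i j‖ ≤
        (Fintype.card ι : ℝ) * (a * ∑ j, rate (Y j).1) := by
      refine (Finset.sum_le_sum fun i _ => Finset.sum_le_sum fun j _ => hcross i j).trans_eq ?_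
      simp [← Finset.mul_sum]
    have s2 : ∑ j, rate (Y j).1 ≤ Fintype.card κ := by
      refine (Finset.sum_le_sum fun j _ => rate_le_one _).trans_eq ?_
      simp
    have s3 : ∑ i, ∑ j, ‖crossing W D X Y i j‖ ≤ N₂ := s1.trans
      (mul_le_mul_of_nonneg_left (mul_le_mul_of_nonneg_left s2 ha0) (Nat.cast_nonneg _))
    refine (exp_sub_one_le (Finset.sum_nonneg fun i _ => Finset.sum_nonneg fun j _ =>
      norm_nonneg _) s3).trans ?_
    calc _ ≤ (Fintype.card ι : ℝ) * (a * ∑ j, rate (Y j).1) * Real.exp N₂ := by gcongr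
      _ = _ := by ring

theorem exists_norm_le_of_apply_ne_zero {l : ℕ} (f : Kernel l) :
    ∃ R, 0 ≤ R ∧ ∀ X, f X ≠ 0 → ∀ i, ‖X i‖ ≤ R := by
  obtain ⟨R, hR⟩ := f.hasCompactSupport.isCompact.isBounded.exists_norm_le
  refine ⟨|R|, abs_nonneg R, fun X hX i => ?_⟩
  exact (norm_le_pi_norm X i).trans ((hR X (subset_tsupport _ hX)).trans (le_abs_self R))

theorem clusters_connected_gaussian {W D : C(Spacetime, ℂ)} (hW : Decays W) (hD : Decays D)
    (A : Obs) : ((gaussian W).connected D A).Clusters := by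
  classical
  intro κ _ m R
  set L := gaussian W with hL
  have h1 : ∀ i : (l : ℕ) × (Fin l → ℕ), ∃ C, 0 ≤ C ∧ ∀ Y : κ → Spacetime,
      (∀ j, ‖(Y j).2‖ ≤ R) → ‖∫ X, A i X * ((L.point D m Y).val (Fin i.1) i.2 X -
        L.val (Fin i.1) i.2 X * L.val κ m Y)‖ ≤ C * ∑ j, rate (Y j).1 := fun i => by
    obtain ⟨R', hR', hA⟩ := exists_norm_le_of_apply_ne_zero (A i)
    obtain ⟨C, hC, hb⟩ := exists_norm_gaussian_point_le hW hD i.2 m (max R R')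
    have hint : Integrable fun X => ‖A i X‖ :=
      ((A i).continuous.integrable_of_hasCompactSupport (A i).hasCompactSupport).norm
    refine ⟨(∫ X, ‖A i X‖) * C, mul_nonneg (integral_nonneg fun _ => norm_nonneg _) hC,
      fun Y hY => ?_⟩
    rw [mul_assoc, ← integral_mul_const]
    refine norm_integral_le_of_norm_le (hint.mul_const _) (ae_of_all _ fun X => ?_)
    by_cases hX : A i X = 0
    · simp [hX]
    · rw [norm_mul]
      exact mul_le_mul_of_nonneg_left (hb X Y (fun i => (hA X hX i).trans (le_max_right _ _))
        fun j => (hY j).trans (le_max_left _ _)) (norm_nonneg _)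
  choose C hC hb using h1
  refine ⟨∑ i ∈ A.support, C i, Finset.sum_nonneg fun i _ => hC i, fun Y hY => ?_⟩
  have h2 : (L.connected D A).val κ m Y = ∑ i ∈ A.support, ∫ X, A i X *
      ((L.point D m Y).val (Fin i.1) i.2 X - L.val (Fin i.1) i.2 X * L.val κ m Y) := by
    change pair (L.point D m Y) A - pair L A * L.val κ m Y = _
    rw [pair_eq_sum, pair_eq_sum, DFinsupp.sum, DFinsupp.sum, Finset.sum_mul,
      ← Finset.sum_sub_distrib]
    refine Finset.sum_congr rfl fun i _ => ?_
    have h : ∀ L' : Observer, Integrable fun X => A i X * L'.val (Fin i.1) i.2 X := fun L' =>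
      ((A i).continuous.mul (L'.continuous_val i.2)).integrable_of_hasCompactSupport
        (A i).hasCompactSupport.mul_right
    rw [← integral_mul_const, ← integral_sub (h _) ((h L).mul_const _)]
    congr 1
    funext X
    ring
  rw [h2, Finset.sum_mul]
  exact (norm_sum_le _ _).trans (Finset.sum_le_sum fun i _ => hb i Y hY)

/-! ### Clustering of the interacting evolution -/

section Symbol

variable {ι κ : Type} [Fintype ι] [Fintype κ]

theorem sum_norm_row (x : ι) (a : ι → ℂ) : ∑ y, ∑ y', ‖row x a y y'‖ = ∑ y', ‖a y'‖ := by
  classical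
  rw [Finset.sum_eq_single x]
  · simp [row]
  · intro y _ hy
    simp [row, hy]
  · simp

/-- Both exponentials are 1 up to terms of first order in their links; the two ones cancel. -/
theorem size_contr_row_sub_le (N : ι →₀ ℕ) (x : ι) {a b : ι → ℂ} {s S : ℝ}
    (ha : ∑ y, ‖a y‖ ≤ s) (hb : ∑ y, ‖b y‖ ≤ s) (hs : s ≤ S) :
    size N (contr (row x a) - contr (row x b)) ≤ 2 * s * Real.exp S := by
  have h : ∀ c : ι → ℂ, ∑ y, ‖c y‖ ≤ s → size N (contr (row x c) - 1) ≤ s * Real.exp S := by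
    intro c hc
    have h0 : 0 ≤ ∑ y, ‖c y‖ := Finset.sum_nonneg fun _ _ => norm_nonneg _
    refine (size_contr_sub_one_le _ _).trans ?_
    rw [sum_norm_row]
    refine (exp_sub_one_le h0 (hc.trans hs)).trans ?_
    gcongr
  rw [← sub_sub_sub_cancel_right _ _ (1 : MvPowerSeries ι ℂ)]
  linarith [size_sub_le N (contr (row x a) - 1) (contr (row x b) - 1), h a ha, h b hb]

/-- The quantitative form of connectedness: each vertex pays one rate, for a link to a later vertex
or to a point of `Y`. -/
theorem exists_size_groupSymbol_le (P : Params) (p : ℕ) (N : Fin p ⊕ κ →₀ ℕ) (R : ℝ) :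
    ∃ C, 0 ≤ C ∧ ∀ (r : Equiv.Perm (Fin p)) (z : Fin p → Spacetime) (Y : κ → Spacetime),
      TimeOrdered r z → (∀ i, ‖(z i).2‖ ≤ R) → (∀ y, ‖(Y y).2‖ ≤ R) →
      size N (groupSymbol (antiFeynman P) (feynman P) (vacuum P) (feynman P) z Y) ≤
        ∏ i, (C * ((∑ j, if r j < r i then rate ((z i).1 - (z j).1) else 0) +
          ∑ y, rate ((z i).1 - (Y y).1))) := by
  obtain ⟨d₁, hd₁, b₁⟩ := decays_vacuum P (R + R)
  obtain ⟨d₂, hd₂, b₂⟩ := decays_feynman P (R + R)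
  set d := d₁ + d₂ with hd
  have hd0 : 0 ≤ d := by positivity
  set S : ℝ := d * ((p : ℝ) + Fintype.card κ) with hS
  refine ⟨2 * d * Real.exp S, by positivity, fun r z Y hr hz hY => ?_⟩
  have sub_le : ∀ {u v : Spacetime}, ‖u.2‖ ≤ R → ‖v.2‖ ≤ R → ‖(u - v).2‖ ≤ R + R :=
    fun hu hv => (norm_sub_le _ _).trans (add_le_add hu hv)
  have hv : ∀ {u v : Spacetime}, ‖u.2‖ ≤ R → ‖v.2‖ ≤ R →
      ‖vacuum P (u - v)‖ ≤ d * rate (u.1 - v.1) := fun {u v} hu hv => by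
    refine (b₁ _ (sub_le hu hv)).trans ?_
    exact mul_le_mul_of_nonneg_right (by linarith) (rate_nonneg _)
  have hf : ∀ {u v : Spacetime}, ‖u.2‖ ≤ R → ‖v.2‖ ≤ R →
      ‖feynman P (u - v)‖ ≤ d * rate (u.1 - v.1) := fun {u v} hu hv => by
    refine (b₂ _ (sub_le hu hv)).trans ?_
    exact mul_le_mul_of_nonneg_right (by linarith) (rate_nonneg _)
  rw [groupSymbol_bogoliubov P hr]
  refine (size_prod_le _ _ _).trans (Finset.prod_le_prod (fun i _ => size_nonneg _ _) fun i _ => ?_)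
  set q := (∑ j, if r j < r i then rate ((z i).1 - (z j).1) else 0) +
    ∑ y, rate ((z i).1 - (Y y).1) with hq
  have h1 : ∑ y, ‖rowFirst P r z Y i y‖ ≤ d * q := by
    rw [Fintype.sum_sum_type, hq, mul_add, Finset.mul_sum, Finset.mul_sum]
    refine add_le_add (Finset.sum_le_sum fun j _ => ?_) (Finset.sum_le_sum fun y _ => ?_)
    · simp only [rowFirst, Sum.elim_inl]
      split_ifs
      · exact hv (hz i) (hz j)
      · simp
    · simp only [rowFirst, Sum.elim_inr]
      exact hv (hz i) (hY y)
  have h2 : ∑ y, ‖rowSecond P r z Y i y‖ ≤ d * q := by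
    rw [Fintype.sum_sum_type, hq, mul_add, Finset.mul_sum, Finset.mul_sum]
    refine add_le_add (Finset.sum_le_sum fun j _ => ?_) (Finset.sum_le_sum fun y _ => ?_)
    · simp only [rowSecond, Sum.elim_inl]
      split_ifs
      · rw [← rate_neg, neg_sub]
        exact hv (hz j) (hz i)
      · simp
    · simp only [rowSecond, Sum.elim_inr]
      exact hf (hz i) (hY y)
  have h3 : q ≤ (p : ℝ) + Fintype.card κ := by
    refine add_le_add ?_ ?_
    · refine (Finset.sum_le_sum (g := fun _ => (1 : ℝ)) fun j _ => ?_).trans_eq (by simp)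
      split_ifs
      exacts [rate_le_one _, zero_le_one]
    · exact (Finset.sum_le_sum fun y _ => rate_le_one _).trans_eq (by simp)
  refine (size_contr_row_sub_le N _ h1 h2 (mul_le_mul_of_nonneg_left h3 hd0)).trans_eq ?_
  rw [hS]
  ring

end Symbol

theorem continuous_treeBound {b : Space → ℝ} (hb : Continuous b) {p : ℕ} (r : Equiv.Perm (Fin p))
    (t : ℝ) : Continuous (treeBound b r t) := by
  have hr := continuous_rate
  have h : ∀ i j, Continuous fun z : Fin p → Spacetime =>
      if r j < r i then rate ((z i).1 - (z j).1) else 0 := fun i j => by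
    by_cases hij : r j < r i
    · simp only [if_pos hij]; fun_prop
    · simp only [if_neg hij]; fun_prop
  unfold treeBound
  fun_prop

theorem treeBound_nonneg {b : Space → ℝ} (hb : ∀ x, 0 ≤ b x) {p : ℕ} (r : Equiv.Perm (Fin p))
    (t : ℝ) (z : Fin p → Spacetime) : 0 ≤ treeBound b r t z := by
  refine mul_nonneg (Finset.prod_nonneg fun i _ => mul_nonneg (hb _) (add_nonneg
    (Finset.sum_nonneg fun j _ => ?_) (rate_nonneg _)))
    (add_nonneg (Finset.sum_nonneg fun i _ => rate_nonneg _) (rate_nonneg _))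
  split_ifs
  exacts [rate_nonneg _, le_rfl]

theorem norm_integral_le_of_treeBound {b : Space → ℝ} (hb : ∀ x, 0 ≤ b x) (hbc : Continuous b)
    (hbi : Integrable b) (p : ℕ) : ∃ C, 0 ≤ C ∧ ∀ (K t : ℝ) (F : (Fin p → Spacetime) → ℂ), 0 ≤ K →
      (∀ z, ∃ r : Equiv.Perm (Fin p), ‖F z‖ ≤ K * treeBound b r t z) →
      ‖∫ z, F z‖ ≤ K * C * rate t := by
  obtain ⟨C, hC, hbd⟩ := exists_lintegral_treeBound_le hb hbc hbi p
  -- The time order depends on the configuration z; bounding by the sum over all permutations avoids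
  -- any measurable choice and costs p!.
  refine ⟨p.factorial * C, by positivity, fun K t F hK hF => ?_⟩
  have h1 : ‖∫ z, F z‖ₑ ≤ ENNReal.ofReal (K * (p.factorial * C) * rate t) := by
    calc ‖∫ z, F z‖ₑ ≤ ∫⁻ z, ‖F z‖ₑ := enorm_integral_le_lintegral_enorm F
      _ ≤ ∫⁻ z, ENNReal.ofReal K * ∑ r : Equiv.Perm (Fin p), ENNReal.ofReal (treeBound b r t z) := by
          refine lintegral_mono fun z => ?_
          obtain ⟨r, hr⟩ := hF z
          rw [← ofReal_norm]
          refine (ENNReal.ofReal_le_ofReal hr).trans ?_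
          rw [ENNReal.ofReal_mul hK]
          gcongr
          exact Finset.single_le_sum
            (f := fun r : Equiv.Perm (Fin p) => ENNReal.ofReal (treeBound b r t z))
            (fun _ _ => zero_le) (Finset.mem_univ r)
      _ = ENNReal.ofReal K * ∑ r : Equiv.Perm (Fin p), ∫⁻ z, ENNReal.ofReal (treeBound b r t z) := by
          have hm : ∀ r : Equiv.Perm (Fin p), Measurable fun z => ENNReal.ofReal (treeBound b r t z) :=
            fun r => (continuous_treeBound hbc r t).measurable.ennreal_ofReal
          rw [lintegral_const_mul _ (Finset.measurable_fun_sum _ fun r _ => hm r),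
            lintegral_finsetSum _ fun r _ => hm r]
      _ ≤ ENNReal.ofReal K * ∑ _r : Equiv.Perm (Fin p), ENNReal.ofReal (C * rate t) := by
          gcongr with r _
          exact hbd r t
      _ = _ := by
          rw [Finset.sum_const, Finset.card_univ, Fintype.card_perm, Fintype.card_fin, nsmul_eq_mul,
            ← ENNReal.ofReal_natCast, ← ENNReal.ofReal_mul (Nat.cast_nonneg _),
            ← ENNReal.ofReal_mul hK]
          congr 1
          ring
  rw [← ofReal_norm] at h1
  exact (ENNReal.ofReal_le_ofReal_iff (mul_nonneg (by positivity) (rate_nonneg t))).1 h1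

/-- The main estimate. Each vertex is linked forward, ultimately to the time t of `Y`, while
clustering of `L` links a vertex or a point of `Y` to time 0. The constant sees the interaction only
through its spatial bound `b`, so it is uniform in the time cutoff. -/
theorem exists_norm_bogoliubovObserver_le (P : Params) (n : ℕ) {L : Observer} (hL : L.Clusters)
    {b : Space → ℝ} (hb : ∀ x, 0 ≤ b x) (hbc : Continuous b) (hbs : HasCompactSupport b) (p : ℕ)
    {κ : Type} [Fintype κ] (m : κ → ℕ) (R : ℝ) : ∃ C, 0 ≤ C ∧
      ∀ (V : Obs) (v : Spacetime → ℂ), IsVertex V v n → (∀ x, ‖v x‖ ≤ b x.2) →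
      ∀ (t : ℝ) (Y : κ → Spacetime), (∀ y, ‖(Y y).2‖ ≤ R) → (∀ y, |(Y y).1 - t| ≤ R) →
        ‖(bogoliubovObserver P V L p).val κ m Y‖ ≤ C * rate t := by
  classical
  obtain ⟨C₀, hC₀, hint⟩ := norm_integral_le_of_treeBound hb hbc (hbc.integrable_of_hasCompactSupport hbs) p
  obtain ⟨Rb, hRb⟩ := hbs.isCompact.isBounded.exists_norm_le
  set R' := max R Rb
  set M : Fin p ⊕ κ → ℕ := Sum.elim (fun _ => n) m with hM
  obtain ⟨C₁, hC₁, hsym⟩ := exists_size_groupSymbol_le (κ := κ) P p (multi M) R'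
  choose B hB hLB using fun q : Fin p ⊕ κ → ℕ => hL (Fin p ⊕ κ) q R'
  set B' := ∑ q ∈ Finset.Iic M, B q with hB'
  have hB'0 : 0 ≤ B' := Finset.sum_nonneg fun q _ => hB q
  obtain ⟨c, hc, hrate⟩ := exists_rate_add_le R
  set c₁ : ℝ := 1 + Fintype.card κ * c with hc₁
  have hc₁0 : 0 ≤ c₁ := by positivity
  have hc₁1 : 1 ≤ c₁ := le_add_of_nonneg_right (by positivity)
  set K : ℝ := ‖fac M‖ * (B' * c₁) * (C₁ * c₁) ^ p with hK
  have hK0 : 0 ≤ K := by positivity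
  refine ⟨‖Complex.I ^ p / (p.factorial : ℂ)‖ * (K * C₀), by positivity,
    fun V v hV hv t Y hY hYt => ?_⟩
  rw [bogoliubovObserver_val hV, norm_mul, mul_assoc]
  refine mul_le_mul_of_nonneg_left (hint K t _ hK0 fun z => ?_) (norm_nonneg _)
  obtain ⟨r, hr⟩ := exists_timeOrdered z
  refine ⟨r, ?_⟩
  -- Either all vertices have bounded positions, as the decay estimates require, or the weight of
  -- the configuration vanishes.
  by_cases hz : ∀ i, b (z i).2 ≠ 0
  · have hzR : ∀ i, ‖(z i).2‖ ≤ R' := fun i =>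
      (hRb _ (subset_tsupport _ (hz i))).trans (le_max_right _ _)
    have hYR : ∀ y, ‖(Y y).2‖ ≤ R' := fun y => (hY y).trans (le_max_left _ _)
    have e1 : ‖vprod v z‖ ≤ ∏ i, b (z i).2 := by
      rw [vprod, norm_prod]
      exact Finset.prod_le_prod (fun _ _ => norm_nonneg _) fun i _ => hv (z i)
    set s := ∑ i, rate (z i).1 + rate t with hs
    have hs0 : 0 ≤ s := add_nonneg (Finset.sum_nonneg fun i _ => rate_nonneg _) (rate_nonneg _)
    have hYr : ∀ y, rate (Y y).1 ≤ c * rate t := fun y => by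
      have := hrate t ((Y y).1 - t) (hYt y)
      rwa [add_sub_cancel] at this
    have e2 : ∑ x, rate (Sum.elim z Y x).1 ≤ c₁ * s := by
      rw [Fintype.sum_sum_type]
      simp only [Sum.elim_inl, Sum.elim_inr]
      have h1 : ∑ y, rate (Y y).1 ≤ Fintype.card κ * (c * rate t) :=
        (Finset.sum_le_sum fun y _ => hYr y).trans_eq (by simp)
      have h2 : 0 ≤ ∑ i, rate (z i).1 := Finset.sum_nonneg fun i _ => rate_nonneg _
      have h3 : 0 ≤ (Fintype.card κ : ℝ) * c := by positivity
      rw [hc₁, hs]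
      nlinarith [mul_nonneg h3 h2, rate_nonneg t]
    have e3 : ∀ q ≤ M, ‖L.val (Fin p ⊕ κ) q (Sum.elim z Y)‖ ≤ B' * (c₁ * s) := fun q hq => by
      refine (hLB q (Sum.elim z Y) fun x => ?_).trans ?_
      · rcases x with i | y
        exacts [hzR i, hYR y]
      · exact mul_le_mul (Finset.single_le_sum (f := B) (fun q _ => hB q) (Finset.mem_Iic.2 hq)) e2
          (Finset.sum_nonneg fun _ _ => rate_nonneg _) hB'0
    have e4 : size (multi M) (groupSymbol (antiFeynman P) (feynman P) (vacuum P) (feynman P) z Y) ≤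
        ∏ i, (C₁ * c₁ * ((∑ j, if r j < r i then rate ((z i).1 - (z j).1) else 0) +
          rate ((z i).1 - t))) := by
      have h0 : ∀ i, 0 ≤ ∑ j, if r j < r i then rate ((z i).1 - (z j).1) else 0 := fun i =>
        Finset.sum_nonneg fun j _ => by
          split_ifs
          exacts [rate_nonneg _, le_rfl]
      refine (hsym r z Y hr hzR hYR).trans (Finset.prod_le_prod (fun i _ => mul_nonneg hC₁
        (add_nonneg (h0 i) (Finset.sum_nonneg fun _ _ => rate_nonneg _))) fun i _ => ?_)
      rw [mul_assoc]
      refine mul_le_mul_of_nonneg_left ?_ hC₁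
      have h1 : ∑ y, rate ((z i).1 - (Y y).1) ≤ Fintype.card κ * (c * rate ((z i).1 - t)) := by
        refine (Finset.sum_le_sum fun y _ => ?_).trans_eq
          (show ∑ _y : κ, c * rate ((z i).1 - t) = _ by simp)
        have := hrate ((z i).1 - t) (t - (Y y).1) (by rw [abs_sub_comm]; exact hYt y)
        rwa [sub_add_sub_cancel] at this
      have h3 : 0 ≤ (Fintype.card κ : ℝ) * c := by positivity
      rw [hc₁]
      nlinarith [mul_nonneg h3 (h0 i), rate_nonneg ((z i).1 - t)]
    rw [norm_mul]
    calc _ ≤ (∏ i, b (z i).2) * (‖fac M‖ * ((∏ i, (C₁ * c₁ *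
          ((∑ j, if r j < r i then rate ((z i).1 - (z j).1) else 0) + rate ((z i).1 - t)))) *
            (B' * (c₁ * s)))) := by
          refine mul_le_mul e1 ?_ (norm_nonneg _) (Finset.prod_nonneg fun i _ => hb _)
          refine (norm_wick_le _ _ _ (by positivity) e3).trans ?_
          gcongr
      _ = K * treeBound b r t z := by
          rw [treeBound, ← hs, hK]
          simp only [Finset.prod_mul_distrib, Finset.prod_const, Finset.card_univ, Fintype.card_fin]
          generalize (∏ i : Fin p, ((∑ j, if r j < r i then rate ((z i).1 - (z j).1) else 0) +
            rate ((z i).1 - t))) = w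
          ring_nf
  · push Not at hz
    obtain ⟨i, hi⟩ := hz
    have : vprod v z = 0 := by
      refine Finset.prod_eq_zero (Finset.mem_univ i) (norm_le_zero_iff.1 ?_)
      exact (hv (z i)).trans_eq hi
    rw [this, zero_mul, norm_zero]
    exact mul_nonneg hK0 (treeBound_nonneg hb r t z)

theorem Observer.shift_val (L : Observer) (t : ℝ) {ι : Type} [Fintype ι] (n : ι → ℕ)
    (X : ι → Spacetime) :
    (L.shift t).val ι n X = L.val ι n fun i => X i + ((t, 0) : Spacetime) := rfl

theorem exists_norm_pair_bogoliubovObserver_le (P : Params) (n : ℕ) {L : Observer} (hL : L.Clusters)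
    {b : Space → ℝ} (hb : ∀ x, 0 ≤ b x) (hbc : Continuous b) (hbs : HasCompactSupport b) (p : ℕ)
    (A : Obs) : ∃ C, 0 ≤ C ∧ ∀ (V : Obs) (v : Spacetime → ℂ), IsVertex V v n →
      (∀ x, ‖v x‖ ≤ b x.2) → ∀ t : ℝ,
        ‖pair ((bogoliubovObserver P V L p).shift t) A‖ ≤ C * rate t := by
  classical
  choose R hR hA using fun i : (l : ℕ) × (Fin l → ℕ) => exists_norm_le_of_apply_ne_zero (A i)
  choose C hC hbd using fun i : (l : ℕ) × (Fin l → ℕ) =>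
    exists_norm_bogoliubovObserver_le P n hL hb hbc hbs p i.2 (R i)
  refine ⟨∑ i ∈ A.support, (∫ X, ‖A i X‖) * C i, Finset.sum_nonneg fun i _ =>
    mul_nonneg (integral_nonneg fun _ => norm_nonneg _) (hC i), fun V v hV hv t => ?_⟩
  rw [pair_eq_sum, DFinsupp.sum, Finset.sum_mul]
  refine (norm_sum_le _ _).trans (Finset.sum_le_sum fun i _ => ?_)
  have hint : Integrable fun X => ‖A i X‖ :=
    ((A i).continuous.integrable_of_hasCompactSupport (A i).hasCompactSupport).norm
  rw [mul_assoc, ← integral_mul_const]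
  refine norm_integral_le_of_norm_le (hint.mul_const _) (ae_of_all _ fun X => ?_)
  by_cases hX : A i X = 0
  · simp [hX]
  · rw [norm_mul]
    refine mul_le_mul_of_nonneg_left ?_ (norm_nonneg _)
    rw [Observer.shift_val]
    refine hbd i V v hV hv t _ (fun y => ?_) fun y => ?_
    · change ‖(X y).2 + 0‖ ≤ _
      rw [add_zero]
      exact (norm_snd_le (X y)).trans (hA i X hX y)
    · change |(X y).1 + t - t| ≤ _
      rw [add_sub_cancel_right]
      exact (norm_fst_le (X y)).trans (hA i X hX y)

/-! ### Time cutoffs -/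

/-- The bound by |χ| is essential: it makes the estimates uniform while the cutoff time grows with
t. -/
theorem exists_cutoff {χ : ℝ → ℝ} (hχ : Continuous χ) {a : ℝ} (hχ_zero : ∀ s, s ≤ a → χ s = 0)
    (T : ℝ) : ∃ χ' : C_c(ℝ, ℝ), (∀ s, s ≤ T → χ' s = χ s) ∧ ∀ s, |χ' s| ≤ |χ s| := by
  refine ⟨⟨⟨fun s => χ s * Real.smoothTransition (T + 1 - s), ?_⟩, ?_⟩, fun s hs => ?_, fun s => ?_⟩
  · exact hχ.mul (Real.smoothTransition.continuous.comp (by fun_prop))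
  · refine HasCompactSupport.intro (isCompact_Icc (a := a) (b := T + 1)) fun s hs => ?_
    rw [Set.mem_Icc, not_and_or, not_le, not_le] at hs
    change χ s * Real.smoothTransition (T + 1 - s) = 0
    rcases hs with hs | hs
    · rw [hχ_zero s hs.le, zero_mul]
    · rw [Real.smoothTransition.zero_of_nonpos (by linarith), mul_zero]
  · change χ s * Real.smoothTransition (T + 1 - s) = χ s
    rw [Real.smoothTransition.one_of_one_le (by linarith), mul_one]
  · change |χ s * Real.smoothTransition (T + 1 - s)| ≤ |χ s|
    rw [abs_mul, abs_of_nonneg (Real.smoothTransition.nonneg _)]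
    exact mul_le_of_le_one_right (abs_nonneg _) (Real.smoothTransition.le_one _)

theorem exists_abs_le_of_step {χ : ℝ → ℝ} (hχ : Continuous χ) {a b : ℝ}
    (hχ_zero : ∀ s, s ≤ a → χ s = 0) (hχ_one : ∀ s, b ≤ s → χ s = 1) :
    ∃ M, 0 ≤ M ∧ ∀ s, |χ s| ≤ M := by
  obtain ⟨M, hM⟩ := (isCompact_Icc (a := a) (b := b)).exists_bound_of_continuousOn hχ.continuousOn
  refine ⟨max M 1, le_max_of_le_right zero_le_one, fun s => ?_⟩
  rcases le_total s a with h | h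
  · rw [hχ_zero s h, abs_zero]
    exact le_max_of_le_right zero_le_one
  · rcases le_total b s with h' | h'
    · rw [hχ_one s h', abs_one]
      exact le_max_right _ _
    · exact (hM s ⟨h, h'⟩).trans (le_max_left _ _)

theorem rate_isBigO : rate =O[atTop] fun t : ℝ => t ^ (-(3 / 2) : ℝ) := by
  refine IsBigO.of_bound 1 ((eventually_gt_atTop 0).mono fun t ht => ?_)
  rw [one_mul, Real.norm_of_nonneg (rate_nonneg t), Real.norm_of_nonneg (by positivity), rate,
    abs_of_pos ht]
  exact Real.rpow_le_rpow_of_nonpos ht (by linarith) (by norm_num)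

/-- The connected expectation values of the interacting evolution decay. -/
theorem pair_evolveWith_isBigO (P : Params) (n : ℕ) (h : C_c(Space, ℝ)) {L : Observer}
    (hL : L.Clusters) (B : Series) (k : ℕ) {T M : ℝ} (hB : SupportedBefore B k T) (hM : 0 ≤ M)
    (χ₀ : C_c(ℝ, ℝ)) {χ : ℝ → C_c(ℝ, ℝ)} (hχ : ∀ t s, |χ t s| ≤ M)
    (hχ₀ : ∀ t s, s ≤ T → χ t s = χ₀ s) :
    (fun t => pair L (evolveWith P (interaction n (χ t) h) t B k)) =O[atTop]
      fun t : ℝ => t ^ (-(3 / 2) : ℝ) := by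
  -- The inverse Bogoliubov map sees only times up to `T`, where all the cutoffs agree with `χ₀`.
  -- After this rewriting the observables being evolved no longer depend on t.
  have e : (fun t => pair L (evolveWith P (interaction n (χ t) h) t B k)) = fun t =>
      ∑ p ∈ Finset.range (k + 1),
        pair ((bogoliubovObserver P (interaction n (χ t) h) L p).shift t)
          (bogoliubovInv P (interaction n χ₀ h) B (k - p)) := by
    funext t
    refine pair_evolveWith_eq (isVertex_interaction n (χ t) h) (isVertex_interaction n χ₀ h) hB
      (fun x hx => ?_) L t
    rw [hχ₀ t _ hx]
  rw [e]
  refine IsBigO.fun_sum fun p _ => IsBigO.trans ?_ rate_isBigO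
  have hb : HasCompactSupport fun x => M * |h x| := by
    refine h.hasCompactSupport.mono fun x hx => ?_
    contrapose! hx
    simp only [Function.mem_support, not_not] at hx ⊢
    rw [hx, abs_zero, mul_zero]
  obtain ⟨C, -, hC⟩ := exists_norm_pair_bogoliubovObserver_le P n hL (b := fun x => M * |h x|)
    (fun x => mul_nonneg hM (abs_nonneg _))
    (continuous_const.mul h.continuous.abs) hb p (bogoliubovInv P (interaction n χ₀ h) B (k - p))
  refine IsBigO.of_bound C (Eventually.of_forall fun t => ?_)
  rw [Real.norm_of_nonneg (rate_nonneg t)]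
  refine hC _ _ (isVertex_interaction n (χ t) h) (fun x => ?_) t
  rw [Complex.norm_real, Real.norm_eq_abs, abs_mul]
  exact mul_le_mul_of_nonneg_right (hχ t _) (abs_nonneg _)

/-- Both the star product and the product of expectations are Cauchy products, so the truncation can
be carried out termwise with the coefficients of `A`. -/
theorem coeff_kmsSeries_connected (P : Params) {β : ℝ} (hβ : 0 < β) (A B : Series) (k : ℕ) :
    PowerSeries.coeff k (kmsSeries P hβ (Series.star P A B) - kmsSeries P hβ A * kmsSeries P hβ B) =
      ∑ j ∈ Finset.range (k + 1), pair ((gaussian (thermal P hβ - vacuum P)).connected (vacuum P)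
        (A j)) (B (k - j)) := by
  simp only [pair_connected, Finset.sum_sub_distrib]
  rw [map_sub, PowerSeries.coeff_mul]
  simp only [kmsSeries, PowerSeries.coeff_mk, kmsState_eq_pair]
  rw [Finset.Nat.sum_antidiagonal_eq_sum_range_succ (fun a b =>
    pair (gaussian (thermal P hβ - vacuum P)) (A a) * pair (gaussian (thermal P hβ - vacuum P)) (B b)),
    Series.star, Series.mul, map_sum]

end QST

end

theorem mainTheorem5 (P : QST.Params) (β : ℝ) (hβ : 0 < β) (n : ℕ)
    (ε : ℝ) (hε : 0 < ε) (χ : ℝ → ℝ) (hχ : ContDiff ℝ ∞ χ)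
    (hχ_one : ∀ s, -ε ≤ s → χ s = 1) (hχ_zero : ∀ s, s ≤ -2 * ε → χ s = 0)
    (h : C_c(QST.Space, ℝ)) (hh : ContDiff ℝ ∞ h) (A B : QST.Series) :
    ∃ αB : ℝ → QST.Series,
      (∀ t : ℝ, QST.IsInteractingEvolution P n χ h t B (αB t)) ∧
      ∀ k : ℕ,
        Tendsto (fun t : ℝ => PowerSeries.coeff k
          (QST.kmsSeries P hβ (QST.Series.star P A (αB t)) -
            QST.kmsSeries P hβ A * QST.kmsSeries P hβ (αB t))) atTop (𝓝 0) ∧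
        (fun t : ℝ => PowerSeries.coeff k
          (QST.kmsSeries P hβ (QST.Series.star P A (αB t)) -
            QST.kmsSeries P hβ A * QST.kmsSeries P hβ (αB t)))
          =O[atTop] fun t : ℝ => t ^ (-(3 / 2) : ℝ) := by
  have hχc : Continuous χ := hχ.continuous
  obtain ⟨M, hM, hχM⟩ := QST.exists_abs_le_of_step hχc hχ_zero hχ_one
  choose T hT using QST.exists_supportedBefore B
  choose cut cut_eq cut_le using QST.exists_cutoff hχc hχ_zero
  -- At order k the cutoff leaves χ unchanged up to the latest time of the supports of `B`, plus |t|
  -- for the free evolution. By causality any cutoff with this property gives the same functional.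
  set αB : ℝ → QST.Series := fun t k =>
    QST.evolveWith P (QST.interaction n (cut (T k + |t|)) h) t B k with hαB
  have main : ∀ k, (fun t : ℝ => PowerSeries.coeff k
      (QST.kmsSeries P hβ (QST.Series.star P A (αB t)) -
        QST.kmsSeries P hβ A * QST.kmsSeries P hβ (αB t)))
      =O[atTop] fun t : ℝ => t ^ (-(3 / 2) : ℝ) := fun k => by
    simp only [QST.coeff_kmsSeries_connected]
    refine IsBigO.fun_sum fun j _ => QST.pair_evolveWith_isBigO P n h
      (QST.clusters_connected_gaussian ((QST.decays_thermal P hβ).sub (QST.decays_vacuum P))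
        (QST.decays_vacuum P) (A j)) B (k - j) (hT (k - j)) hM (cut (T (k - j)))
      (χ := fun t => cut (T (k - j) + |t|)) (fun t s => (cut_le _ s).trans (hχM s))
      fun t s hs => ?_
    rw [cut_eq _ s (by linarith [abs_nonneg t]), cut_eq _ s hs]
  refine ⟨αB, fun t k => ⟨T k + |t|, fun χ' _ hχ' φ => ?_⟩, fun k => ⟨?_, main k⟩⟩
  · rw [QST.Observer.eval_eq_pair _ φ.smooth.continuous,
      QST.Observer.eval_eq_pair _ φ.smooth.continuous]
    refine QST.pair_evolveWith_congr (QST.isVertex_interaction n χ' h)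
      (QST.isVertex_interaction n (cut (T k + |t|)) h) (hT k) (fun x hx => ?_) _
    rw [hχ' _ hx, cut_eq _ _ hx]
  · exact (main k).trans_tendsto (tendsto_rpow_neg_atTop (by norm_num))
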